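/- **Setting.** Variables are ordered $z_1<\dots<z_n$. A triangular set over a field $k$ is $T=\{t_1,\dots,t_n\}\subset k[z_1,\dots,z_n]$ such that $t_i$ involves only $z_1,\dots,z_i$, is non-constant and monic in $z_i$, and $\deg_{z_j}t_i<\deg_{z_j}t_j$ for $j<i$ (so it is zero-dimensional); $T_i=\{t_1,\dots,t_i\}$. It is radical if $\langle T\rangle$ is a radical ideal. Residue classes are represented by their reduced representatives, and reduction mod $p$, lifting, Chinese remaindering and rational reconstruction act on the coefficients of these. A prime $p$ is bad for $(T,a,b)$ if it divides a denominator in $T$, $a$ or $b$, or if the leading coefficient of $a$ or of $b$ (when nonzero) vanishes mod $p$. **Subroutines modulo $p$.** The *monic Euclidean algorithm* on $a,b\in(\mathbb{Z}_p[z_1,\dots,z_i]/T_i)[x]$ makes each divisor monic by inverting its leading coefficient (if $b=0$ it makes $a$ monic; $\gcd(0,0)=0$) and returns the last nonzero remainder. To invert $u\neq 0$ modulo $T_i$ it runs the extended version of itself on $t_i$ and $u$ as polynomials in $z_i$ over $\mathbb{Z}_p[z_1,\dots,z_{i-1}]/T_{i-1}$; if their monic gcd is not $1$, the whole computation stops and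 reports this gcd as a zero-divisor. The *radical prime test* checks, for $i=1,\dots,n$, with this algorithm that $\gcd(t_i,\partial t_i/\partial z_i)=1$ modulo $T_{i-1}$ and $p$; it, too, may report a zero-divisor. **Handling a zero-divisor** $u_0$ (monic, with main variable $z_j$): put $v_0=t_j/u_0$ modulo $T_{j-1},p$; set a global bound $B$ to $2^{60}$ the first time and to $B^2$ each later time; and Hensel-lift $t_j\equiv u_0v_0$. That is, solve $su_0+tv_0=1$ mod $p$ by the extended monic Euclidean algorithm (if this reports a new zero-divisor, handle that one instead; if the gcd is not $1$, report FAIL), and for $e=1,2,\dots$, with $u,v$ the lifts modulo $p^e$: if rational reconstruction of $u$ modulo $p^e$ yields $w$ with $w\mid t_j$ modulo $T_{j-1}$ over $\mathbb{Q}$, return the factorization $t_j=w\cdot(t_j/w)$; otherwise report FAIL if $p^e>2B$; otherwise lift $u,v$ to precision $p^{e+1}$. Rational reconstruction of $c$ modulo $m$ returns the rational number $r/s\equiv c \pmod m$ in lowest terms with $2r^2<m$, $2s^2<m$, $\gcd(s,m)=1$, or fails if there is none. **ModularC-GCD** on $(T,a,b)$: reduce $a,b$ modulo $T$ and swap them if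 $\deg a<\deg b$ or $a=0\ne b$; put $dg=\deg b$ ($dg=\deg a$ if $b=0$; $dg=0$ if $a=b=0$), $M=1$, $G=0$. Main loop: pick a prime $p$ not yet picked in this call; if $p$ is bad or is found not to be radical, go on to the next prime. Otherwise compute $g=\gcd(a,b)$ modulo $\langle T,p\rangle$ by the monic Euclidean algorithm. If a zero-divisor is reported in the radical test or in this computation, handle it: on FAIL go on to the next prime; on a factorization $t_j=wv$, form $T^{(w)},T^{(v)}$ by replacing $t_j$ by $w$, respectively $v$, and reducing the later $t_i$, and return the results of the recursive calls on $(T^{(w)},a,b)$ and $(T^{(v)},a,b)$ together. If no zero-divisor is reported (with $\deg 0$ read as $0$): if $\deg g>dg$, go on to the next prime; if $\deg g=dg$, combine $g$ with $G$ by Chinese remaindering and replace $M$ by $Mp$; if $\deg g<dg$, put $G=g$, $M=p$, $dg=\deg g$. In the last two cases let $h$ be the rational reconstruction of $G$ modulo $M$; if it exists and $h\mid a$ and $h\mid b$ in $(\mathbb{Q}[z_1,\dots,z_n]/T)[x]$, return $(T,h)$; otherwise go on to the next prime. **Theorem.** Let $T\subset\mathbb{Q}[z_1,\dots,z_n]$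 be a radical zero-dimensional triangular set, $R=\mathbb{Q}[z_1,\dots,z_n]/T$ and $a,b\in R[x]$. For every way of picking the primes such that no prime is picked twice within the main loop of one call, ModularC-GCD terminates on $(T,a,b)$, and its output $(T^{(1)},g_1),\dots,(T^{(r)},g_r)$ is a correct componentwise gcd of $a$ and $b$: the $T^{(i)}$ are radical triangular sets, their ideals are pairwise comaximal with $\bigcap_i\langle T^{(i)}\rangle=\langle T\rangle$, so that $R\cong\prod_i R_i$ with $R_i=\mathbb{Q}[z_1,\dots,z_n]/T^{(i)}$ via the natural projections, and for each $i$ the image of $g_i$ in $R_i[x]$ is a greatest common divisor of the images of $a$ and $b$ (it divides both, and every common divisor divides it) and is $0$ or has a unit as leading coefficient. -/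

import Mathlib

open Polynomial

noncomputable section

/-! ## Triangular sets and the rings they define -/

/-- A multivariate polynomial in `z_0, …, z_{n-1}` viewed as a univariate polynomial in `z_j`,
whose coefficients are polynomials in the other variables. -/
def viewAt {k : Type} [CommRing k] {n : ℕ} (j : Fin n) :
    MvPolynomial (Fin n) k →+* (MvPolynomial (Fin n) k)[X] :=
  MvPolynomial.eval₂Hom (Polynomial.C.comp MvPolynomial.C)
    (fun l => if l = j then Polynomial.X else Polynomial.C (MvPolynomial.X l))

/-- The inverse of `viewAt`: substitute `z_j` for the univariate variable. -/
def unviewAt {k : Type} [CommRing k] {n : ℕ} (j : Fin n)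
    (f : (MvPolynomial (Fin n) k)[X]) : MvPolynomial (Fin n) k :=
  f.eval (MvPolynomial.X j)

/-- (Reduced, zero-dimensional) triangular sets `{t_0, …, t_{n-1}} ⊂ k[z_0, …, z_{n-1}]`. -/
structure IsTriangularSet {k : Type} [CommRing k] {n : ℕ}
    (T : Fin n → MvPolynomial (Fin n) k) : Prop where
  /-- no variable larger than `z_i` occurs in `t_i` -/
  noLarger : ∀ i j, i < j → (T i).degreeOf j = 0
  /-- `z_i` does occur in `t_i`, so `z_i` is its main variable -/
  mainVar : ∀ i, 0 < (T i).degreeOf i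
  /-- `t_i` is monic with respect to `z_i` -/
  monic : ∀ i, (viewAt i (T i)).Monic
  /-- `t_i` is reduced with respect to the smaller `t_j` -/
  reduced : ∀ i j, j < i → (T i).degreeOf j < (T j).degreeOf j

/-- The ideal generated by the first `i` elements of `T`; for `i = n` this is `⟨T⟩`. -/
def triIdeal {k : Type} [CommRing k] {n : ℕ} (T : Fin n → MvPolynomial (Fin n) k) (i : ℕ) :
    Ideal (MvPolynomial (Fin n) k) :=
  Ideal.span (T '' {j | j.val < i})

/-- The ring `k[z_0, …, z_{n-1}] / ⟨t_0, …, t_{i-1}⟩`. It is a polynomial ring in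
`z_i, …, z_{n-1}` over `k[z_0, …, z_{i-1}] / ⟨t_0, …, t_{i-1}⟩`; below, computations at level
`i` only involve elements of the latter. For `i = n` this is `k[z] / ⟨T⟩`. -/
abbrev TriQuot {k : Type} [CommRing k] {n : ℕ} (T : Fin n → MvPolynomial (Fin n) k) (i : ℕ) :
    Type :=
  MvPolynomial (Fin n) k ⧸ triIdeal T i

/-- Coefficientwise projection modulo the first `i` elements of `T`. -/
def projPoly {k : Type} [CommRing k] {n : ℕ} (T : Fin n → MvPolynomial (Fin n) k) (i : ℕ) :
    (MvPolynomial (Fin n) k)[X] →+* (TriQuot T i)[X] :=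
  Polynomial.mapRingHom (Ideal.Quotient.mk (triIdeal T i))

open Classical in
/-- The normal form of a residue class modulo the first `i` elements of `T`: its (unique)
representative whose degree in `z_l` is smaller than that of `t_l`, for all `l < i`. -/
def normalForm {k : Type} [CommRing k] {n : ℕ} (T : Fin n → MvPolynomial (Fin n) k) (i : ℕ)
    (u : TriQuot T i) : MvPolynomial (Fin n) k :=
  if h : ∃ r : MvPolynomial (Fin n) k, Ideal.Quotient.mk (triIdeal T i) r = u ∧
      ∀ l : Fin n, l.val < i → r.degreeOf l < (T l).degreeOf l
  then h.choose else 0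

/-- Coefficientwise normal form of a univariate polynomial over a residue class ring. -/
def repPoly {k : Type} [CommRing k] {n : ℕ} (T : Fin n → MvPolynomial (Fin n) k) (i : ℕ)
    (f : (TriQuot T i)[X]) : (MvPolynomial (Fin n) k)[X] :=
  ∑ d ∈ f.support, Polynomial.monomial d (normalForm T i (f.coeff d))

/-- `t_j`, as a univariate polynomial in `z_j` over the residue class ring of level `j`. -/
def levelPoly {k : Type} [CommRing k] {n : ℕ} (T : Fin n → MvPolynomial (Fin n) k) (j : Fin n) :
    (TriQuot T j.val)[X] :=
  projPoly T j.val (viewAt j (T j))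

/-! ## Componentwise gcds -/

/-- `g` is a greatest common divisor of `a` and `b`. -/
def IsGreatestCommonDivisor {S : Type} [CommRing S] (a b g : S) : Prop :=
  g ∣ a ∧ g ∣ b ∧ ∀ c, c ∣ a → c ∣ b → c ∣ g

/-- Given a decomposition `e : R ≃ ∏ S i`, the tuple `g` is a componentwise gcd of
`a, b ∈ R[x]`. The leading coefficient of a component is a unit unless both inputs vanish in
that component. -/
def IsComponentwiseGCD {R : Type} [CommRing R] {m : ℕ} {S : Fin m → Type}
    [∀ i, CommRing (S i)] (e : R ≃+* (∀ i, S i)) (a b : R[X]) (g : ∀ i, (S i)[X]) : Prop :=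
  ∀ i, IsGreatestCommonDivisor
      (a.map ((Pi.evalRingHom S i).comp (e : R →+* (∀ i, S i))))
      (b.map ((Pi.evalRingHom S i).comp (e : R →+* (∀ i, S i)))) (g i) ∧
    (g i = 0 ∨ IsUnit (g i).leadingCoeff)

/-! ## Coefficientwise operations -/

/-- Apply `φ` to the nonzero coefficients of a multivariate polynomial. -/
def mapCoeffs {A B : Type} [CommRing A] [CommRing B] {n : ℕ} (φ : A → B)
    (f : MvPolynomial (Fin n) A) : MvPolynomial (Fin n) B :=
  ∑ e ∈ f.support, MvPolynomial.monomial e (φ (f.coeff e))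

/-- Apply `φ` to the nonzero coefficients of an element of `A[z_0, …, z_{n-1}][x]`. -/
def mapCoeffsPoly {A B : Type} [CommRing A] [CommRing B] {n : ℕ} (φ : A → B)
    (f : (MvPolynomial (Fin n) A)[X]) : (MvPolynomial (Fin n) B)[X] :=
  ∑ d ∈ f.support, Polynomial.monomial d (mapCoeffs φ (f.coeff d))

/-- Reduction modulo `p` of a rational number (meaningful if `p` does not divide its
denominator). -/
def ratMod (p : ℕ) (q : ℚ) : ZMod p := (q.num : ZMod p) * (q.den : ZMod p)⁻¹

/-- Reduction of `T` modulo `p`. -/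
def triMod {n : ℕ} (p : ℕ) (T : Fin n → MvPolynomial (Fin n) ℚ) :
    Fin n → MvPolynomial (Fin n) (ZMod p) :=
  fun j => mapCoeffs (ratMod p) (T j)

/-- Lift from `ℤ/p` to `ℤ`, coefficientwise, with values in `{0, …, p-1}`. -/
def liftInt {n : ℕ} (p : ℕ) (f : (MvPolynomial (Fin n) (ZMod p))[X]) :
    (MvPolynomial (Fin n) ℤ)[X] :=
  mapCoeffsPoly (fun z : ZMod p => (z.val : ℤ)) f

/-- Integer polynomials regarded as rational ones. -/
def intToRat {n : ℕ} (f : (MvPolynomial (Fin n) ℤ)[X]) : (MvPolynomial (Fin n) ℚ)[X] :=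
  f.map (MvPolynomial.map (Int.castRingHom ℚ))

open Classical in
/-- Rational number reconstruction of `c` modulo `m`: the (unique) rational number congruent to
`c` with numerator and denominator smaller than `√(m/2)` in absolute value, or `none` (FAIL). -/
def ratRecon (m : ℕ) (c : ℤ) : Option ℚ :=
  if h : ∃ q : ℚ, 2 * q.num ^ 2 < (m : ℤ) ∧ 2 * q.den ^ 2 < m ∧ Nat.Coprime q.den m ∧
      q.num ≡ c * (q.den : ℤ) [ZMOD (m : ℤ)]
  then some h.choose else none

open Classical in
/-- Coefficientwise rational reconstruction; it fails if it fails for some coefficient. -/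
def ratReconPoly {n : ℕ} (m : ℕ) (f : (MvPolynomial (Fin n) ℤ)[X]) :
    Option (MvPolynomial (Fin n) ℚ)[X] :=
  if ∀ d ∈ f.support, ∀ e ∈ (f.coeff d).support, (ratRecon m ((f.coeff d).coeff e)).isSome = true
  then some (mapCoeffsPoly (fun c => (ratRecon m c).getD 0) f) else none

/-- Chinese remaindering, for coprime `m` and `p`: the result is congruent to `G` modulo `m` and
to `g` modulo `p`. -/
def crtPoly {n : ℕ} (m p : ℕ) (G g : (MvPolynomial (Fin n) ℤ)[X]) :
    (MvPolynomial (Fin n) ℤ)[X] :=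
  ((p : ℤ) * Nat.gcdB m p) • G + ((m : ℤ) * Nat.gcdA m p) • g

/-! ## The monic Euclidean algorithm -/

open Classical in
/-- The loop of the monic extended Euclidean algorithm, over a ring with an inversion routine
`inv` which may report a zero-divisor. Its arguments are two consecutive rows
`(r_{i-1}, s_{i-1}, t_{i-1})` and `(r_i, s_i, t_i)` with `r = s a + t b`. -/
def euclidLoop {A W : Type} [CommRing A] (inv : A → Except W A) :
    ℕ → A[X] × A[X] × A[X] → A[X] × A[X] × A[X] → Except W (A[X] × A[X] × A[X])
  | 0, x, _ => .ok x
  | m + 1, (r₀, s₀, t₀), (r₁, s₁, t₁) =>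
    if r₁ = 0 then .ok (r₀, s₀, t₀) else
      match inv r₁.leadingCoeff with
      | .error w => .error w
      | .ok c =>
        let r := Polynomial.C c * r₁
        let s := Polynomial.C c * s₁
        let t := Polynomial.C c * t₁
        let q := r₀ /ₘ r
        euclidLoop inv m (r, s, t) (r₀ %ₘ r, s₀ - q * s, t₀ - q * t)

open Classical in
/-- The monic extended Euclidean algorithm: it returns `(g, s, t)` with `g = s a + t b` the monic
gcd (or `0` if `a = b = 0`), or the zero-divisor that was met. The degrees of the remainders
decrease, hence `deg b + 1` iterations are enough. -/
def monicEuclid {A W : Type} [CommRing A] (inv : A → Except W A) (a b : A[X]) :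
    Except W (A[X] × A[X] × A[X]) :=
  if b = 0 then
    if a = 0 then .ok (0, 0, 0) else
      match inv a.leadingCoeff with
      | .error w => .error w
      | .ok c => .ok (Polynomial.C c * a, Polynomial.C c, 0)
  else euclidLoop inv (b.natDegree + 1) (a, 1, 0) (b, 0, 1)

/-- A zero-divisor modulo `p`: its main variable `z_j`, and the zero-divisor itself as a
univariate polynomial in `z_j`. -/
abbrev ZeroDivisor (n p : ℕ) : Type := Fin n × (MvPolynomial (Fin n) (ZMod p))[X]

open Classical in
/-- Inversion modulo `p` and the first `i` elements of `T`: run the extended Euclidean algorithm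
on `t_{i-1}` and `u`, as polynomials in `z_{i-1}` over the ring of level `i - 1`. If the gcd is not
`1` then it is a monic zero-divisor, which is reported. -/
def invLevel {n : ℕ} (p : ℕ) (T : Fin n → MvPolynomial (Fin n) (ZMod p)) :
    (i : ℕ) → TriQuot T i → Except (ZeroDivisor n p) (TriQuot T i)
  | 0, u => .ok (Ideal.Quotient.mk _ (MvPolynomial.C ((normalForm T 0 u).coeff 0)⁻¹))
  | i + 1, u =>
    if h : i < n then
      match monicEuclid (invLevel p T i) (levelPoly T ⟨i, h⟩)
          (projPoly T i (viewAt ⟨i, h⟩ (normalForm T (i + 1) u))) with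
      | .error w => .error w
      | .ok (g, _, t) =>
        if g = 1 then .ok (Ideal.Quotient.mk _ (unviewAt ⟨i, h⟩ (repPoly T i t)))
        else .error (⟨i, h⟩, repPoly T i g)
    else .ok 0

open Classical in
/-- The radical prime test for the first `i` elements of `T` modulo `p`: check that `t_j` and its
derivative are coprime, for `j = 0, …, i - 1`. -/
def isRadicalPrime {n : ℕ} (p : ℕ) (T : Fin n → MvPolynomial (Fin n) (ZMod p)) :
    ℕ → Except (ZeroDivisor n p) Bool
  | 0 => .ok true
  | i + 1 =>
    match isRadicalPrime p T i with
    | .error w => .error w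
    | .ok false => .ok false
    | .ok true =>
      if h : i < n then
        match monicEuclid (invLevel p T i) (levelPoly T ⟨i, h⟩)
            (Polynomial.derivative (levelPoly T ⟨i, h⟩)) with
        | .error w => .error w
        | .ok (g, _, _) => .ok (decide (g = 1))
      else .ok true

/-! ## Hensel lifting -/

open Classical in
/-- The loop of Hensel lifting (at level `i`, with bound `B`), at precision `p ^ e`. The
precision grows, so at most `2 * B + 1` iterations take place. -/
def henselLoop {n : ℕ} (p B : ℕ) (T : Fin n → MvPolynomial (Fin n) ℚ) (i : ℕ)
    (f : (TriQuot T i)[X]) (a₀ b₀ s t : (TriQuot (triMod p T) i)[X]) :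
    ℕ → ℕ → (MvPolynomial (Fin n) ℤ)[X] → (MvPolynomial (Fin n) ℤ)[X] →
      Option ((MvPolynomial (Fin n) ℚ)[X] × (MvPolynomial (Fin n) ℚ)[X])
  | 0, _, _, _ => none
  | m + 1, e, u, v =>
    match (ratReconPoly (p ^ e) u).filter (fun a => decide (projPoly T i a ∣ f)) with
    | some a => some (a, repPoly T i (f /ₘ projPoly T i a))
    | none =>
      if 2 * B < p ^ e then none else
        let err := repPoly T i (f - projPoly T i (intToRat (u * v)))
        let c := projPoly (triMod p T) i
          (mapCoeffsPoly (fun q : ℚ => ratMod p (q / (p : ℚ) ^ e)) err)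
        let σ := (s * c) %ₘ b₀
        let τ := t * c + ((s * c) /ₘ b₀) * a₀
        henselLoop p B T i f a₀ b₀ s t m (e + 1)
          (u + (p : ℤ) ^ e • liftInt p (repPoly (triMod p T) i τ))
          (v + (p : ℤ) ^ e • liftInt p (repPoly (triMod p T) i σ))

open Classical in
/-- Hensel lifting of a factorization `f = a₀ b₀` modulo `p` at level `i`, with bound `B`. The
result is a zero-divisor, or FAIL (`none`), or a factorization of `f` over `ℚ`. -/
def henselLift {n : ℕ} (p B : ℕ) (T : Fin n → MvPolynomial (Fin n) ℚ) (i : ℕ)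
    (f : (TriQuot T i)[X]) (a₀ b₀ : (TriQuot (triMod p T) i)[X]) :
    Except (ZeroDivisor n p)
      (Option ((MvPolynomial (Fin n) ℚ)[X] × (MvPolynomial (Fin n) ℚ)[X])) :=
  match monicEuclid (invLevel p (triMod p T) i) a₀ b₀ with
  | .error w => .error w
  | .ok (g, s, t) =>
    if g = 1 then
      .ok (henselLoop p B T i f a₀ b₀ s t (2 * B + 1) 1
        (liftInt p (repPoly (triMod p T) i a₀)) (liftInt p (repPoly (triMod p T) i b₀)))
    else .ok none

/-- The bound `2 ^ 60` is used first, and squared each time. -/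
def nextBound : Option ℕ → ℕ
  | none => 2 ^ 60
  | some B => B ^ 2

/-- Handling of a zero-divisor met modulo `p`: try to lift it to a factorization `t_j = u v` over
`ℚ`. The result is `(j, u, v)` or FAIL (`none`), together with the new value of the global bound
`B`. If lifting meets another zero-divisor, that one (whose main variable is smaller) is
handled instead; so a nesting depth of `n` is enough. -/
def handleZeroDivisor {n : ℕ} (p : ℕ) (T : Fin n → MvPolynomial (Fin n) ℚ) :
    ℕ → Option ℕ → ZeroDivisor n p →
      Option (Fin n × (MvPolynomial (Fin n) ℚ)[X] × (MvPolynomial (Fin n) ℚ)[X]) × Option ℕ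
  | 0, B, _ => (none, B)
  | m + 1, B, (j, w) =>
    let a₀ := projPoly (triMod p T) j.val w
    match henselLift p (nextBound B) T j.val (levelPoly T j) a₀
        (levelPoly (triMod p T) j /ₘ a₀) with
    | .error w' => handleZeroDivisor p T m (some (nextBound B)) w'
    | .ok none => (none, some (nextBound B))
    | .ok (some (u, v)) => (some (j, u, v), some (nextBound B))

/-- The triangular set `T^(u)`: `t_j` is replaced by `u`, and `t_i` is reduced for `i > j`. -/
def splitAt {n : ℕ} (T : Fin n → MvPolynomial (Fin n) ℚ) (j : Fin n)
    (u : (MvPolynomial (Fin n) ℚ)[X]) : Fin n → MvPolynomial (Fin n) ℚ :=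
  fun i => if i ≤ j then Function.update T j (unviewAt j u) i
    else normalForm (Function.update T j (unviewAt j u)) i.val (Ideal.Quotient.mk _ (T i))

/-! ## The modular algorithm -/

/-- A prime is bad if it divides a denominator in `T`, `a` or `b`, or if the leading coefficient
of `a` or `b` vanishes modulo `p` (the zero polynomial has no leading coefficient). -/
def IsBadPrime {n : ℕ} (p : ℕ) (T : Fin n → MvPolynomial (Fin n) ℚ)
    (a b : (MvPolynomial (Fin n) ℚ)[X]) : Prop :=
  (∃ j e, p ∣ ((T j).coeff e).den) ∨
  (∃ d e, p ∣ ((a.coeff d).coeff e).den) ∨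
  (∃ d e, p ∣ ((b.coeff d).coeff e).den) ∨
  (a ≠ 0 ∧ mapCoeffs (ratMod p) a.leadingCoeff = 0) ∨
  (b ≠ 0 ∧ mapCoeffs (ratMod p) b.leadingCoeff = 0)

open Classical in
/-- Reduce `a` and `b` modulo `T`, and swap them if `deg a < deg b`. -/
def prepareInput {n : ℕ} (T : Fin n → MvPolynomial (Fin n) ℚ)
    (a b : (MvPolynomial (Fin n) ℚ)[X]) :
    (MvPolynomial (Fin n) ℚ)[X] × (MvPolynomial (Fin n) ℚ)[X] :=
  let a' := repPoly T n (projPoly T n a)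
  let b' := repPoly T n (projPoly T n b)
  if a'.degree < b'.degree then (b', a') else (a', b')

open Classical in
/-- The initial value of `dg`: the degree of `b`, or that of `a` if `b = 0`. -/
def initDegree {n : ℕ} (ab : (MvPolynomial (Fin n) ℚ)[X] × (MvPolynomial (Fin n) ℚ)[X]) : ℕ :=
  if ab.2 = 0 then ab.1.natDegree else ab.2.natDegree

/-- The output: triangular sets, each with a polynomial. -/
abbrev CGCDOutput (n : ℕ) : Type :=
  List ((Fin n → MvPolynomial (Fin n) ℚ) × (MvPolynomial (Fin n) ℚ)[X])

open Classical in
/-- The main loop of the modular algorithm, run for at most the given number of (nested)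
iterations; `none` means that this number was too small.

`P S i` is the `i`-th prime that is picked when the algorithm works modulo the triangular set `S`.
The state consists of the number `idx` of primes picked so far, the current degree `dg`, the
modulus `M`, the combined image `G`, and the global bound `B` for Hensel lifting (`none` if
unassigned). The output comes with the final value of `B`. -/
def mainLoop {n : ℕ} (P : (Fin n → MvPolynomial (Fin n) ℚ) → ℕ → ℕ) :
    ℕ → (T : Fin n → MvPolynomial (Fin n) ℚ) → (a b : (MvPolynomial (Fin n) ℚ)[X]) →
    (idx dg M : ℕ) → (G : (MvPolynomial (Fin n) ℤ)[X]) → (B : Option ℕ) →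
    Option (CGCDOutput n × Option ℕ)
  | 0, _, _, _, _, _, _, _, _ => none
  | m + 1, T, a, b, idx, dg, M, G, B =>
    let p := P T idx
    let Tp := triMod p T
    -- a recursive call, on the same inputs modulo another triangular set
    let call := fun (S : Fin n → MvPolynomial (Fin n) ℚ) (B' : Option ℕ) =>
      let ab := prepareInput S a b
      mainLoop P m S ab.1 ab.2 0 (initDegree ab) 1 0 B'
    -- what to do with a zero-divisor `w`
    let onZeroDivisor := fun (w : ZeroDivisor n p) =>
      match handleZeroDivisor p T n B w with
      | (none, B') => mainLoop P m T a b (idx + 1) dg M G B'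
      | (some (j, u, v), B') =>
        match call (splitAt T j u) B' with
        | none => none
        | some (out₁, B₁) =>
          match call (splitAt T j v) B₁ with
          | none => none
          | some (out₂, B₂) => some (out₁ ++ out₂, B₂)
    if IsBadPrime p T a b then mainLoop P m T a b (idx + 1) dg M G B else
      match isRadicalPrime p Tp n with
      | .error w => onZeroDivisor w
      | .ok false => mainLoop P m T a b (idx + 1) dg M G B
      | .ok true =>
        match monicEuclid (invLevel p Tp n) (projPoly Tp n (mapCoeffsPoly (ratMod p) a))
            (projPoly Tp n (mapCoeffsPoly (ratMod p) b)) with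
        | .error w => onZeroDivisor w
        | .ok (g, _, _) =>
          if dg < g.natDegree then mainLoop P m T a b (idx + 1) dg M G B else
            let g' := liftInt p (repPoly Tp n g)
            let M' := if g.natDegree = dg then M * p else p
            let G' := if g.natDegree = dg then crtPoly M p G g' else g'
            match (ratReconPoly M' G').filter (fun h =>
                decide (projPoly T n h ∣ projPoly T n a ∧ projPoly T n h ∣ projPoly T n b)) with
            | some h => some ([(T, h)], B)
            | none => mainLoop P m T a b (idx + 1) g.natDegree M' G' B

/-- The modular algorithm, run on `a, b ∈ R[x]` where `R = ℚ[z]/⟨T⟩`, with the primes picked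
according to `P`, terminates with the output `out`. -/
def ModularCGCDOutputs {n : ℕ} (P : (Fin n → MvPolynomial (Fin n) ℚ) → ℕ → ℕ)
    (T : Fin n → MvPolynomial (Fin n) ℚ) (a b : (TriQuot T n)[X]) (out : CGCDOutput n) : Prop :=
  ∃ (N : ℕ) (B : Option ℕ),
    let ab := prepareInput T (repPoly T n a) (repPoly T n b)
    mainLoop P N T ab.1 ab.2 0 (initDegree ab) 1 0 none = some (out, B)

/-- `out` consists of pairwise comaximal radical triangular sets `T_i` whose ideals intersect in
`⟨T⟩`, and of polynomials that form a componentwise gcd of `a` and `b` with respect to the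
resulting decomposition `ℚ[z]/⟨T⟩ ≃ ∏ ℚ[z]/⟨T_i⟩`. -/
structure IsCorrectCGCD {n : ℕ} (T : Fin n → MvPolynomial (Fin n) ℚ) (a b : (TriQuot T n)[X])
    (out : CGCDOutput n) : Prop where
  triangular : ∀ c ∈ out, IsTriangularSet c.1 ∧ (triIdeal c.1 n).IsRadical
  comaximal : out.Pairwise (fun c c' => IsCoprime (triIdeal c.1 n) (triIdeal c'.1 n))
  inter : (⨅ c ∈ out, triIdeal c.1 n) = triIdeal T n
  gcd : ∃ e : TriQuot T n ≃+* (∀ i : Fin out.length, TriQuot (out.get i).1 n),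
    (∀ f i, e (Ideal.Quotient.mk _ f) i = Ideal.Quotient.mk _ f) ∧
    IsComponentwiseGCD e a b (fun i => projPoly (out.get i).1 n (out.get i).2)

end

/-! ### Polynomials viewed in one variable -/

noncomputable section

variable {k : Type} [CommRing k] {n : ℕ}

/-! Correctness and termination rest on two different principles.

Correctness. Let `O` be `ℤ_(p)[z]/⟨T⟩`; it is finite over the local ring `ℤ_(p)`, so `p` lies in its
Jacobson radical. Suppose that the Euclidean algorithm modulo a prime that is not bad ends without a
zero-divisor, and that `a`, `b` are not both `0`. It has inverted the leading coefficient of `b` (of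
`a` if `b = 0`), so `O[x]/(a, b)` is a finite `O`-module; its result `g` is a combination of `a` and
`b`, so modulo `p` this module is spanned by the powers of `x` below `deg g`. By Nakayama they
already span it over `O`, hence `(a, b)` contains a monic `G` of degree `deg g`, and `G` reduces to
`g` (`Polynomial.exists_monic_mem_span_pair`, `euclidMod_lift`). Every monic common divisor over `ℚ`
divides `G`, so no prime yields too small a degree, and at the right degree `g` is the reduction of
the gcd (`IsLoopState.image`). A reconstructed polynomial that passes the trial divisions is monic
of degree `deg g` and divides `G`, so it equals `G`; lying in `(a, b)`, it is a gcd
(`IsLoopState.isGreatestCommonDivisor`).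

Splitting. For `t_j = uv` modulo the smaller elements, radicality gives `⟨T⟩ = ⟨T, u⟩ ∩ ⟨T, v⟩`. The
dimension of `ℚ[z]/⟨T⟩` is the product of the main degrees, and `deg t_j = deg u + deg v`, so the
injection into the product of the two quotients is onto. The two ideals are therefore comaximal, and
hence radical (`isCoprime_triIdeal_splitAt`, `isRadical_triIdeal_splitAt`).

Termination. For fixed `T`, `a`, `b` the runs modulo all large primes are reductions of one
computation over `ℚ`: it involves finitely many rational numbers, and a large prime divides neither
their denominators nor their nonzero numerators (`invLevel_eventually`, `monicEuclid_eventually`,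
`loopStep_eventually`). So all large primes either produce the reduction of one common divisor `γ`,
or report the reduction of one proper factor `w` of some `t_j`. In the first case `dg` settles at
`deg γ`, the modulus grows at each prime, and `γ` is reconstructed at the latest when the modulus
exceeds its height. In the second case radicality makes `w` and `t_j / w` coprime, so either the
Bézout computation reports a factor of smaller main variable, or the Hensel lifts approximate `w`
itself. Each failure raises the bound; once it exceeds the height of the factor being lifted,
lifting cannot fail any more (`henselLoop_ne_none`, `handleZeroDivisor_eventually`). The resulting
splitting lowers the sum of the main degrees, on which `mainLoop_terminates` is an induction. -/

theorem viewAt_C (j : Fin n) (c : k) :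
    viewAt j (MvPolynomial.C c) = Polynomial.C (MvPolynomial.C c) := by
  simp [viewAt]

theorem viewAt_X_self (j : Fin n) : viewAt j (MvPolynomial.X j : MvPolynomial (Fin n) k) = X := by
  simp [viewAt]

theorem viewAt_X_of_ne {j l : Fin n} (h : l ≠ j) :
    viewAt j (MvPolynomial.X l : MvPolynomial (Fin n) k) = C (MvPolynomial.X l) := by
  simp [viewAt, h]

theorem viewAt_monomial (j : Fin n) (e : Fin n →₀ ℕ) (c : k) :
    viewAt j (MvPolynomial.monomial e c) =
      Polynomial.monomial (e j) (MvPolynomial.monomial (e.erase j) c) := by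
  classical
  rw [← Finsupp.erase_add_single j e, ← mul_one c, ← MvPolynomial.monomial_mul, map_mul]
  have h1 : viewAt j (MvPolynomial.monomial (e.erase j) c) =
      C (MvPolynomial.monomial (e.erase j) c) := by
    rw [MvPolynomial.monomial_eq, map_mul, viewAt_C, Finsupp.prod, map_prod, C_mul, map_prod]
    congr 1
    refine Finset.prod_congr rfl fun l hl => ?_
    have : l ≠ j := by
      rintro rfl
      simp at hl
    rw [map_pow, viewAt_X_of_ne this, map_pow]
  have h2 : viewAt j (MvPolynomial.monomial (Finsupp.single j (e j)) (1 : k)) = X ^ (e j) := by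
    rw [← MvPolynomial.X_pow_eq_monomial, map_pow, viewAt_X_self]
  rw [h1, h2, C_mul_X_pow_eq_monomial]
  simp

/-- Exponents split uniquely into their `z_j`-part and the rest. The degree and support statements
about `viewAt` are read off from this formula. -/
theorem coeff_coeff_viewAt (j : Fin n) (f : MvPolynomial (Fin n) k) (d : ℕ) (e : Fin n →₀ ℕ) :
    ((viewAt j f).coeff d).coeff e = if e j = 0 then f.coeff (e + Finsupp.single j d) else 0 := by
  classical
  induction f using MvPolynomial.induction_on' with
  | monomial m c =>
    rw [viewAt_monomial, Polynomial.coeff_monomial]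
    have key : (e j = 0 ∧ m = e + Finsupp.single j d) ↔ (m j = d ∧ m.erase j = e) := by
      constructor
      · rintro ⟨h0, rfl⟩
        refine ⟨by simp [h0], ?_⟩
        ext l
        by_cases hl : l = j
        · subst hl; simp [h0]
        · simp [hl]
      · rintro ⟨rfl, rfl⟩
        exact ⟨by simp, (Finsupp.erase_add_single j m).symm⟩
    by_cases h1 : m j = d
    · rw [if_pos h1, MvPolynomial.coeff_monomial, MvPolynomial.coeff_monomial]
      by_cases h2 : m.erase j = e
      · rw [if_pos h2, if_pos (key.2 ⟨h1, h2⟩).1, if_pos (key.2 ⟨h1, h2⟩).2]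
      · rw [if_neg h2]
        split_ifs with h3 h4
        · exact absurd (key.1 ⟨h3, h4⟩).2 h2
        · rfl
        · rfl
    · rw [if_neg h1, MvPolynomial.coeff_zero, MvPolynomial.coeff_monomial]
      split_ifs with h3 h4
      · exact absurd (key.1 ⟨h3, h4⟩).1 h1
      · rfl
      · rfl
  | add p q hp hq =>
    rw [map_add, Polynomial.coeff_add, MvPolynomial.coeff_add, hp, hq, MvPolynomial.coeff_add]
    split_ifs <;> simp

theorem unviewAt_eq (j : Fin n) (f : (MvPolynomial (Fin n) k)[X]) :
    unviewAt j f = Polynomial.evalRingHom (MvPolynomial.X j) f := rfl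

theorem unviewAt_viewAt (j : Fin n) (f : MvPolynomial (Fin n) k) : unviewAt j (viewAt j f) = f := by
  have : (Polynomial.evalRingHom (MvPolynomial.X j)).comp (viewAt j) =
      RingHom.id (MvPolynomial (Fin n) k) := by
    apply MvPolynomial.ringHom_ext
    · intro r; simp [viewAt_C]
    · intro l
      by_cases h : l = j
      · subst h; simp [viewAt_X_self]
      · simp [viewAt_X_of_ne h]
  exact congrArg (fun φ => φ f) this

theorem viewAt_of_degreeOf_eq_zero {j : Fin n} {f : MvPolynomial (Fin n) k}
    (h : f.degreeOf j = 0) : viewAt j f = C f := by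
  classical
  ext d e
  rw [coeff_coeff_viewAt, Polynomial.coeff_C]
  have hz : ∀ m : Fin n →₀ ℕ, m j ≠ 0 → f.coeff m = 0 := by
    intro m hm
    rw [← MvPolynomial.notMem_support_iff]
    exact MvPolynomial.notMem_support_of_degreeOf_lt j (by omega)
  by_cases hd : d = 0
  · subst hd
    by_cases he : e j = 0
    · simp [he]
    · simp [he, hz e he]
  · by_cases he : e j = 0
    · rw [if_pos he, if_neg hd]
      simpa using hz _ (by simp [hd])
    · simp [he, hd]

/-- The hypothesis is essential: powers of `z_j` hidden in the coefficients would be merged with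
those of the univariate variable. -/
theorem viewAt_unviewAt {j : Fin n} {F : (MvPolynomial (Fin n) k)[X]}
    (h : ∀ d, (F.coeff d).degreeOf j = 0) : viewAt j (unviewAt j F) = F := by
  rw [unviewAt_eq, coe_evalRingHom, Polynomial.eval_eq_sum, Polynomial.sum, map_sum]
  conv_rhs => rw [F.as_sum_support_C_mul_X_pow]
  refine Finset.sum_congr rfl fun d _ => ?_
  rw [map_mul, map_pow, viewAt_X_self, viewAt_of_degreeOf_eq_zero (h d)]

theorem degreeOf_coeff_viewAt_self (j : Fin n) (f : MvPolynomial (Fin n) k) (d : ℕ) :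
    ((viewAt j f).coeff d).degreeOf j = 0 := by
  rw [← Nat.le_zero, MvPolynomial.degreeOf_le_iff]
  intro m hm
  rw [MvPolynomial.mem_support_iff, coeff_coeff_viewAt] at hm
  by_contra h
  simp [show m j ≠ 0 by omega] at hm

theorem degreeOf_coeff_viewAt_le (j l : Fin n) (f : MvPolynomial (Fin n) k) (d : ℕ) :
    ((viewAt j f).coeff d).degreeOf l ≤ f.degreeOf l := by
  rw [MvPolynomial.degreeOf_le_iff]
  intro m hm
  rw [MvPolynomial.mem_support_iff, coeff_coeff_viewAt] at hm
  split_ifs at hm with h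
  · have := MvPolynomial.le_degreeOf_of_mem_support l (MvPolynomial.mem_support_iff.2 hm)
    simp at this
    omega
  · simp at hm

theorem natDegree_viewAt (j : Fin n) (f : MvPolynomial (Fin n) k) :
    (viewAt j f).natDegree = f.degreeOf j := by
  apply le_antisymm
  · rw [Polynomial.natDegree_le_iff_coeff_eq_zero]
    intro d hd
    ext e
    rw [coeff_coeff_viewAt, MvPolynomial.coeff_zero]
    split_ifs with h
    · rw [← MvPolynomial.notMem_support_iff]
      exact MvPolynomial.notMem_support_of_degreeOf_lt j (by simp; omega)
    · rfl
  · rw [MvPolynomial.degreeOf_le_iff]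
    intro m hm
    apply Polynomial.le_natDegree_of_ne_zero
    intro h
    have := coeff_coeff_viewAt j f (m j) (m.erase j)
    rw [h] at this
    simp only [Finsupp.erase_same, if_true, Finsupp.erase_add_single,
      MvPolynomial.coeff_zero] at this
    exact (MvPolynomial.mem_support_iff.1 hm) this.symm

theorem degreeOf_unviewAt_self_le {j : Fin n} {F : (MvPolynomial (Fin n) k)[X]}
    (h : ∀ d, (F.coeff d).degreeOf j = 0) : (unviewAt j F).degreeOf j = F.natDegree := by
  rw [← natDegree_viewAt, viewAt_unviewAt h]

theorem degreeOf_unviewAt_le {j l : Fin n} (hl : l ≠ j) {F : (MvPolynomial (Fin n) k)[X]} {N : ℕ}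
    (h : ∀ d, (F.coeff d).degreeOf l ≤ N) : (unviewAt j F).degreeOf l ≤ N := by
  rw [unviewAt_eq, coe_evalRingHom, Polynomial.eval_eq_sum, Polynomial.sum]
  refine (MvPolynomial.degreeOf_sum_le _ _ _).trans (Finset.sup_le fun d _ => ?_)
  rw [MvPolynomial.degreeOf_mul_X_pow_of_ne _ hl]
  exact h d

/-! ### Supports -/

/-- Polynomials in the variables `z_l` with `l < i`. -/
def lowVars (k : Type) [CommRing k] (n i : ℕ) : Subalgebra k (MvPolynomial (Fin n) k) :=
  MvPolynomial.supported k {l : Fin n | l.val < i}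

theorem mem_supported_iff_degreeOf {s : Set (Fin n)} {f : MvPolynomial (Fin n) k} :
    f ∈ MvPolynomial.supported k s ↔ ∀ j, j ∉ s → f.degreeOf j = 0 := by
  classical
  rw [MvPolynomial.mem_supported]
  constructor
  · intro h j hj
    by_contra h0
    apply hj
    apply h
    rw [Finset.mem_coe, MvPolynomial.vars_def, Multiset.mem_toFinset, ← Multiset.count_ne_zero]
    rwa [MvPolynomial.degreeOf_def] at h0
  · intro h j hj
    by_contra h0
    have := h j h0
    rw [Finset.mem_coe, MvPolynomial.vars_def, Multiset.mem_toFinset, ← Multiset.count_ne_zero] at hj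
    rw [MvPolynomial.degreeOf_def] at this
    exact hj this

theorem mem_lowVars {i : ℕ} {f : MvPolynomial (Fin n) k} :
    f ∈ lowVars k n i ↔ ∀ j : Fin n, i ≤ j.val → f.degreeOf j = 0 := by
  rw [lowVars, mem_supported_iff_degreeOf]
  simp

theorem lowVars_mono {i j : ℕ} (h : i ≤ j) : lowVars k n i ≤ lowVars k n j :=
  MvPolynomial.supported_mono fun _ hl => lt_of_lt_of_le hl h

theorem coeff_viewAt_mem_lowVars {j : Fin n} {f : MvPolynomial (Fin n) k}
    (h : f ∈ lowVars k n (j + 1)) (d : ℕ) : (viewAt j f).coeff d ∈ lowVars k n j := by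
  rw [mem_lowVars] at h ⊢
  intro l hl
  by_cases hlj : l = j
  · subst hlj; exact degreeOf_coeff_viewAt_self _ _ _
  · have := degreeOf_coeff_viewAt_le j l f d
    rw [h l (by have : l.val ≠ j.val := fun h => hlj (Fin.ext h)
                omega)] at this
    omega

theorem unviewAt_mem_lowVars {j : Fin n} {F : (MvPolynomial (Fin n) k)[X]}
    (h : ∀ d, F.coeff d ∈ lowVars k n j) : unviewAt j F ∈ lowVars k n (j + 1) := by
  rw [unviewAt_eq, coe_evalRingHom, Polynomial.eval_eq_sum, Polynomial.sum]
  refine Subalgebra.sum_mem _ fun d _ => Subalgebra.mul_mem _ (lowVars_mono (Nat.le_succ _) (h d))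
    (Subalgebra.pow_mem _ ?_ _)
  exact Algebra.subset_adjoin ⟨j, Nat.lt_succ_self j.val, rfl⟩

end

/-! ### Existence and uniqueness of reduced representatives -/

noncomputable section

/-- Triangular sets that need not be reduced. -/
structure IsMonicTriangular {k : Type} [CommRing k] {n : ℕ}
    (T : Fin n → MvPolynomial (Fin n) k) : Prop where
  noLarger : ∀ i j, i < j → (T i).degreeOf j = 0
  mainVar : ∀ i, 0 < (T i).degreeOf i
  monic : ∀ i, (viewAt i (T i)).Monic

/-- `r` is reduced with respect to the first `i` elements of `T`. -/
def IsReducedWrt {k : Type} [CommRing k] {n : ℕ} (T : Fin n → MvPolynomial (Fin n) k) (i : ℕ)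
    (r : MvPolynomial (Fin n) k) : Prop :=
  ∀ l : Fin n, l.val < i → r.degreeOf l < (T l).degreeOf l

/-- The exponents of reduced monomials in the variables with index in `s`. -/
def reducedExps {k : Type} [CommRing k] {n : ℕ} (T : Fin n → MvPolynomial (Fin n) k) (i : ℕ)
    (s : Set (Fin n)) : Set (Fin n →₀ ℕ) :=
  {e | (∀ l : Fin n, l.val < i → e l < (T l).degreeOf l) ∧ ∀ l ∉ s, e l = 0}

variable {k : Type} [CommRing k] {n : ℕ} {T : Fin n → MvPolynomial (Fin n) k}

theorem IsTriangularSet.toIsMonicTriangular (h : IsTriangularSet T) : IsMonicTriangular T :=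
  ⟨h.noLarger, h.mainVar, h.monic⟩

theorem IsMonicTriangular.mem_lowVars (h : IsMonicTriangular T) (l : Fin n) :
    T l ∈ lowVars k n (l + 1) :=
  _root_.mem_lowVars.2 fun j hj => h.noLarger l j (by rw [Fin.lt_def]; omega)

theorem mem_restrictSupport_reducedExps (h : IsMonicTriangular T) {i : ℕ} {s : Set (Fin n)}
    {r : MvPolynomial (Fin n) k} :
    r ∈ MvPolynomial.restrictSupport k (reducedExps T i s) ↔
      IsReducedWrt T i r ∧ r ∈ MvPolynomial.supported k s := by
  rw [MvPolynomial.mem_restrictSupport_iff, mem_supported_iff_degreeOf]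
  constructor
  · intro hr
    constructor
    · intro l hl
      rw [MvPolynomial.degreeOf_lt_iff (h.mainVar l)]
      intro m hm
      exact (hr hm).1 l hl
    · intro j hj
      rw [← Nat.le_zero, MvPolynomial.degreeOf_le_iff]
      intro m hm
      exact ((hr hm).2 j hj).le
  · rintro ⟨h1, h2⟩ m hm
    constructor
    · intro l hl
      exact (MvPolynomial.degreeOf_lt_iff (h.mainVar l)).1 (h1 l hl) m hm
    · intro j hj
      exact Nat.le_zero.1 ((MvPolynomial.degreeOf_le_iff.1 (h2 j hj).le) m hm)

theorem IsMonicTriangular.mem_triIdeal (T : Fin n → MvPolynomial (Fin n) k) {i : ℕ} {l : Fin n}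
    (hl : l.val < i) : T l ∈ triIdeal T i :=
  Ideal.subset_span ⟨l, hl, rfl⟩

theorem X_pow_degreeOf_eq (h : IsMonicTriangular T) (l : Fin n) :
    (MvPolynomial.X l : MvPolynomial (Fin n) k) ^ (T l).degreeOf l = T l -
      ∑ d ∈ Finset.range ((T l).degreeOf l), (viewAt l (T l)).coeff d * MvPolynomial.X l ^ d := by
  have := unviewAt_viewAt l (T l)
  rw [unviewAt_eq, coe_evalRingHom, Polynomial.eval_eq_sum_range, natDegree_viewAt,
    Finset.sum_range_succ] at this
  have h1 : (viewAt l (T l)).coeff ((T l).degreeOf l) = 1 := by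
    have := h.monic l
    rwa [Polynomial.Monic, Polynomial.leadingCoeff, natDegree_viewAt] at this
  rw [h1, one_mul] at this
  rw [eq_sub_iff_add_eq, add_comm, this]

theorem mul_mem_of_forall_X_mul_mem {V : Submodule k (MvPolynomial (Fin n) k)} {s : Set (Fin n)}
    (hV : ∀ l ∈ s, ∀ f ∈ V, MvPolynomial.X l * f ∈ V) {c f : MvPolynomial (Fin n) k}
    (hc : c ∈ MvPolynomial.supported k s) (hf : f ∈ V) : c * f ∈ V := by
  rw [MvPolynomial.supported_eq_adjoin_X] at hc
  induction hc using Algebra.adjoin_induction generalizing f with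
  | mem x hx =>
    obtain ⟨l, hl, rfl⟩ := hx
    exact hV l hl f hf
  | algebraMap r =>
    rw [← Algebra.smul_def]
    exact V.smul_mem r hf
  | add x y _ _ hx hy =>
    rw [add_mul]
    exact V.add_mem (hx hf) (hy hf)
  | mul x y _ _ hx hy =>
    rw [mul_assoc]
    exact hx (hy hf)

/-- Multiplying a reduced monomial by `z_l` either leaves it reduced or brings the exponent up to
`deg t_l`; in the latter case `t_l` replaces the power by lower ones. Only an induction on the
variable is needed, not a monomial order, because the sum with the ideal is known to be stable under
the smaller variables. -/
theorem X_mul_mem_reduced_sup (h : IsMonicTriangular T) {i : ℕ} {s : Set (Fin n)}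
    (hs : ∀ l : Fin n, l.val < i → l ∈ s) (l : Fin n) (hl : l ∈ s) (f : MvPolynomial (Fin n) k)
    (hf : f ∈ MvPolynomial.restrictSupport k (reducedExps T i s) ⊔
      (triIdeal T i).restrictScalars k) :
    MvPolynomial.X l * f ∈ MvPolynomial.restrictSupport k (reducedExps T i s) ⊔
      (triIdeal T i).restrictScalars k := by
  classical
  induction hm : l.val using Nat.strong_induction_on generalizing l f with
  | _ m IH =>
  subst hm
  set V := MvPolynomial.restrictSupport k (reducedExps T i s) ⊔ (triIdeal T i).restrictScalars k
    with hV
  have hmon : ∀ e ∈ reducedExps T i s, MvPolynomial.monomial e (1 : k) ∈ V := fun e he =>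
    Submodule.mem_sup_left ((MvPolynomial.monomial_mem_restrictSupport k).2 (Or.inl he))
  have hI : ∀ y ∈ triIdeal T i, y ∈ V := fun y hy => Submodule.mem_sup_right hy
  obtain ⟨r, hr, y, hy, rfl⟩ := Submodule.mem_sup.1 hf
  rw [mul_add]
  refine V.add_mem ?_ (hI _ (Ideal.mul_mem_left _ _ hy))
  rw [MvPolynomial.restrictSupport_eq_span] at hr
  clear hf
  induction hr using Submodule.span_induction with
  | zero => simp
  | add x y _ _ hx hy =>
    rw [mul_add]
    exact V.add_mem hx hy
  | smul a x _ hx =>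
    rw [mul_smul_comm]
    exact V.smul_mem a hx
  | mem x hx =>
    obtain ⟨e, he, rfl⟩ := hx
    by_cases hcase : l.val < i ∧ e l + 1 = (T l).degreeOf l
    · obtain ⟨hli, hel⟩ := hcase
      have herase : ∀ d < (T l).degreeOf l, e.erase l + Finsupp.single l d ∈ reducedExps T i s := by
        intro d hd
        refine ⟨fun l' hl' => ?_, fun l' hl' => ?_⟩
        · by_cases hll : l' = l
          · subst hll; simpa using hd
          · simpa [hll] using he.1 l' hl'
        · have hll : l' ≠ l := by rintro rfl; exact hl' hl
          simpa [hll] using he.2 l' hl'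
      have hx : (MvPolynomial.X l : MvPolynomial (Fin n) k) * MvPolynomial.monomial e 1 =
          MvPolynomial.X l ^ (T l).degreeOf l * MvPolynomial.monomial (e.erase l) 1 := by
        conv_lhs => rw [← Finsupp.erase_add_single l e]
        rw [MvPolynomial.X_pow_eq_monomial, ← hel, MvPolynomial.X, MvPolynomial.monomial_mul,
          MvPolynomial.monomial_mul]
        rw [Finsupp.single_add, add_comm (Finsupp.single l 1), add_assoc,
          add_comm (Finsupp.single l (e l) + _)]
      rw [hx, X_pow_degreeOf_eq h, sub_mul, Finset.sum_mul]
      refine V.sub_mem (hI _ (Ideal.mul_mem_right _ _ (IsMonicTriangular.mem_triIdeal T hli)))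
        (V.sum_mem fun d hd => ?_)
      have h2 : MvPolynomial.X l ^ d * MvPolynomial.monomial (e.erase l) (1 : k) ∈ V := by
        rw [MvPolynomial.X_pow_eq_monomial, MvPolynomial.monomial_mul, one_mul, add_comm]
        exact hmon _ (herase d (Finset.mem_range.1 hd))
      rw [mul_assoc]
      -- The coefficients of `t_l` involve only variables below `z_l`, for which stability is the
      -- induction hypothesis.
      refine mul_mem_of_forall_X_mul_mem (s := {l' : Fin n | l'.val < l.val}) ?_
        (coeff_viewAt_mem_lowVars (h.mem_lowVars l) d) h2
      intro l' hl' f hf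
      exact IH l'.val hl' l' (hs l' (lt_trans hl' hli)) f hf rfl
    · rw [MvPolynomial.X, MvPolynomial.monomial_mul, one_mul]
      refine hmon _ ⟨fun l' hl' => ?_, fun l' hl' => ?_⟩
      · have := he.1 l' hl'
        by_cases hll : l' = l
        · subst hll
          simp only [Finsupp.add_apply, Finsupp.single_eq_same]
          omega
        · simpa [hll, Finsupp.single_apply, Ne.symm hll] using this
      · have hll : l' ≠ l := by rintro rfl; exact hl' hl
        simpa [hll, Finsupp.single_apply, Ne.symm hll] using he.2 l' hl'

/-- Reduced polynomials and the ideal together contain `1` and are stable under the variables in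
`s`, hence contain every polynomial in them. The parameter `s` records that reduction introduces no
new variables. -/
theorem exists_reduced (h : IsMonicTriangular T) {i : ℕ} {s : Set (Fin n)}
    (hs : ∀ l : Fin n, l.val < i → l ∈ s) {f : MvPolynomial (Fin n) k}
    (hf : f ∈ MvPolynomial.supported k s) :
    ∃ r, IsReducedWrt T i r ∧ r ∈ MvPolynomial.supported k s ∧ f - r ∈ triIdeal T i := by
  have h1 : (1 : MvPolynomial (Fin n) k) ∈ MvPolynomial.restrictSupport k (reducedExps T i s) ⊔
      (triIdeal T i).restrictScalars k :=
    Submodule.mem_sup_left ((MvPolynomial.monomial_mem_restrictSupport k).2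
      (Or.inl ⟨fun l _ => h.mainVar l, fun l _ => rfl⟩))
  have h2 := mul_mem_of_forall_X_mul_mem (X_mul_mem_reduced_sup h hs) hf h1
  rw [mul_one] at h2
  obtain ⟨r, hr, y, hy, rfl⟩ := Submodule.mem_sup.1 h2
  obtain ⟨hr1, hr2⟩ := (mem_restrictSupport_reducedExps h).1 hr
  exact ⟨r, hr1, hr2, by simpa using hy⟩

theorem triIdeal_succ (T : Fin n → MvPolynomial (Fin n) k) {i : ℕ} (hi : i < n) :
    triIdeal T (i + 1) = triIdeal T i ⊔ Ideal.span {T ⟨i, hi⟩} := by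
  rw [triIdeal, triIdeal, ← Ideal.span_union]
  congr 1
  ext f
  simp only [Set.mem_image, Set.mem_ofPred_eq, Set.mem_union, Set.mem_singleton_iff]
  constructor
  · rintro ⟨l, hl, rfl⟩
    rcases Nat.lt_succ_iff_lt_or_eq.1 hl with h | h
    · exact Or.inl ⟨l, h, rfl⟩
    · right; congr 1; exact Fin.ext h
  · rintro (⟨l, hl, rfl⟩ | rfl)
    · exact ⟨l, by omega, rfl⟩
    · exact ⟨⟨i, hi⟩, by simp, rfl⟩

theorem triIdeal_mono (T : Fin n → MvPolynomial (Fin n) k) {i j : ℕ} (h : i ≤ j) :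
    triIdeal T i ≤ triIdeal T j :=
  Ideal.span_mono (Set.image_mono fun _ hl => lt_of_lt_of_le hl h)

theorem triIdeal_of_le (T : Fin n → MvPolynomial (Fin n) k) {i : ℕ} (h : n ≤ i) :
    triIdeal T i = triIdeal T n := by
  rw [triIdeal, triIdeal]
  congr 2
  ext l
  simp only [Set.mem_ofPred_eq]
  have := l.isLt
  constructor <;> intro <;> omega

/-! ### The tower -/

theorem coeff_projPoly (T : Fin n → MvPolynomial (Fin n) k) (i : ℕ)
    (f : (MvPolynomial (Fin n) k)[X]) (d : ℕ) :
    (projPoly T i f).coeff d = Ideal.Quotient.mk (triIdeal T i) (f.coeff d) := by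
  simp [projPoly]

theorem projPoly_C (T : Fin n → MvPolynomial (Fin n) k) (i : ℕ) (f : MvPolynomial (Fin n) k) :
    projPoly T i (C f) = C (Ideal.Quotient.mk _ f) := by
  simp [projPoly]

theorem projPoly_viewAt_of_mem (h : IsMonicTriangular T) (j : Fin n) {f : MvPolynomial (Fin n) k}
    (hf : f ∈ triIdeal T j) : projPoly T j (viewAt j f) = 0 := by
  have : triIdeal T j ≤ RingHom.ker ((projPoly T j.val).comp (viewAt j)) := by
    refine Ideal.span_le.2 ?_
    rintro _ ⟨l, hl, rfl⟩
    rw [SetLike.mem_coe, RingHom.mem_ker, RingHom.comp_apply,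
      viewAt_of_degreeOf_eq_zero (h.noLarger l j hl), projPoly_C,
      Ideal.Quotient.eq_zero_iff_mem.2 (IsMonicTriangular.mem_triIdeal T hl), C_0]
  exact this hf

theorem levelPoly_dvd_of_mem (h : IsMonicTriangular T) (j : Fin n) {f : MvPolynomial (Fin n) k}
    (hf : f ∈ triIdeal T (j + 1)) : levelPoly T j ∣ projPoly T j (viewAt j f) := by
  rw [triIdeal_succ T j.isLt] at hf
  obtain ⟨y, hy, z, hz, rfl⟩ := Submodule.mem_sup.1 hf
  obtain ⟨c, rfl⟩ := Ideal.mem_span_singleton.1 hz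
  rw [map_add, map_add, projPoly_viewAt_of_mem h j hy, zero_add, map_mul, map_mul]
  exact Dvd.intro _ rfl

theorem levelPoly_monic (h : IsMonicTriangular T) (j : Fin n) : (levelPoly T j).Monic :=
  (h.monic j).map _

theorem natDegree_levelPoly (h : IsMonicTriangular T) (j : Fin n) [Nontrivial (TriQuot T j)] :
    (levelPoly T j).natDegree = (T j).degreeOf j := by
  rw [levelPoly, projPoly, coe_mapRingHom, (h.monic j).natDegree_map, natDegree_viewAt]

/-- As a polynomial in `z_i` over the ring of level `i`, such an `r` is divisible by the monic `t_i`
but has smaller degree, so all its coefficients vanish there; they are themselves reduced, and the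
induction applies to them. -/
theorem eq_zero_of_isReducedWrt [Nontrivial k] (h : IsMonicTriangular T) (i : ℕ) :
    ∀ r : MvPolynomial (Fin n) k, IsReducedWrt T i r → r ∈ triIdeal T i → r = 0 := by
  induction i with
  | zero =>
    intro r _ hr
    simpa [triIdeal] using hr
  | succ i IH =>
    intro r hr hmem
    by_cases hi : i < n
    · set j : Fin n := ⟨i, hi⟩
      -- The induction hypothesis for `r = 1` makes the ring of level `i` nontrivial, as the degree
      -- argument with monic polynomials requires.
      have hne : (1 : MvPolynomial (Fin n) k) ∉ triIdeal T i := fun h1 => by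
        refine one_ne_zero (α := MvPolynomial (Fin n) k) (IH 1 (fun l _ => ?_) h1)
        rw [MvPolynomial.degreeOf_one]
        exact h.mainVar l
      have : Nontrivial (TriQuot T i) :=
        Ideal.Quotient.nontrivial_iff.2 fun h => hne (h ▸ Submodule.mem_top)
      have hdvd := levelPoly_dvd_of_mem h j hmem
      have h0 : projPoly T i (viewAt j r) = 0 := by
        by_contra hne0
        refine (levelPoly_monic h j).not_dvd_of_natDegree_lt hne0 ?_ hdvd
        rw [natDegree_levelPoly h j]
        refine lt_of_le_of_lt Polynomial.natDegree_map_le ?_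
        rw [natDegree_viewAt]
        exact hr j (Nat.lt_succ_self i)
      have hco : ∀ d, (viewAt j r).coeff d = 0 := by
        intro d
        apply IH
        · intro l hl
          exact lt_of_le_of_lt (degreeOf_coeff_viewAt_le _ _ _ _) (hr l (by omega))
        · rw [← Ideal.Quotient.eq_zero_iff_mem, ← coeff_projPoly, h0, coeff_zero]
      rw [← unviewAt_viewAt j r, show viewAt j r = 0 from Polynomial.ext fun d => by rw [hco d, coeff_zero]]
      simp [unviewAt]
    · rw [triIdeal_of_le T (by omega), ← triIdeal_of_le T (i := i) (by omega)] at hmem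
      exact IH r (fun l hl => hr l (by omega)) hmem

end

/-! ### Normal forms and elements of low level -/

noncomputable section

variable {k : Type} [CommRing k] {n : ℕ} {T : Fin n → MvPolynomial (Fin n) k} {i : ℕ}

namespace IsMonicTriangular

theorem isReducedWrt_zero (h : IsMonicTriangular T) : IsReducedWrt T i 0 := fun l _ => by
  rw [MvPolynomial.degreeOf_zero]; exact h.mainVar l

theorem isReducedWrt_one (h : IsMonicTriangular T) : IsReducedWrt T i 1 := fun l _ => by
  rw [MvPolynomial.degreeOf_one]; exact h.mainVar l

theorem one_notMem_triIdeal [Nontrivial k] (h : IsMonicTriangular T) : 1 ∉ triIdeal T i := fun h1 =>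
  one_ne_zero (eq_zero_of_isReducedWrt h i 1 h.isReducedWrt_one h1)

theorem nontrivial_triQuot [Nontrivial k] (h : IsMonicTriangular T) (i : ℕ) :
    Nontrivial (TriQuot T i) :=
  Ideal.Quotient.nontrivial_iff.2 fun h' => h.one_notMem_triIdeal (h' ▸ Submodule.mem_top)

end IsMonicTriangular

theorem IsReducedWrt.add {r s : MvPolynomial (Fin n) k} (hr : IsReducedWrt T i r)
    (hs : IsReducedWrt T i s) : IsReducedWrt T i (r + s) := fun l hl =>
  lt_of_le_of_lt (MvPolynomial.degreeOf_add_le l r s) (max_lt (hr l hl) (hs l hl))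

theorem IsReducedWrt.C_mul {r : MvPolynomial (Fin n) k} (c : k) (hr : IsReducedWrt T i r) :
    IsReducedWrt T i (MvPolynomial.C c * r) := fun l hl =>
  lt_of_le_of_lt (MvPolynomial.degreeOf_C_mul_le r l c) (hr l hl)

theorem IsReducedWrt.neg {r : MvPolynomial (Fin n) k} (hr : IsReducedWrt T i r) :
    IsReducedWrt T i (-r) := by
  simpa using hr.C_mul (-1)

theorem IsReducedWrt.sub {r s : MvPolynomial (Fin n) k} (hr : IsReducedWrt T i r)
    (hs : IsReducedWrt T i s) : IsReducedWrt T i (r - s) := by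
  rw [sub_eq_add_neg]
  exact hr.add hs.neg

theorem IsReducedWrt.eq_of_sub_mem [Nontrivial k] (h : IsMonicTriangular T)
    {r s : MvPolynomial (Fin n) k} (hr : IsReducedWrt T i r) (hs : IsReducedWrt T i s)
    (hrs : r - s ∈ triIdeal T i) : r = s :=
  sub_eq_zero.1 (eq_zero_of_isReducedWrt h i _ (hr.sub hs) hrs)

theorem normalForm_spec (h : IsMonicTriangular T) (u : TriQuot T i) :
    Ideal.Quotient.mk (triIdeal T i) (normalForm T i u) = u ∧ IsReducedWrt T i (normalForm T i u) := by
  have hex : ∃ r : MvPolynomial (Fin n) k, Ideal.Quotient.mk (triIdeal T i) r = u ∧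
      ∀ l : Fin n, l.val < i → r.degreeOf l < (T l).degreeOf l := by
    obtain ⟨f, rfl⟩ := Ideal.Quotient.mk_surjective u
    obtain ⟨r, hr, -, hfr⟩ := exists_reduced h (i := i) (s := Set.univ) (fun _ _ => trivial)
      (f := f) (by simp)
    exact ⟨r, (Ideal.Quotient.eq.2 hfr).symm, hr⟩
  rw [normalForm, dif_pos hex]
  exact hex.choose_spec

theorem mk_normalForm (h : IsMonicTriangular T) (u : TriQuot T i) :
    Ideal.Quotient.mk (triIdeal T i) (normalForm T i u) = u :=
  (normalForm_spec h u).1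

theorem isReducedWrt_normalForm (h : IsMonicTriangular T) (u : TriQuot T i) :
    IsReducedWrt T i (normalForm T i u) :=
  (normalForm_spec h u).2

section
variable [Nontrivial k]

theorem normalForm_eq (h : IsMonicTriangular T) {u : TriQuot T i} {r : MvPolynomial (Fin n) k}
    (hr : IsReducedWrt T i r) (hu : Ideal.Quotient.mk _ r = u) : normalForm T i u = r :=
  (isReducedWrt_normalForm h u).eq_of_sub_mem h hr
    (Ideal.Quotient.eq.1 ((mk_normalForm h u).trans hu.symm))

theorem normalForm_mk (h : IsMonicTriangular T) {r : MvPolynomial (Fin n) k}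
    (hr : IsReducedWrt T i r) : normalForm T i (Ideal.Quotient.mk _ r) = r :=
  normalForm_eq h hr rfl

theorem normalForm_zero (h : IsMonicTriangular T) : normalForm T i 0 = 0 :=
  normalForm_eq h h.isReducedWrt_zero (map_zero _)

theorem normalForm_one (h : IsMonicTriangular T) : normalForm T i 1 = 1 :=
  normalForm_eq h h.isReducedWrt_one (map_one _)

theorem normalForm_add (h : IsMonicTriangular T) (u v : TriQuot T i) :
    normalForm T i (u + v) = normalForm T i u + normalForm T i v :=
  normalForm_eq h ((isReducedWrt_normalForm h u).add (isReducedWrt_normalForm h v))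
    (by rw [map_add, mk_normalForm h, mk_normalForm h])

theorem normalForm_mk_C_mul (h : IsMonicTriangular T) (c : k) (u : TriQuot T i) :
    normalForm T i (Ideal.Quotient.mk _ (MvPolynomial.C c) * u) =
      MvPolynomial.C c * normalForm T i u :=
  normalForm_eq h ((isReducedWrt_normalForm h u).C_mul c) (by rw [map_mul, mk_normalForm h])

omit [Nontrivial k] in
theorem normalForm_injective (h : IsMonicTriangular T) :
    Function.Injective (normalForm T i) := fun u v huv => by
  rw [← mk_normalForm h u, huv, mk_normalForm h]

theorem coeff_repPoly (h : IsMonicTriangular T) (f : (TriQuot T i)[X]) (d : ℕ) :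
    (repPoly T i f).coeff d = normalForm T i (f.coeff d) := by
  rw [repPoly, finsetSum_coeff]
  simp only [coeff_monomial, Finset.sum_ite_eq']
  split_ifs with hd
  · rfl
  · rw [notMem_support_iff.1 hd, normalForm_zero h]

theorem projPoly_repPoly (h : IsMonicTriangular T) (f : (TriQuot T i)[X]) :
    projPoly T i (repPoly T i f) = f := by
  ext d
  rw [coeff_projPoly, coeff_repPoly h, mk_normalForm h]

theorem repPoly_projPoly (h : IsMonicTriangular T) {F : (MvPolynomial (Fin n) k)[X]}
    (hF : ∀ d, IsReducedWrt T i (F.coeff d)) : repPoly T i (projPoly T i F) = F := by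
  ext1 d
  rw [coeff_repPoly h, coeff_projPoly, normalForm_mk h (hF d)]

theorem isReducedWrt_coeff_repPoly (h : IsMonicTriangular T) (f : (TriQuot T i)[X]) (d : ℕ) :
    IsReducedWrt T i ((repPoly T i f).coeff d) := by
  rw [coeff_repPoly h]
  exact isReducedWrt_normalForm h _

theorem repPoly_add (h : IsMonicTriangular T) (f g : (TriQuot T i)[X]) :
    repPoly T i (f + g) = repPoly T i f + repPoly T i g := by
  ext1 d
  simp only [coeff_repPoly h, coeff_add, normalForm_add h]

theorem repPoly_zero (h : IsMonicTriangular T) : repPoly T i 0 = 0 := by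
  ext1 d
  simp only [coeff_repPoly h, coeff_zero, normalForm_zero h]

theorem repPoly_injective (h : IsMonicTriangular T) : Function.Injective (repPoly T i) :=
  fun f g hfg => by rw [← projPoly_repPoly h f, hfg, projPoly_repPoly h]

theorem degree_repPoly (h : IsMonicTriangular T) (f : (TriQuot T i)[X]) :
    (repPoly T i f).degree = f.degree := by
  have : (repPoly T i f).support = f.support := by
    ext d
    rw [mem_support_iff, mem_support_iff, coeff_repPoly h, ne_eq, ne_eq,
      ← normalForm_zero h (i := i), (normalForm_injective h).eq_iff]
  rw [degree, degree, this]

theorem natDegree_repPoly (h : IsMonicTriangular T) (f : (TriQuot T i)[X]) :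
    (repPoly T i f).natDegree = f.natDegree := by
  rw [natDegree, natDegree, degree_repPoly h]

theorem repPoly_eq_zero (h : IsMonicTriangular T) {f : (TriQuot T i)[X]} :
    repPoly T i f = 0 ↔ f = 0 := by
  rw [← repPoly_zero h (i := i), (repPoly_injective h).eq_iff]

theorem repPoly_monic (h : IsMonicTriangular T) {f : (TriQuot T i)[X]} (hf : f.Monic) :
    (repPoly T i f).Monic := by
  rw [Monic, leadingCoeff, natDegree_repPoly h, coeff_repPoly h, ← leadingCoeff, hf,
    normalForm_one h]

end

/-! ### Elements of low level -/

/-- The subring of `TriQuot T i` generated over `k` by the `z_l` with `l < i`. -/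
def lowSubring (T : Fin n → MvPolynomial (Fin n) k) (i : ℕ) : Subring (TriQuot T i) :=
  (lowVars k n i).toSubring.map (Ideal.Quotient.mk (triIdeal T i))

theorem mk_mem_lowSubring {f : MvPolynomial (Fin n) k} (hf : f ∈ lowVars k n i) :
    Ideal.Quotient.mk (triIdeal T i) f ∈ lowSubring T i := ⟨f, hf, rfl⟩

theorem lowSubring_top (T : Fin n → MvPolynomial (Fin n) k) : lowSubring T n = ⊤ := by
  rw [eq_top_iff]
  intro u _
  obtain ⟨f, rfl⟩ := Ideal.Quotient.mk_surjective u
  exact mk_mem_lowSubring (mem_lowVars.2 fun j hj => absurd j.isLt (by omega))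

theorem normalForm_mem_supported [Nontrivial k] (h : IsMonicTriangular T) {s : Set (Fin n)}
    (hs : ∀ l : Fin n, l.val < i → l ∈ s) {f : MvPolynomial (Fin n) k}
    (hf : f ∈ MvPolynomial.supported k s) :
    normalForm T i (Ideal.Quotient.mk _ f) ∈ MvPolynomial.supported k s := by
  obtain ⟨r, hr, hrs, hfr⟩ := exists_reduced h hs hf
  rwa [normalForm_eq h hr (Ideal.Quotient.eq.2 hfr).symm]

/-- `TriQuot T i` still contains the larger variables as free ones, and inversion at level `i` is
only meant for elements without them. All later specifications are therefore relative to
`lowSubring`, and this lemma lets them descend from one level to the previous one. -/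
theorem normalForm_mem_lowVars [Nontrivial k] (h : IsMonicTriangular T) {u : TriQuot T i}
    (hu : u ∈ lowSubring T i) : normalForm T i u ∈ lowVars k n i := by
  obtain ⟨f, hf, rfl⟩ := hu
  exact normalForm_mem_supported h (fun _ hl => hl) hf

/-- Polynomials with coefficients of low level. -/
def lowPolys (T : Fin n → MvPolynomial (Fin n) k) (i : ℕ) : Subring (TriQuot T i)[X] :=
  Polynomial.liftsRing (lowSubring T i).subtype

theorem mem_lowPolys {f : (TriQuot T i)[X]} :
    f ∈ lowPolys T i ↔ ∀ d, f.coeff d ∈ lowSubring T i := by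
  rw [lowPolys]
  change f ∈ Polynomial.lifts _ ↔ _
  rw [Polynomial.lifts_iff_coeff_lifts]
  simp

theorem projPoly_mem_lowPolys {F : (MvPolynomial (Fin n) k)[X]}
    (hF : ∀ d, F.coeff d ∈ lowVars k n i) : projPoly T i F ∈ lowPolys T i :=
  mem_lowPolys.2 fun d => by
    rw [coeff_projPoly]
    exact mk_mem_lowSubring (hF d)

theorem levelPoly_mem_lowPolys (h : IsMonicTriangular T) (j : Fin n) :
    levelPoly T j ∈ lowPolys T j :=
  projPoly_mem_lowPolys fun d => coeff_viewAt_mem_lowVars (h.mem_lowVars j) d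

theorem lowPolys_top (T : Fin n → MvPolynomial (Fin n) k) (f : (TriQuot T n)[X]) :
    f ∈ lowPolys T n :=
  mem_lowPolys.2 fun d => by rw [lowSubring_top]; trivial

theorem coeff_repPoly_mem_lowVars [Nontrivial k] (h : IsMonicTriangular T) {f : (TriQuot T i)[X]}
    (hf : f ∈ lowPolys T i) (d : ℕ) : (repPoly T i f).coeff d ∈ lowVars k n i := by
  rw [coeff_repPoly h]
  exact normalForm_mem_lowVars h (mem_lowPolys.1 hf d)

section Lifts

variable {A : Type} [CommRing A] (S : Subring A)

theorem exists_lift_of_mem_liftsRing {f : A[X]} (hf : f ∈ Polynomial.liftsRing S.subtype) :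
    ∃ F : S[X], F.map S.subtype = f :=
  (Polynomial.mem_lifts _).1 hf

theorem map_mem_liftsRing (F : S[X]) : F.map S.subtype ∈ Polynomial.liftsRing S.subtype :=
  (Polynomial.mem_lifts _).2 ⟨F, rfl⟩

theorem exists_lift_monic {f : A[X]} (hf : f ∈ Polynomial.liftsRing S.subtype) (hm : f.Monic) :
    ∃ F : S[X], F.map S.subtype = f ∧ F.Monic := by
  obtain ⟨F, rfl⟩ := exists_lift_of_mem_liftsRing S hf
  exact ⟨F, rfl, Polynomial.monic_of_injective Subtype.coe_injective hm⟩

/-- Division by a monic polynomial commutes with ring homomorphisms, so it can be carried out over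
the subring. -/
theorem divByMonic_mem_liftsRing {f g : A[X]} (hf : f ∈ Polynomial.liftsRing S.subtype)
    (hg : g ∈ Polynomial.liftsRing S.subtype) (hm : g.Monic) :
    f /ₘ g ∈ Polynomial.liftsRing S.subtype := by
  obtain ⟨F, rfl⟩ := exists_lift_of_mem_liftsRing S hf
  obtain ⟨G, rfl, hG⟩ := exists_lift_monic S hg hm
  rw [← Polynomial.map_divByMonic _ hG]
  exact map_mem_liftsRing S _

theorem modByMonic_mem_liftsRing {f g : A[X]} (hf : f ∈ Polynomial.liftsRing S.subtype)
    (hg : g ∈ Polynomial.liftsRing S.subtype) (hm : g.Monic) :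
    f %ₘ g ∈ Polynomial.liftsRing S.subtype := by
  obtain ⟨F, rfl⟩ := exists_lift_of_mem_liftsRing S hf
  obtain ⟨G, rfl, hG⟩ := exists_lift_monic S hg hm
  rw [← Polynomial.map_modByMonic _ hG]
  exact map_mem_liftsRing S _

theorem mem_liftsRing_iff {f : A[X]} :
    f ∈ Polynomial.liftsRing S.subtype ↔ ∀ d, f.coeff d ∈ S := by
  change f ∈ Polynomial.lifts _ ↔ _
  rw [Polynomial.lifts_iff_coeff_lifts]
  simp

theorem C_mem_liftsRing {c : A} (hc : c ∈ S) : C c ∈ Polynomial.liftsRing S.subtype :=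
  (mem_liftsRing_iff S).2 fun d => by
    rw [coeff_C]
    split_ifs
    · exact hc
    · exact S.zero_mem

theorem derivative_mem_liftsRing {f : A[X]} (hf : f ∈ Polynomial.liftsRing S.subtype) :
    derivative f ∈ Polynomial.liftsRing S.subtype := by
  obtain ⟨F, rfl⟩ := exists_lift_of_mem_liftsRing S hf
  rw [Polynomial.derivative_map]
  exact map_mem_liftsRing S _

end Lifts

/-! ### From one level to the next -/

/-- Substitute `z_j` for the univariate variable. -/
def evalLevel (T : Fin n → MvPolynomial (Fin n) k) (j : Fin n) :
    (TriQuot T j.val)[X] →+* TriQuot T (j.val + 1) :=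
  Polynomial.eval₂RingHom (Ideal.Quotient.factor (triIdeal_mono T (Nat.le_succ _)))
    (Ideal.Quotient.mk _ (MvPolynomial.X j))

theorem evalLevel_projPoly (T : Fin n → MvPolynomial (Fin n) k) (j : Fin n)
    (F : (MvPolynomial (Fin n) k)[X]) :
    evalLevel T j (projPoly T j F) = Ideal.Quotient.mk _ (unviewAt j F) := by
  rw [evalLevel, projPoly, coe_mapRingHom, coe_eval₂RingHom, eval₂_map, unviewAt,
    Ideal.Quotient.factor_comp_mk, eval₂_at_apply]

theorem evalLevel_levelPoly (T : Fin n → MvPolynomial (Fin n) k) (j : Fin n) :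
    evalLevel T j (levelPoly T j) = 0 := by
  rw [levelPoly, evalLevel_projPoly, unviewAt_viewAt, Ideal.Quotient.eq_zero_iff_mem]
  exact IsMonicTriangular.mem_triIdeal T (Nat.lt_succ_self _)

section
variable [Nontrivial k]

theorem degreeOf_coeff_repPoly (h : IsMonicTriangular T) (j : Fin n) {f : (TriQuot T j.val)[X]}
    (hf : f ∈ lowPolys T j) (d : ℕ) : ((repPoly T j f).coeff d).degreeOf j = 0 :=
  mem_lowVars.1 (coeff_repPoly_mem_lowVars h hf d) j le_rfl

theorem viewAt_unviewAt_repPoly (h : IsMonicTriangular T) (j : Fin n) {f : (TriQuot T j.val)[X]}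
    (hf : f ∈ lowPolys T j) : viewAt j (unviewAt j (repPoly T j f)) = repPoly T j f :=
  viewAt_unviewAt (degreeOf_coeff_repPoly h j hf)

theorem evalLevel_eq (h : IsMonicTriangular T) (j : Fin n) (f : (TriQuot T j.val)[X]) :
    evalLevel T j f = Ideal.Quotient.mk _ (unviewAt j (repPoly T j f)) := by
  rw [← evalLevel_projPoly, projPoly_repPoly h]

theorem evalLevel_mem_lowSubring (h : IsMonicTriangular T) (j : Fin n)
    {f : (TriQuot T j.val)[X]} (hf : f ∈ lowPolys T j) :
    evalLevel T j f ∈ lowSubring T (j + 1) := by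
  rw [evalLevel_eq h]
  exact mk_mem_lowSubring (unviewAt_mem_lowVars (coeff_repPoly_mem_lowVars h hf))

/-- If `f` has degree smaller than `t_j` then substituting `z_j` yields a reduced polynomial. -/
theorem isReducedWrt_unviewAt_repPoly (h : IsMonicTriangular T) (j : Fin n)
    {f : (TriQuot T j.val)[X]} (hf : f ∈ lowPolys T j) (hd : f.natDegree < (T j).degreeOf j)
    (i : ℕ) : IsReducedWrt T i (unviewAt j (repPoly T j f)) := by
  intro l _
  rcases lt_trichotomy l j with hl | rfl | hl
  · refine lt_of_le_of_lt (degreeOf_unviewAt_le hl.ne (N := (T l).degreeOf l - 1) fun d => ?_)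
      (by have := h.mainVar l; omega)
    have := isReducedWrt_coeff_repPoly h f d l hl
    omega
  · rwa [degreeOf_unviewAt_self_le (degreeOf_coeff_repPoly h l hf), natDegree_repPoly h]
  · rw [mem_lowVars.1 (unviewAt_mem_lowVars (coeff_repPoly_mem_lowVars h hf)) l
      (by have : j.val < l.val := hl
          omega)]
    exact h.mainVar l

/-- The remainder `r` of `f` also has a square divisible by `t_j`, so substituting `z_j` gives an
element whose square lies in `⟨T⟩`. By radicality the element lies there too; being reduced with
respect to all of `T`, it is zero. In this way radicality of the full ideal is used at level `j`
directly, without proving the intermediate ideals radical. -/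
theorem levelPoly_dvd_of_sq (h : IsMonicTriangular T) (hrad : (triIdeal T n).IsRadical)
    (j : Fin n) {f : (TriQuot T j.val)[X]} (hf : f ∈ lowPolys T j)
    (h2 : levelPoly T j ∣ f ^ 2) : levelPoly T j ∣ f := by
  have := h.nontrivial_triQuot j.val
  have hm := levelPoly_monic h j
  set r := f %ₘ levelPoly T j with hr
  have hr_low : r ∈ lowPolys T j := modByMonic_mem_liftsRing _ hf (levelPoly_mem_lowPolys h j) hm
  have hdeg : r.natDegree < (T j).degreeOf j := by
    rw [← natDegree_levelPoly h j]
    refine natDegree_modByMonic_lt _ hm fun h1 => ?_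
    have := natDegree_levelPoly h j
    rw [h1, natDegree_one] at this
    exact (h.mainVar j).ne this
  have h3 : levelPoly T j ∣ r ^ 2 := by
    have h4 : levelPoly T j ∣ f - r := by
      rw [hr, modByMonic_eq_sub_mul_div, sub_sub_cancel]
      exact Dvd.intro _ rfl
    have h5 : r ^ 2 = f ^ 2 - (f - r) * (f + r) := by ring
    rw [h5]
    exact dvd_sub h2 (Dvd.dvd.mul_right h4 _)
  have h6 : unviewAt j (repPoly T j r) ^ 2 ∈ triIdeal T n := by
    refine triIdeal_mono T j.isLt ?_
    rw [← Ideal.Quotient.eq_zero_iff_mem, map_pow, ← evalLevel_eq h, ← map_pow]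
    obtain ⟨c, hc⟩ := h3
    rw [hc, map_mul, evalLevel_levelPoly, zero_mul]
  have h7 := eq_zero_of_isReducedWrt h n _ (isReducedWrt_unviewAt_repPoly h j hr_low hdeg n)
    (hrad ⟨2, h6⟩)
  have h8 : r = 0 := by
    have := viewAt_unviewAt_repPoly h j hr_low
    rw [h7, map_zero] at this
    exact (repPoly_eq_zero h).1 this.symm
  exact (modByMonic_eq_zero_iff_dvd hm).1 h8

end

end

/-! ### The monic Euclidean algorithm and inversion modulo `p` -/

noncomputable section

section Euclid

variable {A W : Type} [CommRing A]

/-- `g = s a + t b` is a common divisor of `a` and `b`, everything has coefficients in `S`, and `g`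
is monic unless `a = b = 0`. -/
structure IsBezoutGCD (S : Subring A) (a b g s t : A[X]) : Prop where
  mem_g : g ∈ Polynomial.liftsRing S.subtype
  mem_s : s ∈ Polynomial.liftsRing S.subtype
  mem_t : t ∈ Polynomial.liftsRing S.subtype
  bezout : g = s * a + t * b
  dvd_left : g ∣ a
  dvd_right : g ∣ b
  monic : g.Monic ∨ a = 0 ∧ b = 0 ∧ g = 0

/-- Specification of an inversion routine on the nonzero elements of `S`. -/
def InvSpec (S : Subring A) (E : W → Prop) (inv : A → Except W A) : Prop :=
  ∀ u ∈ S, u ≠ 0 → (∀ c, inv u = .ok c → c ∈ S ∧ u * c = 1) ∧ ∀ w, inv u = .error w → E w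

/-- The loop invariants: both rows are combinations of `a` and `b`, common divisors of the two
current remainders divide `a` and `b`, and the older remainder is already monic when the newer one
vanishes. -/
theorem euclidLoop_spec {S : Subring A} {E : W → Prop} {inv : A → Except W A}
    (hinv : InvSpec S E inv) (a b : A[X]) (m : ℕ) :
    ∀ r₀ s₀ t₀ r₁ s₁ t₁ : A[X],
      r₀ ∈ Polynomial.liftsRing S.subtype → s₀ ∈ Polynomial.liftsRing S.subtype →
      t₀ ∈ Polynomial.liftsRing S.subtype → r₁ ∈ Polynomial.liftsRing S.subtype →
      s₁ ∈ Polynomial.liftsRing S.subtype → t₁ ∈ Polynomial.liftsRing S.subtype →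
      r₀ = s₀ * a + t₀ * b → r₁ = s₁ * a + t₁ * b →
      (∀ d, d ∣ r₀ → d ∣ r₁ → d ∣ a ∧ d ∣ b) → r₁.degree < m → (r₁ = 0 → r₀.Monic) →
      (∀ g s t, euclidLoop inv m (r₀, s₀, t₀) (r₁, s₁, t₁) = .ok (g, s, t) →
        IsBezoutGCD S a b g s t ∧ g.Monic) ∧
      ∀ w, euclidLoop inv m (r₀, s₀, t₀) (r₁, s₁, t₁) = .error w → E w := by
  induction m with
  | zero =>
    intro r₀ s₀ t₀ r₁ s₁ t₁ hr₀ hs₀ ht₀ hr₁ hs₁ ht₁ h₀ h₁ hd hdeg hm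
    -- A degree below `0` means the zero polynomial: fuel runs out only when the algorithm has ended
    -- anyway.
    have hr : r₁ = 0 := by
      rw [← degree_eq_bot]
      simpa [Nat.WithBot.lt_zero_iff] using hdeg
    have hmon := hm hr
    simp only [euclidLoop]
    refine ⟨fun g s t h => ?_, fun w h => by cases h⟩
    cases h
    have := hd r₀ dvd_rfl (hr ▸ dvd_zero _)
    exact ⟨⟨hr₀, hs₀, ht₀, h₀, this.1, this.2, Or.inl hmon⟩, hmon⟩
  | succ m IH =>
    intro r₀ s₀ t₀ r₁ s₁ t₁ hr₀ hs₀ ht₀ hr₁ hs₁ ht₁ h₀ h₁ hd hdeg hm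
    rw [euclidLoop]
    by_cases hr : r₁ = 0
    · rw [if_pos hr]
      have hmon := hm hr
      refine ⟨fun g s t h => ?_, fun w h => by cases h⟩
      cases h
      have := hd r₀ dvd_rfl (hr ▸ dvd_zero _)
      exact ⟨⟨hr₀, hs₀, ht₀, h₀, this.1, this.2, Or.inl hmon⟩, hmon⟩
    · rw [if_neg hr]
      have hu := hinv r₁.leadingCoeff ((mem_liftsRing_iff S).1 hr₁ _)
        (leadingCoeff_ne_zero.2 hr)
      cases hc : inv r₁.leadingCoeff with
      | error w =>
        refine ⟨fun g s t h => by simp at h, fun w' h => ?_⟩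
        simp only [Except.error.injEq] at h
        exact h ▸ hu.2 w hc
      | ok c =>
        obtain ⟨hcS, hc1⟩ := hu.1 c hc
        have hmon : (C c * r₁).Monic :=
          monic_C_mul_of_mul_leadingCoeff_eq_one (by rw [mul_comm]; exact hc1)
        have hC := C_mem_liftsRing S hcS
        have hrL := Subring.mul_mem _ hC hr₁
        have hq := divByMonic_mem_liftsRing S hr₀ hrL hmon
        have : Nontrivial A := by
          by_contra hA
          rw [not_nontrivial_iff_subsingleton] at hA
          exact hr (Subsingleton.elim _ _)
        have hmod : r₀ %ₘ (C c * r₁) = r₀ - (C c * r₁) * (r₀ /ₘ (C c * r₁)) :=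
          modByMonic_eq_sub_mul_div _ _
        refine IH _ _ _ _ _ _ hrL (Subring.mul_mem _ hC hs₁) (Subring.mul_mem _ hC ht₁)
          (modByMonic_mem_liftsRing S hr₀ hrL hmon)
          (Subring.sub_mem _ hs₀ (Subring.mul_mem _ hq (Subring.mul_mem _ hC hs₁)))
          (Subring.sub_mem _ ht₀ (Subring.mul_mem _ hq (Subring.mul_mem _ hC ht₁)))
          ?_ ?_ ?_ ?_ fun _ => hmon
        · rw [h₁]; ring
        · rw [hmod]
          set q := r₀ /ₘ (C c * r₁)
          rw [h₀, h₁]; ring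
        · intro d hd1 hd2
          apply hd
          · rw [← modByMonic_add_div r₀ (C c * r₁)]
            exact dvd_add hd2 (Dvd.dvd.mul_right hd1 _)
          · have : r₁ = C r₁.leadingCoeff * (C c * r₁) := by
              rw [← mul_assoc, ← C_mul, hc1, C_1, one_mul]
            rw [this]
            exact Dvd.dvd.mul_left hd1 _
        · refine lt_of_lt_of_le (degree_modByMonic_lt _ hmon) ?_
          have h2 : (C c * r₁).degree ≤ r₁.degree :=
            (degree_mul_le _ _).trans (by
              have := degree_C_le (a := c)
              calc (C c).degree + r₁.degree ≤ 0 + r₁.degree := by gcongr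
                _ = _ := zero_add _)
          refine h2.trans ?_
          rw [degree_eq_natDegree hr] at hdeg ⊢
          exact_mod_cast Nat.lt_succ_iff.1 (by exact_mod_cast hdeg)

theorem monicEuclid_spec {S : Subring A} {E : W → Prop} {inv : A → Except W A}
    (hinv : InvSpec S E inv) {a b : A[X]} (ha : a ∈ Polynomial.liftsRing S.subtype)
    (hb : b ∈ Polynomial.liftsRing S.subtype) :
    (∀ g s t, monicEuclid inv a b = .ok (g, s, t) → IsBezoutGCD S a b g s t) ∧
      ∀ w, monicEuclid inv a b = .error w → E w := by
  rw [monicEuclid]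
  by_cases hb0 : b = 0
  · rw [if_pos hb0]
    by_cases ha0 : a = 0
    · rw [if_pos ha0]
      refine ⟨fun g s t h => ?_, fun w h => by cases h⟩
      cases h
      exact ⟨zero_mem _, zero_mem _, zero_mem _, by simp, by simp [ha0], by simp [hb0],
        Or.inr ⟨ha0, hb0, rfl⟩⟩
    · rw [if_neg ha0]
      have hu := hinv a.leadingCoeff ((mem_liftsRing_iff S).1 ha _) (leadingCoeff_ne_zero.2 ha0)
      cases hc : inv a.leadingCoeff with
      | error w =>
        refine ⟨fun g s t h => by simp at h, fun w' h => ?_⟩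
        simp only [Except.error.injEq] at h
        exact h ▸ hu.2 w hc
      | ok c =>
        obtain ⟨hcS, hc1⟩ := hu.1 c hc
        have hC := C_mem_liftsRing S hcS
        refine ⟨fun g s t h => ?_, fun w h => by cases h⟩
        cases h
        refine ⟨Subring.mul_mem _ hC ha, hC, zero_mem _, by simp, ?_, by simp [hb0],
          Or.inl (monic_C_mul_of_mul_leadingCoeff_eq_one (by rw [mul_comm]; exact hc1))⟩
        exact ⟨C a.leadingCoeff, by
          rw [mul_right_comm, ← C_mul, mul_comm c, hc1, C_1, one_mul]⟩
  · rw [if_neg hb0]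
    -- The first row need not be monic; the invariant about monicity is vacuous at the start because
    -- `b ≠ 0`.
    have := euclidLoop_spec hinv a b (b.natDegree + 1) a 1 0 b 0 1 ha (one_mem _) (zero_mem _) hb
      (zero_mem _) (one_mem _) (by ring) (by ring) (fun d h1 h2 => ⟨h1, h2⟩)
      (by rw [degree_eq_natDegree hb0]; exact_mod_cast Nat.lt_succ_self _)
      (fun h => absurd h hb0)
    exact ⟨fun g s t h => (this.1 g s t h).1, this.2⟩

end Euclid

/-- `g` is a proper monic factor of `t_j`, with coefficients of low level. -/
structure IsLevelFactor {k : Type} [CommRing k] {n : ℕ} (T : Fin n → MvPolynomial (Fin n) k)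
    (j : Fin n) (g : (TriQuot T j.val)[X]) : Prop where
  mem : g ∈ lowPolys T j
  monic : g.Monic
  dvd : g ∣ levelPoly T j
  pos : 0 < g.natDegree
  lt : g.natDegree < (T j).degreeOf j

/-- `w` represents a proper monic factor of some `t_j`. -/
def IsZeroDivisor {n p : ℕ} (T : Fin n → MvPolynomial (Fin n) (ZMod p)) (w : ZeroDivisor n p) :
    Prop :=
  ∃ g, IsLevelFactor T w.1 g ∧ w.2 = repPoly T w.1 g

section InvLevel

variable {n p : ℕ} [Fact p.Prime] {T : Fin n → MvPolynomial (Fin n) (ZMod p)}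

theorem natDegree_projPoly_viewAt_lt {k : Type} [CommRing k] [Nontrivial k]
    {T : Fin n → MvPolynomial (Fin n) k} (h : IsMonicTriangular T) (j : Fin n)
    (u : TriQuot T (j.val + 1)) :
    (projPoly T j.val (viewAt j (normalForm T (j.val + 1) u))).natDegree < (T j).degreeOf j :=
  lt_of_le_of_lt natDegree_map_le (by
    rw [natDegree_viewAt]
    exact isReducedWrt_normalForm h u j (Nat.lt_succ_self _))

theorem projPoly_viewAt_normalForm_ne_zero {k : Type} [CommRing k] [Nontrivial k]
    {T : Fin n → MvPolynomial (Fin n) k} (h : IsMonicTriangular T) (j : Fin n)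
    {u : TriQuot T (j.val + 1)} (hu : u ≠ 0) :
    projPoly T j.val (viewAt j (normalForm T (j.val + 1) u)) ≠ 0 := by
  intro h0
  apply hu
  have := evalLevel_projPoly T j (viewAt j (normalForm T (j.val + 1) u))
  rwa [h0, map_zero, unviewAt_viewAt, mk_normalForm h, eq_comm] at this

theorem projPoly_viewAt_normalForm_mem {k : Type} [CommRing k] [Nontrivial k]
    {T : Fin n → MvPolynomial (Fin n) k} (h : IsMonicTriangular T) (j : Fin n)
    {u : TriQuot T (j.val + 1)} (hu : u ∈ lowSubring T (j.val + 1)) :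
    projPoly T j.val (viewAt j (normalForm T (j.val + 1) u)) ∈ lowPolys T j :=
  projPoly_mem_lowPolys fun d => coeff_viewAt_mem_lowVars (normalForm_mem_lowVars h hu) d

theorem evalLevel_projPoly_viewAt_normalForm {k : Type} [CommRing k] [Nontrivial k]
    {T : Fin n → MvPolynomial (Fin n) k} (h : IsMonicTriangular T) (j : Fin n)
    (u : TriQuot T (j.val + 1)) :
    evalLevel T j (projPoly T j.val (viewAt j (normalForm T (j.val + 1) u))) = u := by
  rw [evalLevel_projPoly, unviewAt_viewAt, mk_normalForm h]

/-- A Bézout relation `1 = s t_i + t U` becomes an inverse of `u` after substituting `z_i`.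
Otherwise the monic gcd divides `t_i` and the nonzero `U` of smaller degree, and so is a proper
factor. The bound on the main variable of a reported error shows that nested reports descend. -/
theorem invLevel_spec (h : IsMonicTriangular T) (i : ℕ) (hi : i ≤ n) :
    InvSpec (lowSubring T i) (fun w => IsZeroDivisor T w ∧ w.1.val < i) (invLevel p T i) := by
  induction i with
  | zero =>
    intro u hu hu0
    simp only [invLevel]
    refine ⟨fun c hc => ?_, fun w hw => by cases hw⟩
    cases hc
    refine ⟨mk_mem_lowSubring (Subalgebra.algebraMap_mem _ _), ?_⟩
    have hl := normalForm_mem_lowVars h hu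
    have hC : normalForm T 0 u = MvPolynomial.C ((normalForm T 0 u).coeff 0) := by
      rw [lowVars, show {l : Fin n | l.val < 0} = ∅ by ext; simp, MvPolynomial.supported_empty,
        Algebra.mem_bot] at hl
      obtain ⟨c, hc⟩ := hl
      rw [← hc]
      simp
    have hne : (normalForm T 0 u).coeff 0 ≠ 0 := by
      intro h0
      rw [h0, MvPolynomial.C_0] at hC
      apply hu0
      rw [← mk_normalForm h u, hC, map_zero]
    have hu' := mk_normalForm h u
    rw [hC] at hu'
    calc u * Ideal.Quotient.mk _ (MvPolynomial.C ((normalForm T 0 u).coeff 0)⁻¹)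
        = Ideal.Quotient.mk _ (MvPolynomial.C ((normalForm T 0 u).coeff 0)) *
          Ideal.Quotient.mk _ (MvPolynomial.C ((normalForm T 0 u).coeff 0)⁻¹) := by rw [hu']
      _ = 1 := by
        rw [← map_mul, ← MvPolynomial.C_mul, mul_inv_cancel₀ hne, MvPolynomial.C_1, map_one]
  | succ i IH =>
    intro u hu hu0
    have hin : i < n := hi
    set j : Fin n := ⟨i, hin⟩ with hj
    have hnt := h.nontrivial_triQuot i
    have hU := projPoly_viewAt_normalForm_mem h j hu
    have hU0 := projPoly_viewAt_normalForm_ne_zero h j hu0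
    have hspec := monicEuclid_spec (IH hin.le) (levelPoly_mem_lowPolys h j) hU
    rw [invLevel, dif_pos hin]
    cases he : monicEuclid (invLevel p T i) (levelPoly T j)
        (projPoly T i (viewAt j (normalForm T (i + 1) u))) with
    | error w =>
      refine ⟨fun c hc => by simp at hc, fun w' hw => ?_⟩
      simp only [Except.error.injEq] at hw
      have := hspec.2 w he
      exact hw ▸ ⟨this.1, this.2.trans (Nat.lt_succ_self _)⟩
    | ok x =>
      obtain ⟨g, s, t⟩ := x
      have hg := hspec.1 g s t he
      have hgm : g.Monic := hg.monic.resolve_right fun h' => hU0 h'.2.1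
      by_cases hg1 : g = 1
      · simp only [hg1, if_true]
        refine ⟨fun c hc => ?_, fun w hw => by cases hw⟩
        have hc' : Ideal.Quotient.mk _ (unviewAt j (repPoly T i t)) = c := by
          simpa using hc
        have hc2 : evalLevel T j t = c := by rw [evalLevel_eq h, ← hc']
        subst hc2
        refine ⟨evalLevel_mem_lowSubring h j hg.mem_t, ?_⟩
        -- Substituting `z_j` kills `t_j` and turns the second polynomial back into `u`.
        have h1 := congrArg (evalLevel T j) hg.bezout
        rw [hg1, map_one, map_add, map_mul, map_mul, evalLevel_levelPoly, mul_zero, zero_add,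
          evalLevel_projPoly_viewAt_normalForm h j u] at h1
        rw [mul_comm]
        exact h1.symm
      · simp only [hg1, if_false]
        refine ⟨fun c hc => (by simp at hc), fun w hw => ?_⟩
        simp only [Except.error.injEq] at hw
        subst hw
        refine ⟨⟨g, ⟨hg.mem_g, hgm, hg.dvd_left, ?_, ?_⟩, rfl⟩, Nat.lt_succ_self i⟩
        · rw [Nat.pos_iff_ne_zero]
          exact fun h0 => hg1 (hgm.natDegree_eq_zero.1 h0)
        -- `g` divides a nonzero polynomial that has smaller degree than `t_j` because it comes from
        -- a normal form.
        · refine lt_of_le_of_lt ?_ (natDegree_projPoly_viewAt_lt h j u)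
          by_contra hlt
          exact hgm.not_dvd_of_natDegree_lt hU0 (not_le.1 hlt) hg.dvd_right

theorem isRadicalPrime_error (h : IsMonicTriangular T) (i : ℕ) (w : ZeroDivisor n p)
    (hw : isRadicalPrime p T i = .error w) : IsZeroDivisor T w := by
  induction i with
  | zero => simp [isRadicalPrime] at hw
  | succ i IH =>
    rw [isRadicalPrime] at hw
    split at hw
    · rename_i w' h'
      simp only [Except.error.injEq] at hw
      exact IH (hw ▸ h')
    · simp at hw
    · split_ifs at hw with hin
      split at hw
      · rename_i w' h'
        simp only [Except.error.injEq] at hw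
        subst hw
        have hl := levelPoly_mem_lowPolys h ⟨i, hin⟩
        exact ((monicEuclid_spec (invLevel_spec h i hin.le) hl
          (derivative_mem_liftsRing _ hl)).2 w' h').1
      · simp at hw

end InvLevel

end

/-! ### Coefficientwise maps -/

noncomputable section

section MapCoeffs

variable {A B : Type} [CommRing A] [CommRing B] {n : ℕ}

theorem coeff_mapCoeffs {φ : A → B} (h0 : φ 0 = 0) (f : MvPolynomial (Fin n) A) (e : Fin n →₀ ℕ) :
    (mapCoeffs φ f).coeff e = φ (f.coeff e) := by
  classical
  rw [mapCoeffs, MvPolynomial.coeff_sum]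
  simp only [MvPolynomial.coeff_monomial, Finset.sum_ite_eq']
  split_ifs with he
  · rfl
  · rw [MvPolynomial.notMem_support_iff.1 he, h0]

theorem mapCoeffs_zero (φ : A → B) : mapCoeffs φ (0 : MvPolynomial (Fin n) A) = 0 := by
  simp [mapCoeffs]

theorem coeff_mapCoeffsPoly {φ : A → B} (f : (MvPolynomial (Fin n) A)[X])
    (d : ℕ) : (mapCoeffsPoly φ f).coeff d = mapCoeffs φ (f.coeff d) := by
  rw [mapCoeffsPoly, finsetSum_coeff]
  simp only [coeff_monomial, Finset.sum_ite_eq']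
  split_ifs with hd
  · rfl
  · rw [notMem_support_iff.1 hd, mapCoeffs_zero]

theorem coeff_coeff_mapCoeffsPoly {φ : A → B} (h0 : φ 0 = 0) (f : (MvPolynomial (Fin n) A)[X])
    (d : ℕ) (e : Fin n →₀ ℕ) :
    ((mapCoeffsPoly φ f).coeff d).coeff e = φ ((f.coeff d).coeff e) := by
  rw [coeff_mapCoeffsPoly, coeff_mapCoeffs h0]

theorem mapCoeffs_eq_map {C : Type} [CommRing C] (ι : C →+* A) (π : C →+* B) {φ : A → B}
    (h : ∀ c, φ (ι c) = π c) (f : MvPolynomial (Fin n) C) :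
    mapCoeffs φ (MvPolynomial.map ι f) = MvPolynomial.map π f := by
  ext e
  rw [coeff_mapCoeffs (by simpa using h 0), MvPolynomial.coeff_map, MvPolynomial.coeff_map, h]

theorem mapCoeffsPoly_eq_map {C : Type} [CommRing C] (ι : C →+* A) (π : C →+* B) {φ : A → B}
    (h : ∀ c, φ (ι c) = π c) (f : (MvPolynomial (Fin n) C)[X]) :
    mapCoeffsPoly φ (f.map (MvPolynomial.map ι)) = f.map (MvPolynomial.map π) := by
  ext1 d
  rw [coeff_mapCoeffsPoly, Polynomial.coeff_map, Polynomial.coeff_map, mapCoeffs_eq_map ι π h]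

theorem degreeOf_le_of_coeff {f : MvPolynomial (Fin n) A} {g : MvPolynomial (Fin n) B}
    (h : ∀ e, f.coeff e = 0 → g.coeff e = 0) (l : Fin n) : g.degreeOf l ≤ f.degreeOf l := by
  rw [MvPolynomial.degreeOf_le_iff]
  intro m hm
  apply MvPolynomial.le_degreeOf_of_mem_support
  rw [MvPolynomial.mem_support_iff] at hm ⊢
  exact fun h0 => hm (h m h0)

theorem degreeOf_mapCoeffs_le {φ : A → B} (h0 : φ 0 = 0) (f : MvPolynomial (Fin n) A) (l : Fin n) :
    (mapCoeffs φ f).degreeOf l ≤ f.degreeOf l :=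
  degreeOf_le_of_coeff (fun e he => by rw [coeff_mapCoeffs h0, he, h0]) l

theorem degreeOf_map_le' (φ : A →+* B) (f : MvPolynomial (Fin n) A) (l : Fin n) :
    (MvPolynomial.map φ f).degreeOf l ≤ f.degreeOf l :=
  degreeOf_le_of_coeff (fun e he => by rw [MvPolynomial.coeff_map, he, map_zero]) l

theorem degreeOf_map_of_injective' {φ : A →+* B} (hφ : Function.Injective φ)
    (f : MvPolynomial (Fin n) A) (l : Fin n) :
    (MvPolynomial.map φ f).degreeOf l = f.degreeOf l :=
  le_antisymm (degreeOf_map_le' φ f l)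
    (degreeOf_le_of_coeff (fun e he => by
      rw [MvPolynomial.coeff_map] at he
      exact (map_eq_zero_iff φ hφ).1 he) l)

end MapCoeffs

/-! ### Base change of triangular sets -/

section BaseChange

variable {k k' : Type} [CommRing k] [CommRing k'] {n : ℕ} {φ : k →+* k'}
  {T : Fin n → MvPolynomial (Fin n) k} {T' : Fin n → MvPolynomial (Fin n) k'} {i : ℕ}

/-- Base change along `φ`, where `T'` is the image of `T`. -/
def triQuotMap (φ : k →+* k') (hT : ∀ j, MvPolynomial.map φ (T j) = T' j) (i : ℕ) :
    TriQuot T i →+* TriQuot T' i :=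
  Ideal.quotientMap (triIdeal T' i) (MvPolynomial.map φ) (Ideal.span_le.2 (by
    rintro _ ⟨l, hl, rfl⟩
    rw [SetLike.mem_coe, Ideal.mem_comap, hT]
    exact IsMonicTriangular.mem_triIdeal T' hl))

theorem triQuotMap_mk (hT : ∀ j, MvPolynomial.map φ (T j) = T' j) (f : MvPolynomial (Fin n) k) :
    triQuotMap φ hT i (Ideal.Quotient.mk _ f) = Ideal.Quotient.mk _ (MvPolynomial.map φ f) :=
  rfl

theorem viewAt_map (φ : k →+* k') (j : Fin n) (f : MvPolynomial (Fin n) k) :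
    viewAt j (MvPolynomial.map φ f) = (viewAt j f).map (MvPolynomial.map φ) := by
  ext d e
  rw [Polynomial.coeff_map, MvPolynomial.coeff_map, coeff_coeff_viewAt, coeff_coeff_viewAt]
  split_ifs
  · rw [MvPolynomial.coeff_map]
  · rw [map_zero]

theorem map_unviewAt (φ : k →+* k') (j : Fin n) (F : (MvPolynomial (Fin n) k)[X]) :
    MvPolynomial.map φ (unviewAt j F) = unviewAt j (F.map (MvPolynomial.map φ)) := by
  rw [unviewAt, unviewAt, ← MvPolynomial.map_X φ, eval_map_apply]

theorem map_projPoly (hT : ∀ j, MvPolynomial.map φ (T j) = T' j) (F : (MvPolynomial (Fin n) k)[X]) :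
    (projPoly T i F).map (triQuotMap φ hT i) = projPoly T' i (F.map (MvPolynomial.map φ)) := by
  ext1 d
  rw [Polynomial.coeff_map, coeff_projPoly, coeff_projPoly, triQuotMap_mk, Polynomial.coeff_map]

theorem map_levelPoly (hT : ∀ j, MvPolynomial.map φ (T j) = T' j) (j : Fin n) :
    (levelPoly T j).map (triQuotMap φ hT j) = levelPoly T' j := by
  rw [levelPoly, map_projPoly, ← viewAt_map, hT, levelPoly]

theorem degreeOf_map_self [Nontrivial k'] (h : IsMonicTriangular T)
    (hT : ∀ j, MvPolynomial.map φ (T j) = T' j) (j : Fin n) :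
    (T' j).degreeOf j = (T j).degreeOf j := by
  rw [← natDegree_viewAt, ← hT, viewAt_map, (h.monic j).natDegree_map, natDegree_viewAt]

theorem IsMonicTriangular.map [Nontrivial k'] (h : IsMonicTriangular T)
    (hT : ∀ j, MvPolynomial.map φ (T j) = T' j) : IsMonicTriangular T' where
  noLarger i j hij := by
    have := degreeOf_map_le' φ (T i) j
    rw [hT, h.noLarger i j hij] at this
    omega
  mainVar j := by rw [degreeOf_map_self h hT]; exact h.mainVar j
  monic j := by rw [← hT, viewAt_map]; exact (h.monic j).map _

theorem IsMonicTriangular.of_map (hφ : Function.Injective φ) (h : IsMonicTriangular T')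
    (hT : ∀ j, MvPolynomial.map φ (T j) = T' j) : IsMonicTriangular T where
  noLarger i j hij := by
    rw [← degreeOf_map_of_injective' hφ, hT, h.noLarger i j hij]
  mainVar j := by rw [← degreeOf_map_of_injective' hφ, hT]; exact h.mainVar j
  monic j := by
    have := h.monic j
    rw [← hT, viewAt_map] at this
    exact Polynomial.monic_of_injective (MvPolynomial.map_injective φ hφ) this

theorem IsReducedWrt.map [Nontrivial k'] (h : IsMonicTriangular T)
    (hT : ∀ j, MvPolynomial.map φ (T j) = T' j) {r : MvPolynomial (Fin n) k}
    (hr : IsReducedWrt T i r) : IsReducedWrt T' i (MvPolynomial.map φ r) := fun l hl => by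
  rw [degreeOf_map_self h hT]
  exact lt_of_le_of_lt (degreeOf_map_le' φ r l) (hr l hl)

variable [Nontrivial k']

/-- Monic elements keep their main degrees under `φ`, so reduced polynomials stay reduced and
uniqueness applies. Injectivity and the kernel of base change can then be read off from
coefficients. -/
theorem normalForm_triQuotMap (h : IsMonicTriangular T) (hT : ∀ j, MvPolynomial.map φ (T j) = T' j)
    (u : TriQuot T i) :
    normalForm T' i (triQuotMap φ hT i u) = MvPolynomial.map φ (normalForm T i u) :=
  normalForm_eq (h.map hT) ((isReducedWrt_normalForm h u).map h hT)
    (by rw [← triQuotMap_mk hT, mk_normalForm h])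

theorem repPoly_map [Nontrivial k] (h : IsMonicTriangular T)
    (hT : ∀ j, MvPolynomial.map φ (T j) = T' j) (f : (TriQuot T i)[X]) :
    repPoly T' i (f.map (triQuotMap φ hT i)) = (repPoly T i f).map (MvPolynomial.map φ) := by
  ext1 d
  rw [coeff_repPoly (h.map hT), Polynomial.coeff_map, normalForm_triQuotMap h hT,
    Polynomial.coeff_map, coeff_repPoly h]

theorem triQuotMap_injective [Nontrivial k] (hφ : Function.Injective φ) (h : IsMonicTriangular T)
    (hT : ∀ j, MvPolynomial.map φ (T j) = T' j) : Function.Injective (triQuotMap φ hT i) := by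
  intro u v huv
  apply normalForm_injective h
  apply MvPolynomial.map_injective φ hφ
  rw [← normalForm_triQuotMap h hT, huv, normalForm_triQuotMap h hT]

omit [Nontrivial k'] in
theorem triQuotMap_surjective (hφ : Function.Surjective φ)
    (hT : ∀ j, MvPolynomial.map φ (T j) = T' j) : Function.Surjective (triQuotMap φ hT i) :=
  Ideal.quotientMap_surjective (MvPolynomial.map_surjective φ hφ)

theorem map_evalLevel [Nontrivial k] (h : IsMonicTriangular T)
    (hT : ∀ j, MvPolynomial.map φ (T j) = T' j)
    (j : Fin n) (f : (TriQuot T j.val)[X]) :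
    triQuotMap φ hT (j.val + 1) (evalLevel T j f) =
      evalLevel T' j (f.map (triQuotMap φ hT j.val)) := by
  rw [evalLevel_eq h, triQuotMap_mk, map_unviewAt, evalLevel_eq (h.map hT), repPoly_map h hT]

end BaseChange

/-! ### The local ring of `ℤ` at `p` -/

section Localization

/-- The rational numbers whose denominator is prime to `p`. -/
def localInt (p : ℕ) [hp : Fact p.Prime] : Subring ℚ where
  carrier := {q | ¬ p ∣ q.den}
  mul_mem' {a b} ha hb h := by
    rcases hp.out.dvd_mul.1 (h.trans (Rat.mul_den_dvd a b)) with h | h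
    exacts [ha h, hb h]
  one_mem' h := hp.out.one_lt.ne' (Nat.dvd_one.1 h)
  add_mem' {a b} ha hb h := by
    rcases hp.out.dvd_mul.1 (h.trans (Rat.add_den_dvd a b)) with h | h
    exacts [ha h, hb h]
  zero_mem' h := hp.out.one_lt.ne' (Nat.dvd_one.1 h)
  neg_mem' {a} ha := by
    simpa using ha

variable (p : ℕ) [hp : Fact p.Prime]

theorem mem_localInt {q : ℚ} : q ∈ localInt p ↔ ¬ p ∣ q.den := Iff.rfl

theorem ratMod_eq_cast (q : ℚ) : ratMod p q = (q : ZMod p) := by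
  rw [ratMod, Rat.cast_def, div_eq_mul_inv]

theorem den_cast_ne_zero {q : ℚ} (hq : q ∈ localInt p) : (q.den : ZMod p) ≠ 0 := by
  rw [ne_eq, ZMod.natCast_eq_zero_iff]
  exact hq

/-- Reduction modulo `p`. -/
def localIntMod : localInt p →+* ZMod p where
  toFun q := ratMod p q
  map_one' := by simp [ratMod_eq_cast]
  map_zero' := by simp [ratMod_eq_cast]
  map_mul' a b := by
    rw [Subring.coe_mul, ratMod_eq_cast, ratMod_eq_cast, ratMod_eq_cast,
      Rat.cast_mul_of_ne_zero (den_cast_ne_zero p a.2) (den_cast_ne_zero p b.2)]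
  map_add' a b := by
    rw [Subring.coe_add, ratMod_eq_cast, ratMod_eq_cast, ratMod_eq_cast,
      Rat.cast_add_of_ne_zero (den_cast_ne_zero p a.2) (den_cast_ne_zero p b.2)]

theorem localIntMod_apply (q : localInt p) : localIntMod p q = ratMod p q := rfl

theorem localIntMod_surjective : Function.Surjective (localIntMod p) := by
  intro z
  refine ⟨(z.val : localInt p), ?_⟩
  rw [map_natCast, ZMod.natCast_zmod_val]

theorem inv_mem_localInt {q : ℚ} (hn : ¬ (p : ℤ) ∣ q.num) : q⁻¹ ∈ localInt p := by
  rw [mem_localInt, Rat.inv_def]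
  intro h
  apply hn
  have hq : q.num ≠ 0 := by rintro h0; exact hn (h0 ▸ dvd_zero _)
  have h2 : ((Rat.divInt q.den q.num).den : ℤ) ∣ q.num := Rat.den_dvd _ _
  exact (Int.natCast_dvd_natCast.2 h).trans h2

/-- Dividing the numerator by `p` leaves the denominator prime to `p`. -/
theorem localIntMod_eq_zero {q : localInt p} :
    localIntMod p q = 0 ↔ ∃ r : localInt p, q = (p : localInt p) * r := by
  constructor
  · intro h
    have h1 : (p : ℤ) ∣ (q : ℚ).num := by
      rw [localIntMod_apply, ratMod] at h
      rcases mul_eq_zero.1 h with h | h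
      · exact (ZMod.intCast_zmod_eq_zero_iff_dvd _ _).1 h
      · exact absurd h (inv_ne_zero (den_cast_ne_zero p q.2))
    obtain ⟨c, hc⟩ := h1
    have h2 : ((c : ℤ) : ℚ) / (q : ℚ).den ∈ localInt p := by
      rw [mem_localInt]
      intro h
      apply q.2
      have := Rat.den_dvd c (q : ℚ).den
      rw [Rat.divInt_eq_div, Int.cast_natCast] at this
      exact h.trans (Int.natCast_dvd_natCast.1 this)
    refine ⟨⟨_, h2⟩, ?_⟩
    apply Subtype.ext
    have h3 := Rat.num_div_den (q : ℚ)
    rw [hc] at h3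
    rw [Subring.coe_mul]
    conv_lhs => rw [← h3]
    push_cast
    ring
  · rintro ⟨r, rfl⟩
    rw [map_mul, map_natCast, ZMod.natCast_self, zero_mul]

theorem isUnit_localInt_iff {q : localInt p} : IsUnit q ↔ localIntMod p q ≠ 0 := by
  constructor
  · intro h
    exact (h.map (localIntMod p)).ne_zero
  · intro h
    have hn : ¬ (p : ℤ) ∣ (q : ℚ).num := by
      intro hd
      apply h
      rw [localIntMod_apply, ratMod, (ZMod.intCast_zmod_eq_zero_iff_dvd _ _).2 hd, zero_mul]
    have hq : (q : ℚ) ≠ 0 := by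
      intro h0
      rw [h0] at hn
      exact hn (by simp)
    exact IsUnit.of_mul_eq_one ⟨_, inv_mem_localInt p hn⟩ (Subtype.ext (mul_inv_cancel₀ hq))

instance : IsLocalRing (localInt p) := by
  refine IsLocalRing.of_nonunits_add fun a b ha hb => ?_
  rw [mem_nonunits_iff, isUnit_localInt_iff, not_not] at *
  rw [map_add, ha, hb, add_zero]

theorem natCast_mem_maximalIdeal : (p : localInt p) ∈ IsLocalRing.maximalIdeal (localInt p) := by
  rw [IsLocalRing.mem_maximalIdeal, mem_nonunits_iff, isUnit_localInt_iff, not_not, map_natCast,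
    ZMod.natCast_self]

end Localization

end

/-! ### Lifting a modular gcd by Nakayama's lemma -/

noncomputable section

theorem Polynomial.exists_eq_C_mul_of_map_eq_zero {O Q : Type} [CommRing O] [CommRing Q]
    {π : O →+* Q} {ϖ : O} (hker : ∀ u, π u = 0 → ∃ v, u = ϖ * v) {F : O[X]} (hF : F.map π = 0) :
    ∃ F', F = C ϖ * F' := by
  have h : ∀ d, ∃ v, F.coeff d = ϖ * v := fun d => hker _ (by rw [← coeff_map, hF, coeff_zero])
  choose v hv using h
  refine ⟨∑ d ∈ F.support, monomial d (v d), ?_⟩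
  conv_lhs => rw [F.as_sum_support]
  rw [Finset.mul_sum]
  refine Finset.sum_congr rfl fun d _ => ?_
  rw [C_mul_monomial, hv]

/-- With `I = (a, b)` and `d = deg g`, the module `O[X]/I` is finite because `I` contains a monic
polynomial, and modulo `ϖ` it is spanned by `1, …, X^(d-1)`. By Nakayama these span it over `O`, and
expressing `X^d` through them gives the monic element. Only membership of `g` in the reduced ideal
is used, not that `g` divides `a` and `b`. -/
theorem Polynomial.exists_monic_mem_span_pair {O Q : Type} [CommRing O] [CommRing Q]
    {π : O →+* Q} (hπ : Function.Surjective π) {ϖ : O}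
    (hϖ : ϖ ∈ (⊥ : Ideal O).jacobson)
    (hker : ∀ u, π u = 0 → ∃ v, u = ϖ * v) {a b : O[X]}
    (hab : IsUnit (π a.leadingCoeff) ∨ IsUnit (π b.leadingCoeff)) {g s t : Q[X]} (hg : g.Monic)
    (hgst : g = s * a.map π + t * b.map π) :
    ∃ G : O[X], G.Monic ∧ G.natDegree = g.natDegree ∧ G ∈ Ideal.span {a, b} := by
  classical
  -- Units lift along `π`, since its kernel is generated by an element of the Jacobson radical.
  have hunit : ∀ u : O, IsUnit (π u) → IsUnit u := by
    intro u hu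
    obtain ⟨w, hw⟩ := hu.exists_right_inv
    obtain ⟨w, rfl⟩ := hπ w
    obtain ⟨v, hv⟩ := hker (u * w - 1) (by rw [map_sub, map_mul, hw, map_one, sub_self])
    have h1 : IsUnit (u * w) := by
      rw [sub_eq_iff_eq_add.1 hv]
      exact Ideal.mem_jacobson_bot.1 hϖ v
    exact isUnit_of_mul_isUnit_left h1
  obtain ⟨c, hcI, hcm⟩ : ∃ c ∈ Ideal.span {a, b}, c.Monic := by
    rcases hab with h | h
    · obtain ⟨w, hw⟩ := (hunit _ h).exists_left_inv
      exact ⟨C w * a, Ideal.mul_mem_left _ _ (Ideal.subset_span (by simp)),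
        monic_C_mul_of_mul_leadingCoeff_eq_one hw⟩
    · obtain ⟨w, hw⟩ := (hunit _ h).exists_left_inv
      exact ⟨C w * b, Ideal.mul_mem_left _ _ (Ideal.subset_span (by simp)),
        monic_C_mul_of_mul_leadingCoeff_eq_one hw⟩
  set I : Ideal O[X] := Ideal.span {a, b} with hI
  rcases subsingleton_or_nontrivial O with hO | hO
  · exact ⟨0, Subsingleton.elim _ _, by
      have : Subsingleton Q := hπ.subsingleton
      rw [Subsingleton.elim g 0]; simp, zero_mem _⟩
  have hfin : Module.Finite O (O[X] ⧸ I) := by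
    have := hcm.finite_quotient
    have hle : Ideal.span {c} ≤ I := (Ideal.span_singleton_le_iff_mem _).2 hcI
    exact Module.Finite.of_surjective
      ((Ideal.Quotient.factorₐ O hle).toLinearMap) (Ideal.Quotient.factor_surjective hle)
  rcases subsingleton_or_nontrivial Q with hQ | hQ
  · have h1 : IsUnit (0 : O) := hunit 0 (by rw [Subsingleton.elim (π 0) 1]; exact isUnit_one)
    exact absurd h1 not_isUnit_zero
  set d := g.natDegree with hd
  set N : Submodule O (O[X] ⧸ I) := (degreeLT O d).map (I.mkQ.restrictScalars O) with hN
  -- Divide `f` by `g` modulo `ϖ`: the remainder has degree below `d`, the multiple of `g` lifts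
  -- into `I` by the Bézout relation, and what is left over is a multiple of `ϖ`.
  have key : (⊤ : Submodule O (O[X] ⧸ I)) ≤ N ⊔ Ideal.span {ϖ} • ⊤ := by
    intro x _
    obtain ⟨f, rfl⟩ := Ideal.Quotient.mk_surjective x
    obtain ⟨q, hq⟩ := Polynomial.map_surjective π hπ (f.map π /ₘ g)
    obtain ⟨s', hs⟩ := Polynomial.map_surjective π hπ s
    obtain ⟨t', ht⟩ := Polynomial.map_surjective π hπ t
    obtain ⟨r, hr, hrd⟩ := exists_degree_eq_of_mem_lifts
      (mem_lifts_of_surjective hπ (f.map π %ₘ g))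
    have hr_mem : r ∈ degreeLT O d := by
      rw [mem_degreeLT, hrd, hd, ← degree_eq_natDegree hg.ne_zero]
      exact degree_modByMonic_lt _ hg
    obtain ⟨F', hF'⟩ := Polynomial.exists_eq_C_mul_of_map_eq_zero hker
      (F := f - q * (s' * a + t' * b) - r) (by
        simp only [Polynomial.map_sub, Polynomial.map_mul, Polynomial.map_add, hq, hs, ht, hr]
        rw [← hgst, modByMonic_eq_sub_mul_div]
        ring)
    have hab' : q * (s' * a + t' * b) ∈ I :=
      Ideal.mul_mem_left _ _ (add_mem
        (Ideal.mul_mem_left _ _ (Ideal.subset_span (by simp)))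
        (Ideal.mul_mem_left _ _ (Ideal.subset_span (by simp))))
    have hf : Ideal.Quotient.mk I f = Ideal.Quotient.mk I r + ϖ • Ideal.Quotient.mk I F' := by
      have h1 : ϖ • Ideal.Quotient.mk I F' = Ideal.Quotient.mk I (C ϖ * F') := by
        rw [← smul_eq_C_mul]
        rfl
      rw [h1, ← map_add, Ideal.Quotient.eq, ← hF']
      have : f - (r + (f - q * (s' * a + t' * b) - r)) = q * (s' * a + t' * b) := by ring
      rwa [this]
    rw [hf]
    refine Submodule.add_mem_sup (Submodule.mem_map_of_mem hr_mem) ?_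
    exact Submodule.smul_mem_smul (Ideal.mem_span_singleton_self ϖ) trivial
  have hle : (⊤ : Submodule O (O[X] ⧸ I)) ≤ N :=
    Submodule.le_of_le_smul_of_le_jacobson_bot hfin.fg_top
      ((Ideal.span_singleton_le_iff_mem _).2 hϖ) key
  obtain ⟨r, hr, hrX⟩ := Submodule.mem_map.1
    (hle (show Ideal.Quotient.mk I (X ^ d) ∈ ⊤ from trivial))
  have hrX' : Ideal.Quotient.mk I r = Ideal.Quotient.mk I (X ^ d) := hrX
  have hrd : r.degree < d := mem_degreeLT.1 hr
  refine ⟨X ^ d - r, monic_X_pow_sub hrd, ?_, Ideal.Quotient.eq.1 hrX'.symm⟩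
  refine natDegree_eq_of_degree_eq_some ?_
  rw [degree_sub_eq_left_of_degree_lt (by rwa [degree_X_pow]), degree_X_pow]

/-- Each `1 + xy` is a unit: from `z = (1 + xy) z - x (y z)` the ideal it generates is all of `O`
modulo the maximal ideal of `R`, hence all of `O` by Nakayama. -/
theorem algebraMap_mem_jacobson_bot {R O : Type} [CommRing R] [IsLocalRing R] [CommRing O]
    [Algebra R O] [Module.Finite R O] {x : R} (hx : x ∈ IsLocalRing.maximalIdeal R) :
    algebraMap R O x ∈ (⊥ : Ideal O).jacobson := by
  rw [Ideal.mem_jacobson_bot]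
  intro y
  set N : Submodule R O := (Ideal.span {algebraMap R O x * y + 1}).restrictScalars R with hN
  have hle : (⊤ : Submodule R O) ≤ N := by
    refine Submodule.le_of_le_smul_of_le_jacobson_bot (I := IsLocalRing.maximalIdeal R)
      Module.Finite.fg_top (IsLocalRing.maximalIdeal_le_jacobson _) fun z _ => ?_
    have hz : z = (algebraMap R O x * y + 1) * z + x • (-(y * z)) := by
      rw [Algebra.smul_def]; ring
    rw [hz]
    refine Submodule.add_mem_sup ?_ (Submodule.smul_mem_smul hx trivial)
    exact Ideal.mul_mem_right _ _ (Ideal.mem_span_singleton_self _)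
  have h1 : (1 : O) ∈ Ideal.span {algebraMap R O x * y + 1} := hle trivial
  exact Ideal.span_singleton_eq_top.1 ((Ideal.eq_top_iff_one _).2 h1)

/-! ### Finiteness and dimension of the residue class ring -/

section Finite

variable {k : Type} [CommRing k] {n : ℕ} {T : Fin n → MvPolynomial (Fin n) k}

theorem finite_reducedExps (T : Fin n → MvPolynomial (Fin n) k) :
    (reducedExps T n Set.univ).Finite := by
  refine (Set.finite_Icc 0 (Finsupp.equivFunOnFinite.symm fun l => (T l).degreeOf l)).subset ?_
  intro e he
  refine ⟨zero_le, fun l => ?_⟩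
  exact (he.1 l l.isLt).le

/-- The residue classes of reduced polynomials. -/
def reducedToQuot (T : Fin n → MvPolynomial (Fin n) k) :
    MvPolynomial.restrictSupport k (reducedExps T n Set.univ) →ₗ[k] TriQuot T n :=
  (Ideal.Quotient.mkₐ k (triIdeal T n)).toLinearMap.comp (Submodule.subtype _)

theorem reducedToQuot_surjective (h : IsMonicTriangular T) :
    Function.Surjective (reducedToQuot T) := by
  intro u
  exact ⟨⟨normalForm T n u, (mem_restrictSupport_reducedExps h).2
    ⟨isReducedWrt_normalForm h u, by simp⟩⟩, mk_normalForm h u⟩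

theorem reducedToQuot_injective [Nontrivial k] (h : IsMonicTriangular T) :
    Function.Injective (reducedToQuot T) := by
  rw [injective_iff_map_eq_zero]
  rintro ⟨r, hr⟩ h0
  exact Subtype.ext (eq_zero_of_isReducedWrt h n r ((mem_restrictSupport_reducedExps h).1 hr).1
    (Ideal.Quotient.eq_zero_iff_mem.1 h0))

theorem finite_triQuot (h : IsMonicTriangular T) : Module.Finite k (TriQuot T n) := by
  have := (finite_reducedExps T).to_subtype
  have : Module.Finite k (MvPolynomial.restrictSupport k (reducedExps T n Set.univ)) :=
    Module.Finite.of_basis (MvPolynomial.basisRestrictSupport k _)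
  exact Module.Finite.of_surjective _ (reducedToQuot_surjective h)

/-- The reduced monomials form a basis, and their exponents range over a box with sides the main
degrees. This count is what proves comaximality after a splitting. -/
theorem finrank_triQuot [Nontrivial k] (h : IsMonicTriangular T) :
    Module.finrank k (TriQuot T n) = ∏ l, (T l).degreeOf l := by
  classical
  have hfin := finite_reducedExps T
  have := hfin.to_subtype
  rw [← (LinearEquiv.ofBijective _
    ⟨reducedToQuot_injective h, reducedToQuot_surjective h⟩).finrank_eq,
    Module.finrank_eq_nat_card_basis (MvPolynomial.basisRestrictSupport k _)]
  have e : reducedExps T n Set.univ ≃ ((l : Fin n) → Fin ((T l).degreeOf l)) :=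
    { toFun := fun e l => ⟨e.1 l, e.2.1 l l.isLt⟩
      invFun := fun f => ⟨Finsupp.equivFunOnFinite.symm fun l => (f l).val,
        fun l _ => (f l).isLt, fun l hl => absurd trivial hl⟩
      left_inv := fun e => Subtype.ext (by ext l; simp)
      right_inv := fun f => by ext l; simp }
  rw [Nat.card_congr e, Nat.card_pi]
  simp

end Finite

/-! ### Residue class rings over the localization -/

section LocalInt

variable {n p : ℕ} [Fact p.Prime] {T : Fin n → MvPolynomial (Fin n) (localInt p)}
  {Tp : Fin n → MvPolynomial (Fin n) (ZMod p)} {i : ℕ}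

theorem map_localIntMod_eq_zero {f : MvPolynomial (Fin n) (localInt p)}
    (hf : MvPolynomial.map (localIntMod p) f = 0) :
    ∃ g, f = MvPolynomial.C (p : localInt p) * g := by
  have h : ∀ e, ∃ v, f.coeff e = (p : localInt p) * v := fun e => by
    apply (localIntMod_eq_zero p).1
    rw [← MvPolynomial.coeff_map, hf, MvPolynomial.coeff_zero]
  choose v hv using h
  refine ⟨∑ e ∈ f.support, MvPolynomial.monomial e (v e), ?_⟩
  conv_lhs => rw [f.as_sum]
  rw [Finset.mul_sum]
  refine Finset.sum_congr rfl fun e _ => ?_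
  rw [MvPolynomial.C_mul_monomial, hv]

/-- Reduction takes normal forms to normal forms, so the normal form of a class in the kernel has
all its coefficients divisible by `p`. -/
theorem triQuotMap_localIntMod_eq_zero (h : IsMonicTriangular T)
    (hT : ∀ j, MvPolynomial.map (localIntMod p) (T j) = Tp j) {u : TriQuot T i}
    (hu : triQuotMap (localIntMod p) hT i u = 0) : ∃ v, u = (p : TriQuot T i) * v := by
  have h1 := normalForm_triQuotMap h hT u
  rw [hu, normalForm_zero (h.map hT)] at h1
  obtain ⟨g, hg⟩ := map_localIntMod_eq_zero h1.symm
  refine ⟨Ideal.Quotient.mk _ g, ?_⟩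
  rw [← mk_normalForm h u, hg, map_mul]
  congr 1

theorem natCast_mem_jacobson_triQuot (h : IsMonicTriangular T) :
    (p : TriQuot T n) ∈ (⊥ : Ideal (TriQuot T n)).jacobson := by
  have := finite_triQuot h
  have h1 := algebraMap_mem_jacobson_bot (O := TriQuot T n) (natCast_mem_maximalIdeal p)
  rwa [map_natCast] at h1

theorem exists_monic_mem_span_pair_triQuot (h : IsMonicTriangular T)
    (hT : ∀ j, MvPolynomial.map (localIntMod p) (T j) = Tp j) {a b : (TriQuot T n)[X]}
    (hab : IsUnit (triQuotMap (localIntMod p) hT n a.leadingCoeff) ∨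
      IsUnit (triQuotMap (localIntMod p) hT n b.leadingCoeff)) {g s t : (TriQuot Tp n)[X]}
    (hg : g.Monic) (hgst : g = s * a.map (triQuotMap (localIntMod p) hT n) +
      t * b.map (triQuotMap (localIntMod p) hT n)) :
    ∃ G : (TriQuot T n)[X], G.Monic ∧ G.natDegree = g.natDegree ∧ G ∈ Ideal.span {a, b} :=
  Polynomial.exists_monic_mem_span_pair
    (triQuotMap_surjective (localIntMod_surjective p) hT) (natCast_mem_jacobson_triQuot h)
    (fun _ hu => triQuotMap_localIntMod_eq_zero h hT hu) hab hg hgst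

end LocalInt

end

/-! ### Reduction modulo large primes -/

noncomputable section

/-- The filter of large primes. -/
def largePrimes : Filter ℕ := Filter.atTop ⊓ Filter.principal {p | p.Prime}

theorem eventually_largePrimes {P : ℕ → Prop} :
    (∀ᶠ p in largePrimes, P p) ↔ ∀ᶠ p in Filter.atTop, p.Prime → P p := by
  rw [largePrimes, Filter.eventually_inf_principal]
  rfl

theorem eventually_prime : ∀ᶠ p in largePrimes, p.Prime :=
  eventually_largePrimes.2 (Filter.Eventually.of_forall fun _ h => h)

theorem eventually_gt_largePrimes (N : ℕ) : ∀ᶠ p in largePrimes, N < p :=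
  eventually_largePrimes.2 ((Filter.eventually_gt_atTop N).mono fun _ h _ => h)

instance : largePrimes.NeBot := by
  rw [← Filter.frequently_true_iff_neBot, Filter.Frequently, eventually_largePrimes]
  intro h
  obtain ⟨N, hN⟩ := Filter.eventually_atTop.1 h
  obtain ⟨p, hp, hpp⟩ := Nat.exists_infinite_primes N
  exact hN p hp hpp trivial

theorem eventually_mem_localInt (q : ℚ) : ∀ᶠ p in largePrimes, ¬ p ∣ q.den := by
  filter_upwards [eventually_gt_largePrimes q.den] with p hp h
  exact absurd (Nat.le_of_dvd q.den_pos h) (by omega)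

theorem eventually_ratMod_ne_zero {q : ℚ} (hq : q ≠ 0) :
    ∀ᶠ p in largePrimes, ratMod p q ≠ 0 := by
  filter_upwards [eventually_mem_localInt q, eventually_gt_largePrimes q.num.natAbs,
    eventually_prime] with p h1 h2 hp h
  have : Fact p.Prime := ⟨hp⟩
  rw [ratMod] at h
  rcases mul_eq_zero.1 h with h | h
  · rw [ZMod.intCast_zmod_eq_zero_iff_dvd, Int.natCast_dvd] at h
    have := Nat.le_of_dvd (Int.natAbs_pos.2 (Rat.num_ne_zero.2 hq)) h
    omega
  · exact absurd h (inv_ne_zero (den_cast_ne_zero p h1))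

variable {n : ℕ}

theorem ratMod_zero (p : ℕ) : ratMod p 0 = 0 := by simp [ratMod]

/-- No denominator of `f` is divisible by `p`. -/
def IsIntegralAt (p : ℕ) (f : MvPolynomial (Fin n) ℚ) : Prop :=
  ∀ e, ¬ p ∣ (f.coeff e).den

theorem eventually_isIntegralAt (f : MvPolynomial (Fin n) ℚ) :
    ∀ᶠ p in largePrimes, IsIntegralAt p f := by
  have h1 : ∀ᶠ p in largePrimes, ∀ e ∈ f.support, ¬ p ∣ (f.coeff e).den :=
    (Filter.eventually_all_finset _).2 fun e _ => eventually_mem_localInt _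
  filter_upwards [h1, eventually_prime] with p hp hpp e
  by_cases he : e ∈ f.support
  · exact hp e he
  · rw [MvPolynomial.notMem_support_iff.1 he]
    exact fun h => hpp.one_lt.ne' (Nat.dvd_one.1 h)

open Classical in
/-- The polynomial `f`, with coefficients in `localInt p`. -/
def toLocalInt (p : ℕ) [Fact p.Prime] (f : MvPolynomial (Fin n) ℚ) :
    MvPolynomial (Fin n) (localInt p) :=
  mapCoeffs (fun q => if h : q ∈ localInt p then ⟨q, h⟩ else 0) f

section
variable {p : ℕ} [Fact p.Prime]

theorem map_toLocalInt {f : MvPolynomial (Fin n) ℚ} (hf : IsIntegralAt p f) :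
    MvPolynomial.map (localInt p).subtype (toLocalInt p f) = f := by
  ext e
  rw [MvPolynomial.coeff_map, toLocalInt, coeff_mapCoeffs (by simp),
    dif_pos (show f.coeff e ∈ localInt p from hf e)]
  rfl

theorem mapCoeffs_ratMod (f : MvPolynomial (Fin n) (localInt p)) :
    mapCoeffs (ratMod p) (MvPolynomial.map (localInt p).subtype f) =
      MvPolynomial.map (localIntMod p) f :=
  mapCoeffs_eq_map _ _ (fun _ => rfl) f

theorem mapCoeffsPoly_ratMod (f : (MvPolynomial (Fin n) (localInt p))[X]) :
    mapCoeffsPoly (ratMod p) (f.map (MvPolynomial.map (localInt p).subtype)) =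
      f.map (MvPolynomial.map (localIntMod p)) :=
  mapCoeffsPoly_eq_map _ _ (fun _ => rfl) f

theorem map_localIntMod_toLocalInt {f : MvPolynomial (Fin n) ℚ} (hf : IsIntegralAt p f) :
    MvPolynomial.map (localIntMod p) (toLocalInt p f) = mapCoeffs (ratMod p) f := by
  rw [← mapCoeffs_ratMod, map_toLocalInt hf]

/-- No denominator of `T` is divisible by `p`. -/
def IsTriIntegralAt (p : ℕ) (T : Fin n → MvPolynomial (Fin n) ℚ) : Prop :=
  ∀ j, IsIntegralAt p (T j)

/-- The triangular set `T` over `localInt p`. -/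
def localTri (p : ℕ) [Fact p.Prime] (T : Fin n → MvPolynomial (Fin n) ℚ) :
    Fin n → MvPolynomial (Fin n) (localInt p) :=
  fun j => toLocalInt p (T j)

theorem map_subtype_localTri {T : Fin n → MvPolynomial (Fin n) ℚ} (h : IsTriIntegralAt p T) :
    ∀ j, MvPolynomial.map (localInt p).subtype (localTri p T j) = T j :=
  fun j => map_toLocalInt (h j)

theorem map_localIntMod_localTri {T : Fin n → MvPolynomial (Fin n) ℚ} (h : IsTriIntegralAt p T) :
    ∀ j, MvPolynomial.map (localIntMod p) (localTri p T j) = triMod p T j :=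
  fun j => map_localIntMod_toLocalInt (h j)

end

section Red

variable {p : ℕ} [Fact p.Prime] {T : Fin n → MvPolynomial (Fin n) ℚ} {i : ℕ}

/-- The inclusion of `p`-integral residue classes. -/
def inclTri (h : IsTriIntegralAt p T) (i : ℕ) : TriQuot (localTri p T) i →+* TriQuot T i :=
  triQuotMap (localInt p).subtype (map_subtype_localTri h) i

/-- Reduction modulo `p` of `p`-integral residue classes. -/
def redTri (h : IsTriIntegralAt p T) (i : ℕ) :
    TriQuot (localTri p T) i →+* TriQuot (triMod p T) i :=
  triQuotMap (localIntMod p) (map_localIntMod_localTri h) i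

theorem IsMonicTriangular.localTri (hT : IsMonicTriangular T) (h : IsTriIntegralAt p T) :
    IsMonicTriangular (localTri p T) :=
  hT.of_map Subtype.coe_injective (map_subtype_localTri h)

theorem IsMonicTriangular.triMod (hT : IsMonicTriangular T) (h : IsTriIntegralAt p T) :
    IsMonicTriangular (triMod p T) :=
  (hT.localTri h).map (map_localIntMod_localTri h)

theorem degreeOf_triMod (hT : IsMonicTriangular T) (h : IsTriIntegralAt p T) (j : Fin n) :
    (triMod p T j).degreeOf j = (T j).degreeOf j := by
  rw [degreeOf_map_self (hT.localTri h) (map_localIntMod_localTri h),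
    ← degreeOf_map_self (hT.localTri h) (map_subtype_localTri h)]

theorem inclTri_injective (hT : IsMonicTriangular T) (h : IsTriIntegralAt p T) (i : ℕ) :
    Function.Injective (inclTri h i) :=
  triQuotMap_injective Subtype.coe_injective (hT.localTri h) _

end Red

/-- Reduction modulo `p` of the normal form. -/
def redElt (p : ℕ) (T : Fin n → MvPolynomial (Fin n) ℚ) (i : ℕ) (u : TriQuot T i) :
    TriQuot (triMod p T) i :=
  Ideal.Quotient.mk _ (mapCoeffs (ratMod p) (normalForm T i u))

/-- Reduction modulo `p` of the normal forms of the coefficients. -/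
def redPoly (p : ℕ) (T : Fin n → MvPolynomial (Fin n) ℚ) (i : ℕ) (f : (TriQuot T i)[X]) :
    (TriQuot (triMod p T) i)[X] :=
  projPoly (triMod p T) i (mapCoeffsPoly (ratMod p) (repPoly T i f))

section Eventually

variable {T : Fin n → MvPolynomial (Fin n) ℚ} {i : ℕ}

theorem coeff_redPoly (hT : IsMonicTriangular T) (p : ℕ) (f : (TriQuot T i)[X]) (d : ℕ) :
    (redPoly p T i f).coeff d = redElt p T i (f.coeff d) := by
  rw [redPoly, coeff_projPoly, coeff_mapCoeffsPoly, coeff_repPoly hT, redElt]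

/-- `redElt` makes sense for every `p` but respects the ring operations only on `p`-integral
classes, where it is the homomorphism `redTri`. Identities between given elements therefore hold for
all primes that are large enough for these elements. -/
theorem redElt_inclTri {p : ℕ} [Fact p.Prime] (hT : IsMonicTriangular T) (h : IsTriIntegralAt p T)
    (u : TriQuot (localTri p T) i) : redElt p T i (inclTri h i u) = redTri h i u := by
  rw [redElt, inclTri, normalForm_triQuotMap (hT.localTri h), mapCoeffs_ratMod, redTri,
    ← triQuotMap_mk (map_localIntMod_localTri h), mk_normalForm (hT.localTri h)]

theorem redPoly_map_inclTri {p : ℕ} [Fact p.Prime] (hT : IsMonicTriangular T)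
    (h : IsTriIntegralAt p T) (f : (TriQuot (localTri p T) i)[X]) :
    redPoly p T i (f.map (inclTri h i)) = f.map (redTri h i) := by
  ext1 d
  rw [coeff_redPoly hT, coeff_map, redElt_inclTri hT, coeff_map]

theorem eventually_isTriIntegralAt (T : Fin n → MvPolynomial (Fin n) ℚ) :
    ∀ᶠ p in largePrimes, ∃ _ : Fact p.Prime, IsTriIntegralAt p T := by
  have : ∀ᶠ p in largePrimes, ∀ j, IsIntegralAt p (T j) :=
    Filter.eventually_all.2 fun j => eventually_isIntegralAt _
  filter_upwards [this, eventually_prime] with p h1 h2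
  exact ⟨⟨h2⟩, h1⟩

theorem exists_inclTri_eq {p : ℕ} [Fact p.Prime] (hT : IsMonicTriangular T)
    (h : IsTriIntegralAt p T) {u : TriQuot T i} (hu : IsIntegralAt p (normalForm T i u)) :
    ∃ u₀, inclTri h i u₀ = u :=
  ⟨Ideal.Quotient.mk _ (toLocalInt p (normalForm T i u)), by
    rw [inclTri, triQuotMap_mk, map_toLocalInt hu, mk_normalForm hT]⟩

theorem eventually_exists_inclTri (hT : IsMonicTriangular T) (u : TriQuot T i) :
    ∀ᶠ p in largePrimes, ∃ (_ : Fact p.Prime) (h : IsTriIntegralAt p T),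
      ∃ u₀, inclTri h i u₀ = u := by
  filter_upwards [eventually_isTriIntegralAt T, eventually_isIntegralAt (normalForm T i u)]
    with p ⟨hp, h⟩ h2
  exact ⟨hp, h, exists_inclTri_eq hT h h2⟩

theorem exists_map_inclTri_eq {p : ℕ} [Fact p.Prime]
    (h : IsTriIntegralAt p T) {f : (TriQuot T i)[X]}
    (hf : ∀ d, ∃ u₀, inclTri h i u₀ = f.coeff d) : 
    ∃ f₀ : (TriQuot (localTri p T) i)[X], f₀.map (inclTri h i) = f :=
  (mem_lifts f).1 ((lifts_iff_coeff_lifts f).2 hf)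

theorem eventually_exists_map_inclTri (hT : IsMonicTriangular T) (f : (TriQuot T i)[X]) :
    ∀ᶠ p in largePrimes, ∃ (_ : Fact p.Prime) (h : IsTriIntegralAt p T),
      ∃ f₀ : (TriQuot (localTri p T) i)[X], f₀.map (inclTri h i) = f := by
  have h1 : ∀ᶠ p in largePrimes, ∀ d ∈ f.support, ∃ (_ : Fact p.Prime) (h : IsTriIntegralAt p T),
      ∃ u₀, inclTri h i u₀ = f.coeff d :=
    (Filter.eventually_all_finset _).2 fun d _ => eventually_exists_inclTri hT _
  filter_upwards [eventually_isTriIntegralAt T, h1] with p ⟨hp, h⟩ h2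
  refine ⟨hp, h, exists_map_inclTri_eq h fun d => ?_⟩
  by_cases hd : d ∈ f.support
  · obtain ⟨_, _, h3⟩ := h2 d hd
    exact h3
  · exact ⟨0, by rw [map_zero, notMem_support_iff.1 hd]⟩

theorem eventually_redPoly_zero (hT : IsMonicTriangular T) (i : ℕ) :
    ∀ᶠ p in largePrimes, redPoly p T i 0 = 0 := by
  filter_upwards [eventually_isTriIntegralAt T] with p ⟨hp, h⟩
  simpa using redPoly_map_inclTri hT h (i := i) 0

theorem eventually_redPoly_one (hT : IsMonicTriangular T) (i : ℕ) :
    ∀ᶠ p in largePrimes, redPoly p T i 1 = 1 := by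
  filter_upwards [eventually_isTriIntegralAt T] with p ⟨hp, h⟩
  simpa using redPoly_map_inclTri hT h (i := i) 1

theorem eventually_redPoly_mul (hT : IsMonicTriangular T) (f g : (TriQuot T i)[X]) :
    ∀ᶠ p in largePrimes, redPoly p T i (f * g) = redPoly p T i f * redPoly p T i g := by
  filter_upwards [eventually_exists_map_inclTri hT f, eventually_exists_map_inclTri hT g]
    with p ⟨hp, h, f₀, hf⟩ ⟨_, _, g₀, hg⟩
  rw [← hf, ← hg, ← Polynomial.map_mul, redPoly_map_inclTri hT, redPoly_map_inclTri hT,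
    redPoly_map_inclTri hT, Polynomial.map_mul]

theorem eventually_redPoly_add (hT : IsMonicTriangular T) (f g : (TriQuot T i)[X]) :
    ∀ᶠ p in largePrimes, redPoly p T i (f + g) = redPoly p T i f + redPoly p T i g := by
  filter_upwards [eventually_exists_map_inclTri hT f, eventually_exists_map_inclTri hT g]
    with p ⟨hp, h, f₀, hf⟩ ⟨_, _, g₀, hg⟩
  rw [← hf, ← hg, ← Polynomial.map_add, redPoly_map_inclTri hT, redPoly_map_inclTri hT,
    redPoly_map_inclTri hT, Polynomial.map_add]

theorem eventually_redPoly_sub (hT : IsMonicTriangular T) (f g : (TriQuot T i)[X]) :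
    ∀ᶠ p in largePrimes, redPoly p T i (f - g) = redPoly p T i f - redPoly p T i g := by
  filter_upwards [eventually_exists_map_inclTri hT f, eventually_exists_map_inclTri hT g]
    with p ⟨hp, h, f₀, hf⟩ ⟨_, _, g₀, hg⟩
  rw [← hf, ← hg, ← Polynomial.map_sub, redPoly_map_inclTri hT, redPoly_map_inclTri hT,
    redPoly_map_inclTri hT, Polynomial.map_sub]

theorem eventually_redPoly_C (hT : IsMonicTriangular T) (u : TriQuot T i) :
    ∀ᶠ p in largePrimes, redPoly p T i (C u) = C (redElt p T i u) := by
  filter_upwards [eventually_exists_inclTri hT u] with p ⟨hp, h, u₀, hu⟩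
  rw [← hu, ← map_C, redPoly_map_inclTri hT, redElt_inclTri hT, map_C]

theorem eventually_redPoly_derivative (hT : IsMonicTriangular T) (f : (TriQuot T i)[X]) :
    ∀ᶠ p in largePrimes, redPoly p T i (derivative f) = derivative (redPoly p T i f) := by
  filter_upwards [eventually_exists_map_inclTri hT f] with p ⟨hp, h, f₀, hf⟩
  rw [← hf, derivative_map, redPoly_map_inclTri hT, redPoly_map_inclTri hT, derivative_map]

theorem exists_monic_map_inclTri {p : ℕ} [Fact p.Prime] (hT : IsMonicTriangular T)
    {h : IsTriIntegralAt p T} {g₀ : (TriQuot (localTri p T) i)[X]}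
    (hg : (g₀.map (inclTri h i)).Monic) : g₀.Monic :=
  monic_of_injective (inclTri_injective hT h i) hg

theorem eventually_redPoly_divByMonic (hT : IsMonicTriangular T) (f : (TriQuot T i)[X])
    {g : (TriQuot T i)[X]} (hm : g.Monic) :
    ∀ᶠ p in largePrimes, redPoly p T i (f /ₘ g) = redPoly p T i f /ₘ redPoly p T i g := by
  filter_upwards [eventually_exists_map_inclTri hT f, eventually_exists_map_inclTri hT g]
    with p ⟨hp, h, f₀, hf⟩ ⟨_, _, g₀, hg⟩
  have hm₀ : g₀.Monic := exists_monic_map_inclTri hT (hg ▸ hm)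
  rw [← hf, ← hg, ← map_divByMonic _ hm₀, redPoly_map_inclTri hT, redPoly_map_inclTri hT,
    redPoly_map_inclTri hT, map_divByMonic _ hm₀]

theorem eventually_redPoly_modByMonic (hT : IsMonicTriangular T) (f : (TriQuot T i)[X])
    {g : (TriQuot T i)[X]} (hm : g.Monic) :
    ∀ᶠ p in largePrimes, redPoly p T i (f %ₘ g) = redPoly p T i f %ₘ redPoly p T i g := by
  filter_upwards [eventually_exists_map_inclTri hT f, eventually_exists_map_inclTri hT g]
    with p ⟨hp, h, f₀, hf⟩ ⟨_, _, g₀, hg⟩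
  have hm₀ : g₀.Monic := exists_monic_map_inclTri hT (hg ▸ hm)
  rw [← hf, ← hg, ← map_modByMonic _ hm₀, redPoly_map_inclTri hT, redPoly_map_inclTri hT,
    redPoly_map_inclTri hT, map_modByMonic _ hm₀]

theorem eventually_mapCoeffs_ne_zero {f : MvPolynomial (Fin n) ℚ} (hf : f ≠ 0) :
    ∀ᶠ p in largePrimes, mapCoeffs (ratMod p) f ≠ 0 := by
  obtain ⟨e, he⟩ := MvPolynomial.exists_coeff_ne_zero hf
  filter_upwards [eventually_ratMod_ne_zero he] with p hp h0
  apply hp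
  rw [← coeff_mapCoeffs (ratMod_zero p), h0, MvPolynomial.coeff_zero]

/-- Main degrees do not change modulo `p`, so the reduction of a reduced polynomial is reduced and
represents zero only if it is zero. -/
theorem mk_mapCoeffs_eq_zero {p : ℕ} [Fact p.Prime] (hT : IsMonicTriangular T)
    (h : IsTriIntegralAt p T) {r : MvPolynomial (Fin n) ℚ} (hr : IsReducedWrt T i r)
    (h0 : Ideal.Quotient.mk (triIdeal (triMod p T) i) (mapCoeffs (ratMod p) r) = 0) :
    mapCoeffs (ratMod p) r = 0 :=
  eq_zero_of_isReducedWrt (hT.triMod h) i _ (fun l hl => by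
    rw [degreeOf_triMod hT h]
    exact lt_of_le_of_lt (degreeOf_mapCoeffs_le (ratMod_zero p) _ _) (hr l hl))
    (Ideal.Quotient.eq_zero_iff_mem.1 h0)

theorem eventually_redElt_ne_zero (hT : IsMonicTriangular T) {u : TriQuot T i} (hu : u ≠ 0) :
    ∀ᶠ p in largePrimes, redElt p T i u ≠ 0 := by
  have h1 : normalForm T i u ≠ 0 := fun h => hu (by rw [← mk_normalForm hT u, h, map_zero])
  filter_upwards [eventually_mapCoeffs_ne_zero h1, eventually_isTriIntegralAt T]
    with p hp ⟨_, h⟩ h0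
  exact hp (mk_mapCoeffs_eq_zero hT h (isReducedWrt_normalForm hT u) h0)

theorem eventually_redPoly_ne_zero (hT : IsMonicTriangular T) {f : (TriQuot T i)[X]}
    (hf : f ≠ 0) : ∀ᶠ p in largePrimes, redPoly p T i f ≠ 0 := by
  filter_upwards [eventually_redElt_ne_zero hT (leadingCoeff_ne_zero.2 hf)] with p hp h0
  apply hp
  rw [leadingCoeff, ← coeff_redPoly hT, h0, coeff_zero]

/-- A nonzero difference keeps a nonzero reduction at all large primes. Identities proved modulo
infinitely many primes are thereby brought back to `ℚ`. -/
theorem eq_of_frequently_redPoly_eq (hT : IsMonicTriangular T) {f g : (TriQuot T i)[X]}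
    (h : ∃ᶠ p in largePrimes, redPoly p T i f = redPoly p T i g) : f = g := by
  by_contra hne
  have h1 := eventually_redPoly_ne_zero hT (sub_ne_zero.2 hne)
  apply h
  filter_upwards [h1, eventually_redPoly_sub hT f g] with p h2 h3 h4
  rw [h3, h4, sub_self] at h2
  exact h2 rfl

theorem eventually_natDegree_redPoly (hT : IsMonicTriangular T) (f : (TriQuot T i)[X]) :
    ∀ᶠ p in largePrimes, (redPoly p T i f).natDegree = f.natDegree := by
  by_cases hf : f = 0
  · subst hf
    filter_upwards [eventually_redPoly_zero hT i] with p hp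
    rw [hp, natDegree_zero, natDegree_zero]
  filter_upwards [eventually_redElt_ne_zero hT (leadingCoeff_ne_zero.2 hf),
    eventually_exists_map_inclTri hT f] with p hp ⟨_, h, f₀, hf₀⟩
  apply le_antisymm
  · have := inclTri_injective hT h i
    rw [← hf₀, redPoly_map_inclTri hT, natDegree_map_eq_of_injective this]
    exact natDegree_map_le
  · apply le_natDegree_of_ne_zero
    rwa [coeff_redPoly hT]

theorem eventually_leadingCoeff_redPoly (hT : IsMonicTriangular T) (f : (TriQuot T i)[X]) :
    ∀ᶠ p in largePrimes, (redPoly p T i f).leadingCoeff = redElt p T i f.leadingCoeff := by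
  filter_upwards [eventually_natDegree_redPoly hT f] with p hp
  rw [leadingCoeff, hp, coeff_redPoly hT, leadingCoeff]

theorem redPoly_levelPoly {p : ℕ} [Fact p.Prime] (hT : IsMonicTriangular T)
    (h : IsTriIntegralAt p T) (j : Fin n) :
    redPoly p T j (levelPoly T j) = levelPoly (triMod p T) j := by
  rw [← map_levelPoly (map_subtype_localTri h),
    ← map_levelPoly (map_localIntMod_localTri h)]
  exact redPoly_map_inclTri hT h _

theorem eventually_redPoly_levelPoly (hT : IsMonicTriangular T) (j : Fin n) :
    ∀ᶠ p in largePrimes, redPoly p T j (levelPoly T j) = levelPoly (triMod p T) j := by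
  filter_upwards [eventually_isTriIntegralAt T] with p ⟨_, h⟩
  exact redPoly_levelPoly hT h j

theorem eventually_redElt_evalLevel (hT : IsMonicTriangular T) (j : Fin n)
    (f : (TriQuot T j.val)[X]) : ∀ᶠ p in largePrimes,
      redElt p T (j.val + 1) (evalLevel T j f) = evalLevel (triMod p T) j (redPoly p T j f) := by
  filter_upwards [eventually_exists_map_inclTri hT f] with p ⟨_, h, f₀, hf⟩
  have h1 : evalLevel T j (f₀.map (inclTri h j)) = inclTri h (j.val + 1) (evalLevel _ j f₀) :=
    (map_evalLevel (hT.localTri h) _ j f₀).symm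
  rw [← hf, redPoly_map_inclTri hT, h1, redElt_inclTri hT]
  exact map_evalLevel (hT.localTri h) _ j f₀

theorem eventually_redPoly_projPoly_viewAt (hT : IsMonicTriangular T) (j : Fin n)
    (u : TriQuot T (j.val + 1)) : ∀ᶠ p in largePrimes,
      redPoly p T j (projPoly T j.val (viewAt j (normalForm T (j.val + 1) u))) =
        projPoly (triMod p T) j.val
          (viewAt j (normalForm (triMod p T) (j.val + 1) (redElt p T (j.val + 1) u))) := by
  filter_upwards [eventually_exists_inclTri hT u] with p ⟨_, h, u₀, hu⟩
  rw [← hu, redElt_inclTri hT, redTri, inclTri, normalForm_triQuotMap (hT.localTri h),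
    normalForm_triQuotMap (hT.localTri h), viewAt_map, viewAt_map,
    ← map_projPoly (map_subtype_localTri h),
    ← map_projPoly (map_localIntMod_localTri h)]
  exact redPoly_map_inclTri hT h _

theorem redElt_mem_lowSubring (hT : IsMonicTriangular T) (p : ℕ) {u : TriQuot T i}
    (hu : u ∈ lowSubring T i) : redElt p T i u ∈ lowSubring (triMod p T) i := by
  refine mk_mem_lowSubring (mem_lowVars.2 fun j hj => ?_)
  have := degreeOf_mapCoeffs_le (ratMod_zero p) (normalForm T i u) j
  rw [mem_lowVars.1 (normalForm_mem_lowVars hT hu) j hj] at this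
  omega

theorem redPoly_mem_lowPolys (hT : IsMonicTriangular T) (p : ℕ) {f : (TriQuot T i)[X]}
    (hf : f ∈ lowPolys T i) : redPoly p T i f ∈ lowPolys (triMod p T) i :=
  mem_lowPolys.2 fun d => by
    rw [coeff_redPoly hT]
    exact redElt_mem_lowSubring hT p (mem_lowPolys.1 hf d)

end Eventually

end

/-! ### The Euclidean algorithm for all large primes at once -/

noncomputable section

variable {n : ℕ} {T : Fin n → MvPolynomial (Fin n) ℚ} {i : ℕ}

/-- The zero-divisor modulo `p` obtained from a factor of `t_j`. -/
def redZeroDivisor (p : ℕ) (T : Fin n → MvPolynomial (Fin n) ℚ) (j : Fin n)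
    (g : (TriQuot T j.val)[X]) : ZeroDivisor n p :=
  (j, repPoly (triMod p T) j (redPoly p T j g))

/-- For all large primes, the computations `f p` report the same zero-divisor of level `< i`. -/
def EventuallyReports {α : ℕ → Type} (T : Fin n → MvPolynomial (Fin n) ℚ) (i : ℕ)
    (f : ∀ p, Except (ZeroDivisor n p) (α p)) : Prop :=
  ∃ (j : Fin n) (g : (TriQuot T j.val)[X]), IsLevelFactor T j g ∧ j.val < i ∧
    ∀ᶠ p in largePrimes, f p = .error (redZeroDivisor p T j g)

/-- For all large primes, the Euclidean algorithm returns the reduction of the same row. -/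
def EventuallyReturns (T : Fin n → MvPolynomial (Fin n) ℚ) (i : ℕ)
    (f : ∀ p, Except (ZeroDivisor n p) ((TriQuot (triMod p T) i)[X] ×
      (TriQuot (triMod p T) i)[X] × (TriQuot (triMod p T) i)[X]))
    (g s t : (TriQuot T i)[X]) : Prop :=
  g ∈ lowPolys T i ∧ s ∈ lowPolys T i ∧ t ∈ lowPolys T i ∧
    ∀ᶠ p in largePrimes, f p = .ok (redPoly p T i g, redPoly p T i s, redPoly p T i t)

/-- The behaviour of inversion for large primes. -/
def EventualInvSpec (T : Fin n → MvPolynomial (Fin n) ℚ) (i : ℕ) : Prop :=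
  ∀ u ∈ lowSubring T i, u ≠ 0 →
    (∃ c ∈ lowSubring T i, u * c = 1 ∧ ∀ᶠ p in largePrimes,
      invLevel p (triMod p T) i (redElt p T i u) = .ok (redElt p T i c)) ∨
    EventuallyReports T i fun p => invLevel p (triMod p T) i (redElt p T i u)

/-- Whether a remainder vanishes and what its leading coefficient is are decided over `ℚ`, and a
large prime changes neither. A run has boundedly many steps, so finitely many conditions on `p`
suffice. -/
theorem euclidLoop_eventually (hT : IsMonicTriangular T) (hinv : EventualInvSpec T i) (m : ℕ) :
    ∀ r₀ s₀ t₀ r₁ s₁ t₁ : (TriQuot T i)[X], r₀ ∈ lowPolys T i → s₀ ∈ lowPolys T i →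
      t₀ ∈ lowPolys T i → r₁ ∈ lowPolys T i → s₁ ∈ lowPolys T i → t₁ ∈ lowPolys T i →
      (∃ g s t, EventuallyReturns T i (fun p => euclidLoop (invLevel p (triMod p T) i) m
        (redPoly p T i r₀, redPoly p T i s₀, redPoly p T i t₀)
        (redPoly p T i r₁, redPoly p T i s₁, redPoly p T i t₁)) g s t) ∨
      EventuallyReports T i fun p => euclidLoop (invLevel p (triMod p T) i) m
        (redPoly p T i r₀, redPoly p T i s₀, redPoly p T i t₀)
        (redPoly p T i r₁, redPoly p T i s₁, redPoly p T i t₁) := by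
  induction m with
  | zero =>
    intro r₀ s₀ t₀ r₁ s₁ t₁ hr₀ hs₀ ht₀ _ _ _
    exact Or.inl ⟨r₀, s₀, t₀, hr₀, hs₀, ht₀, Filter.Eventually.of_forall fun p => rfl⟩
  | succ m IH =>
    intro r₀ s₀ t₀ r₁ s₁ t₁ hr₀ hs₀ ht₀ hr₁ hs₁ ht₁
    by_cases hr : r₁ = 0
    · refine Or.inl ⟨r₀, s₀, t₀, hr₀, hs₀, ht₀, ?_⟩
      filter_upwards [eventually_redPoly_zero hT i] with p hp
      rw [hr, hp, euclidLoop, if_pos rfl]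
    · rcases hinv r₁.leadingCoeff (mem_lowPolys.1 hr₁ _) (leadingCoeff_ne_zero.2 hr) with
        ⟨c, hc, huc, hev⟩ | ⟨j, g, hg, hj, hev⟩
      · set r := C c * r₁ with hr_def
        have hm : r.Monic := monic_C_mul_of_mul_leadingCoeff_eq_one (by rw [mul_comm]; exact huc)
        have hC : C c ∈ lowPolys T i := C_mem_liftsRing _ hc
        have hrL : r ∈ lowPolys T i := Subring.mul_mem _ hC hr₁
        have hsL : C c * s₁ ∈ lowPolys T i := Subring.mul_mem _ hC hs₁
        have htL : C c * t₁ ∈ lowPolys T i := Subring.mul_mem _ hC ht₁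
        have hq : r₀ /ₘ r ∈ lowPolys T i := divByMonic_mem_liftsRing _ hr₀ hrL hm
        have key : ∀ᶠ p in largePrimes, euclidLoop (invLevel p (triMod p T) i) (m + 1)
            (redPoly p T i r₀, redPoly p T i s₀, redPoly p T i t₀)
            (redPoly p T i r₁, redPoly p T i s₁, redPoly p T i t₁) =
            euclidLoop (invLevel p (triMod p T) i) m
            (redPoly p T i r, redPoly p T i (C c * s₁), redPoly p T i (C c * t₁))
            (redPoly p T i (r₀ %ₘ r), redPoly p T i (s₀ - r₀ /ₘ r * (C c * s₁)),
              redPoly p T i (t₀ - r₀ /ₘ r * (C c * t₁))) := by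
          filter_upwards [hev, eventually_redPoly_ne_zero hT hr,
            eventually_leadingCoeff_redPoly hT r₁, eventually_redPoly_C hT c,
            eventually_redPoly_mul hT (C c) r₁, eventually_redPoly_mul hT (C c) s₁,
            eventually_redPoly_mul hT (C c) t₁, eventually_redPoly_divByMonic hT r₀ hm,
            eventually_redPoly_modByMonic hT r₀ hm,
            (eventually_redPoly_sub hT s₀ (r₀ /ₘ r * (C c * s₁))).and
              ((eventually_redPoly_sub hT t₀ (r₀ /ₘ r * (C c * t₁))).and
              ((eventually_redPoly_mul hT (r₀ /ₘ r) (C c * s₁)).and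
              (eventually_redPoly_mul hT (r₀ /ₘ r) (C c * t₁))))]
            with p h1 h2 h3 h4 h5 h6 h7 h8 h9 ⟨h10, h11, h12, h13⟩
          rw [euclidLoop, if_neg h2, h3, h1]
          simp only
          rw [h10, h11, h12, h13, h8, h9, h6, h7, hr_def, h5, h4]
        rcases IH r (C c * s₁) (C c * t₁) (r₀ %ₘ r) (s₀ - r₀ /ₘ r * (C c * s₁))
          (t₀ - r₀ /ₘ r * (C c * t₁)) hrL hsL htL (modByMonic_mem_liftsRing _ hr₀ hrL hm)
          (Subring.sub_mem _ hs₀ (Subring.mul_mem _ hq hsL))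
          (Subring.sub_mem _ ht₀ (Subring.mul_mem _ hq htL)) with
          ⟨g, s, t, hg, hs, ht, h⟩ | ⟨j, g, hg, hj, h⟩
        · exact Or.inl ⟨g, s, t, hg, hs, ht, by
            filter_upwards [key, h] with p h1 h2
            rw [h1, h2]⟩
        · exact Or.inr ⟨j, g, hg, hj, by
            filter_upwards [key, h] with p h1 h2
            rw [h1, h2]⟩
      · refine Or.inr ⟨j, g, hg, hj, ?_⟩
        filter_upwards [hev, eventually_redPoly_ne_zero hT hr,
          eventually_leadingCoeff_redPoly hT r₁] with p h1 h2 h3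
        rw [euclidLoop, if_neg h2, h3, h1]

/-- The specification modulo large primes gives a specification over the rational numbers. -/
theorem isBezoutGCD_of_eventually (hT : IsMonicTriangular T) {a b g s t : (TriQuot T i)[X]}
    (hg : g ∈ lowPolys T i) (hs : s ∈ lowPolys T i) (ht : t ∈ lowPolys T i)
    (h : ∀ᶠ p in largePrimes, IsBezoutGCD (lowSubring (triMod p T) i) (redPoly p T i a)
      (redPoly p T i b) (redPoly p T i g) (redPoly p T i s) (redPoly p T i t)) :
    IsBezoutGCD (lowSubring T i) a b g s t := by
  have hbez : g = s * a + t * b := by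
    apply eq_of_frequently_redPoly_eq hT
    apply Filter.Eventually.frequently
    filter_upwards [h, eventually_redPoly_add hT (s * a) (t * b), eventually_redPoly_mul hT s a,
      eventually_redPoly_mul hT t b] with p h1 h2 h3 h4
    rw [h2, h3, h4]
    exact h1.bezout
  by_cases h0 : a = 0 ∧ b = 0
  · have hg0 : g = 0 := by rw [hbez, h0.1, h0.2]; ring
    exact ⟨hg, hs, ht, hbez, by rw [h0.1]; exact dvd_zero _, by rw [h0.2]; exact dvd_zero _,
      Or.inr ⟨h0.1, h0.2, hg0⟩⟩
  have hev : ∀ᶠ p in largePrimes, (redPoly p T i g).Monic := by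
    rcases not_and_or.1 h0 with h0 | h0
    · filter_upwards [h, eventually_redPoly_ne_zero hT h0] with p h1 h2
      exact h1.monic.resolve_right fun h' => h2 h'.1
    · filter_upwards [h, eventually_redPoly_ne_zero hT h0] with p h1 h2
      exact h1.monic.resolve_right fun h' => h2 h'.2.1
  -- Being monic is the equation of the leading coefficient with `1`, and equations transfer from
  -- infinitely many primes.
  have hm : g.Monic := by
    have h1 : C g.leadingCoeff = 1 := by
      apply eq_of_frequently_redPoly_eq hT
      apply Filter.Eventually.frequently
      filter_upwards [hev, eventually_redPoly_C hT g.leadingCoeff,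
        eventually_leadingCoeff_redPoly hT g, eventually_redPoly_one hT i] with p h1 h2 h3 h4
      rw [h2, ← h3, h1, C_1, h4]
    rw [← C_1] at h1
    exact C_injective h1
  -- Divisibility by a monic polynomial is the vanishing of a remainder, so it transfers as an
  -- equation too.
  have hdvd : ∀ c : (TriQuot T i)[X], (∀ᶠ p in largePrimes, redPoly p T i g ∣ redPoly p T i c) →
      g ∣ c := by
    intro c hc
    rw [← modByMonic_eq_zero_iff_dvd hm]
    apply eq_of_frequently_redPoly_eq hT
    apply Filter.Eventually.frequently
    filter_upwards [hc, eventually_redPoly_modByMonic hT c hm, eventually_redPoly_zero hT i, hev]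
      with p h1 h2 h3 h4
    rw [h2, h3, modByMonic_eq_zero_iff_dvd h4]
    exact h1
  exact ⟨hg, hs, ht, hbez, hdvd a (h.mono fun p hp => hp.dvd_left),
    hdvd b (h.mono fun p hp => hp.dvd_right), Or.inl hm⟩

/-- The algorithm is not specified a second time over `ℚ`: the rational row is the common lift of
the modular ones, and inherits its properties from `monicEuclid_spec` modulo large primes. -/
theorem monicEuclid_eventually (hT : IsMonicTriangular T) (hi : i ≤ n)
    (hinv : EventualInvSpec T i) {a b : (TriQuot T i)[X]} (ha : a ∈ lowPolys T i)
    (hb : b ∈ lowPolys T i) :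
    (∃ g s t, EventuallyReturns T i (fun p => monicEuclid (invLevel p (triMod p T) i)
        (redPoly p T i a) (redPoly p T i b)) g s t ∧ IsBezoutGCD (lowSubring T i) a b g s t) ∨
      EventuallyReports T i fun p => monicEuclid (invLevel p (triMod p T) i)
        (redPoly p T i a) (redPoly p T i b) := by
  have main : (∃ g s t, EventuallyReturns T i (fun p => monicEuclid (invLevel p (triMod p T) i)
        (redPoly p T i a) (redPoly p T i b)) g s t) ∨
      EventuallyReports T i fun p => monicEuclid (invLevel p (triMod p T) i)
        (redPoly p T i a) (redPoly p T i b) := by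
    by_cases hb0 : b = 0
    · by_cases ha0 : a = 0
      · refine Or.inl ⟨0, 0, 0, zero_mem _, zero_mem _, zero_mem _, ?_⟩
        filter_upwards [eventually_redPoly_zero hT i] with p hp
        rw [ha0, hb0, hp, monicEuclid, if_pos rfl, if_pos rfl]
      · rcases hinv a.leadingCoeff (mem_lowPolys.1 ha _) (leadingCoeff_ne_zero.2 ha0) with
          ⟨c, hc, huc, hev⟩ | ⟨j, g, hg, hj, hev⟩
        · have hC : C c ∈ lowPolys T i := C_mem_liftsRing _ hc
          refine Or.inl ⟨C c * a, C c, 0, Subring.mul_mem _ hC ha, hC, zero_mem _, ?_⟩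
          filter_upwards [hev, eventually_redPoly_zero hT i, eventually_redPoly_ne_zero hT ha0,
            eventually_leadingCoeff_redPoly hT a, eventually_redPoly_C hT c,
            eventually_redPoly_mul hT (C c) a] with p h1 h2 h3 h4 h5 h6
          rw [hb0, h2, monicEuclid, if_pos rfl, if_neg h3, h4, h1, h6, h5]
        · refine Or.inr ⟨j, g, hg, hj, ?_⟩
          filter_upwards [hev, eventually_redPoly_zero hT i, eventually_redPoly_ne_zero hT ha0,
            eventually_leadingCoeff_redPoly hT a] with p h1 h2 h3 h4
          rw [hb0, h2, monicEuclid, if_pos rfl, if_neg h3, h4, h1]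
    · have key : ∀ᶠ p in largePrimes, monicEuclid (invLevel p (triMod p T) i)
          (redPoly p T i a) (redPoly p T i b) =
          euclidLoop (invLevel p (triMod p T) i) (b.natDegree + 1)
            (redPoly p T i a, redPoly p T i 1, redPoly p T i 0)
            (redPoly p T i b, redPoly p T i 0, redPoly p T i 1) := by
        filter_upwards [eventually_redPoly_zero hT i, eventually_redPoly_one hT i,
          eventually_redPoly_ne_zero hT hb0, eventually_natDegree_redPoly hT b] with p h1 h2 h3 h4
        rw [monicEuclid, if_neg h3, h1, h2, h4]
      rcases euclidLoop_eventually hT hinv (b.natDegree + 1) a 1 0 b 0 1 ha (one_mem _)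
        (zero_mem _) hb (zero_mem _) (one_mem _) with ⟨g, s, t, hg, hs, ht, h⟩ | ⟨j, g, hg, hj, h⟩
      · exact Or.inl ⟨g, s, t, hg, hs, ht, by
          filter_upwards [key, h] with p h1 h2
          rw [h1, h2]⟩
      · exact Or.inr ⟨j, g, hg, hj, by
          filter_upwards [key, h] with p h1 h2
          rw [h1, h2]⟩
  refine main.imp_left ?_
  rintro ⟨g, s, t, h⟩
  refine ⟨g, s, t, h, isBezoutGCD_of_eventually hT h.1 h.2.1 h.2.2.1 ?_⟩
  filter_upwards [h.2.2.2, eventually_isTriIntegralAt T] with p hp ⟨_, hint⟩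
  exact (monicEuclid_spec (invLevel_spec (hT.triMod hint) i hi) (redPoly_mem_lowPolys hT p ha)
    (redPoly_mem_lowPolys hT p hb)).1 _ _ _ hp

theorem EventuallyReports.mono {α β : ℕ → Type} {i j : ℕ} (hij : i ≤ j)
    {f : ∀ p, Except (ZeroDivisor n p) (α p)} {f' : ∀ p, Except (ZeroDivisor n p) (β p)}
    (h : EventuallyReports T i f)
    (hf : ∀ᶠ p in largePrimes, ∀ w, f p = .error w → f' p = .error w) :
    EventuallyReports T j f' := by
  obtain ⟨l, g, hg, hl, h⟩ := h
  refine ⟨l, g, hg, hl.trans_le hij, ?_⟩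
  filter_upwards [h, hf] with p h1 h2
  exact h2 _ h1

/-- The dichotomy of `invLevel_spec`, decided once over `ℚ`: the branch taken at a large prime
depends only on whether the rational gcd is `1`. -/
theorem invLevel_eventually (hT : IsMonicTriangular T) (i : ℕ) (hi : i ≤ n) :
    EventualInvSpec T i := by
  induction i with
  | zero =>
    intro u hu hu0
    refine Or.inl ?_
    have hl := normalForm_mem_lowVars hT hu
    have hC : normalForm T 0 u = MvPolynomial.C ((normalForm T 0 u).coeff 0) := by
      rw [lowVars, show {l : Fin n | l.val < 0} = ∅ by ext; simp, MvPolynomial.supported_empty,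
        Algebra.mem_bot] at hl
      obtain ⟨c, hc⟩ := hl
      rw [← hc]
      simp
    set q := (normalForm T 0 u).coeff 0
    have hne : q ≠ 0 := by
      intro h0
      rw [h0, MvPolynomial.C_0] at hC
      apply hu0
      rw [← mk_normalForm hT u, hC, map_zero]
    have hred : ∀ (p : ℕ) (r : ℚ), redElt p T 0 (Ideal.Quotient.mk _ (MvPolynomial.C r)) =
        Ideal.Quotient.mk _ (MvPolynomial.C (ratMod p r)) := by
      intro p r
      rw [redElt, normalForm_mk hT (fun l hl => absurd hl (Nat.not_lt_zero _))]
      congr 1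
      classical
      ext e
      rw [coeff_mapCoeffs (ratMod_zero p), MvPolynomial.coeff_C, MvPolynomial.coeff_C]
      split_ifs
      · rfl
      · exact ratMod_zero p
    have hu' : u = Ideal.Quotient.mk _ (MvPolynomial.C q) := by rw [← hC, mk_normalForm hT]
    refine ⟨Ideal.Quotient.mk _ (MvPolynomial.C q⁻¹),
      mk_mem_lowSubring (Subalgebra.algebraMap_mem _ _), ?_, ?_⟩
    · rw [hu', ← map_mul, ← MvPolynomial.C_mul, mul_inv_cancel₀ hne, MvPolynomial.C_1, map_one]
    · filter_upwards [eventually_isTriIntegralAt T, eventually_mem_localInt q,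
        eventually_mem_localInt q⁻¹] with p ⟨hp, h⟩ hq hq'
      rw [invLevel, hu', hred, hred,
        normalForm_mk (hT.triMod h) (fun l hl => absurd hl (Nat.not_lt_zero _)),
        MvPolynomial.coeff_C, if_pos rfl]
      have h1 := map_mul (localIntMod p) ⟨q, hq⟩ ⟨q⁻¹, hq'⟩
      rw [show (⟨q, hq⟩ : localInt p) * ⟨q⁻¹, hq'⟩ = 1 from Subtype.ext (mul_inv_cancel₀ hne),
        map_one] at h1
      rw [show ratMod p q⁻¹ = (ratMod p q)⁻¹ from (inv_eq_of_mul_eq_one_right h1.symm).symm]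
  | succ i IH =>
    intro u hu hu0
    have hin : i < n := hi
    set j : Fin n := ⟨i, hin⟩ with hj
    have hnt := hT.nontrivial_triQuot i
    set U := projPoly T i (viewAt j (normalForm T (i + 1) u)) with hUdef
    have hU : U ∈ lowPolys T i := projPoly_viewAt_normalForm_mem hT j hu
    have hU0 : U ≠ 0 := projPoly_viewAt_normalForm_ne_zero hT j hu0
    have key : ∀ᶠ p in largePrimes, monicEuclid (invLevel p (triMod p T) i)
        (levelPoly (triMod p T) j) (projPoly (triMod p T) i (viewAt j
          (normalForm (triMod p T) (i + 1) (redElt p T (i + 1) u)))) =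
        monicEuclid (invLevel p (triMod p T) i) (redPoly p T i (levelPoly T j))
          (redPoly p T i U) := by
      filter_upwards [eventually_redPoly_levelPoly hT j,
        eventually_redPoly_projPoly_viewAt hT j u] with p h1 h2
      exact congrArg₂ _ h1.symm h2.symm
    rcases monicEuclid_eventually hT hin.le (IH hin.le) (levelPoly_mem_lowPolys hT j) hU with
      ⟨g, s, t, ⟨hg, hs, ht, hev⟩, hbez⟩ | hrep
    · have hgm : g.Monic := hbez.monic.resolve_right fun h' => hU0 h'.2.1
      by_cases hg1 : g = 1
      · refine Or.inl ⟨evalLevel T j t, evalLevel_mem_lowSubring hT j ht, ?_, ?_⟩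
        · have h1 := congrArg (evalLevel T j) hbez.bezout
          rw [hg1, map_one, map_add, map_mul, map_mul, evalLevel_levelPoly, mul_zero, zero_add,
            hUdef, evalLevel_projPoly_viewAt_normalForm hT j u] at h1
          rw [mul_comm]
          exact h1.symm
        · filter_upwards [key, hev, eventually_redPoly_one hT i, eventually_redElt_evalLevel hT j t,
            eventually_isTriIntegralAt T] with p h1 h2 h3 h4 ⟨_, h5⟩
          rw [invLevel, dif_pos hin, h1, h2]
          simp only [hg1, h3, if_true]
          rw [h4, evalLevel_eq (hT.triMod h5)]
      · refine Or.inr ⟨j, g, ⟨hg, hgm, hbez.dvd_left, ?_, ?_⟩, Nat.lt_succ_self i, ?_⟩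
        · rw [Nat.pos_iff_ne_zero]
          exact fun h0 => hg1 (hgm.natDegree_eq_zero.1 h0)
        · refine lt_of_le_of_lt ?_ (natDegree_projPoly_viewAt_lt hT j u)
          by_contra hlt
          exact hgm.not_dvd_of_natDegree_lt hU0 (not_le.1 hlt) hbez.dvd_right
        -- A rational gcd different from `1` must stay so modulo `p`, for otherwise the modular run
        -- would return an inverse.
        · have hne : ∀ᶠ p in largePrimes, redPoly p T i g ≠ 1 := by
            filter_upwards [eventually_redPoly_ne_zero hT (sub_ne_zero.2 hg1),
              eventually_redPoly_sub hT g 1, eventually_redPoly_one hT i] with p h1 h2 h3 h4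
            rw [h2, h3, h4, sub_self] at h1
            exact h1 rfl
          filter_upwards [key, hev, hne] with p h1 h2 h3
          rw [invLevel, dif_pos hin, h1, h2]
          simp only [h3, if_false]
          rfl
    · refine Or.inr (hrep.mono (Nat.le_succ i) ?_)
      filter_upwards [key] with p h1 w hw
      rw [invLevel, dif_pos hin, h1, hw]

end

noncomputable section

/-! ### Consequences of radicality -/

theorem mul_divByMonic_of_dvd {A : Type} [CommRing A] {f g : A[X]} (hg : g.Monic) (h : g ∣ f) :
    g * (f /ₘ g) = f := by
  have := modByMonic_add_div f g
  rwa [(modByMonic_eq_zero_iff_dvd hg).2 h, zero_add] at this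

section Radical

variable {n : ℕ} {T : Fin n → MvPolynomial (Fin n) ℚ}

/-- In positive degree the derivative has smaller degree, so it would have to vanish; but its top
coefficient is `deg g`, which is nonzero in characteristic zero. -/
theorem Polynomial.Monic.eq_one_of_dvd_derivative {A : Type} [CommRing A] [CharZero A] {g : A[X]}
    (hg : g.Monic) (h : g ∣ derivative g) : g = 1 := by
  have : Nontrivial A := nontrivial_of_ne ((0 : ℕ) : A) ((1 : ℕ) : A) fun h =>
    zero_ne_one (Nat.cast_injective h)
  by_contra h1
  have hd : g.natDegree ≠ 0 := fun h0 => h1 (hg.natDegree_eq_zero.1 h0)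
  have h0 : derivative g = 0 := by
    by_contra h0
    exact hg.not_dvd_of_natDegree_lt h0 (natDegree_derivative_lt hd) h
  obtain ⟨m, hm⟩ := Nat.exists_eq_succ_of_ne_zero hd
  have h2 := coeff_derivative g m
  rw [h0, coeff_zero, ← Nat.succ_eq_add_one, ← hm, hg.coeff_natDegree, one_mul] at h2
  exact (Nat.cast_add_one_ne_zero m) h2.symm

/-- Write `f = g q` for `f = t_j`. From `g ∣ f'` follows `g ∣ g' q`, so `f` divides `(g' q)^2`;
radicality yields `f ∣ g' q`, and cancelling the monic `q` leaves `g ∣ g'`. This replaces the usual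
squarefreeness argument over a field, as the level ring need not be a domain. -/
theorem bezoutGCD_derivative_eq_one (hT : IsMonicTriangular T) (hrad : (triIdeal T n).IsRadical)
    (j : Fin n) {g s t : (TriQuot T j.val)[X]}
    (h : IsBezoutGCD (lowSubring T j) (levelPoly T j) (derivative (levelPoly T j)) g s t) :
    g = 1 := by
  have hnt := hT.nontrivial_triQuot j.val
  have hf := levelPoly_monic hT j
  have hfl := levelPoly_mem_lowPolys hT j
  have hg : g.Monic := h.monic.resolve_right fun h' => hf.ne_zero h'.1
  set f := levelPoly T j with hf_def
  obtain ⟨q, hq⟩ : ∃ q, q = f /ₘ g := ⟨_, rfl⟩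
  have hfq : f = g * q := by
    rw [hq, mul_divByMonic_of_dvd hg h.dvd_left]
  have hql : q ∈ lowPolys T j := hq ▸ divByMonic_mem_liftsRing _ hfl h.mem_g hg
  have hqm : q.Monic := hg.of_mul_monic_left (hfq ▸ hf)
  have h1 : g ∣ derivative g * q := by
    have h2 := h.dvd_right
    rw [hfq, derivative_mul] at h2
    exact (dvd_add_left (Dvd.intro _ rfl)).1 h2
  obtain ⟨w, hw⟩ := h1
  have h2 : f ∣ (derivative g * q) ^ 2 :=
    ⟨w * derivative g, by rw [sq]; nth_rewrite 1 [hw]; rw [hfq]; ring⟩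
  have h3 := levelPoly_dvd_of_sq hT hrad j
    (Subring.mul_mem _ (derivative_mem_liftsRing _ h.mem_g) hql) h2
  rw [← hf_def, hfq] at h3
  obtain ⟨c, hc⟩ := h3
  have : CharZero (TriQuot T j.val) := algebraRat.charZero _
  refine hg.eq_one_of_dvd_derivative ⟨c, ?_⟩
  apply hqm.isRegular.right
  change derivative g * q = g * c * q
  rw [hc]; ring

/-- If `w = d w₁` and `v = d v₁` with `t_j = w v`, then `y = d w₁ v₁` satisfies `t_j = d y` and `t_j
∣ y^2`. By radicality `t_j ∣ y`, so `deg d = 0`. -/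
theorem bezoutGCD_cofactor_eq_one (hT : IsMonicTriangular T) (hrad : (triIdeal T n).IsRadical)
    (j : Fin n) {w d s t : (TriQuot T j.val)[X]} (hw : IsLevelFactor T j w)
    (h : IsBezoutGCD (lowSubring T j) w (levelPoly T j /ₘ w) d s t) : d = 1 := by
  have hnt := hT.nontrivial_triQuot j.val
  have hf := levelPoly_monic hT j
  have hfl := levelPoly_mem_lowPolys hT j
  have hd : d.Monic := h.monic.resolve_right fun h' => hw.monic.ne_zero h'.1
  have hvl := divByMonic_mem_liftsRing _ hfl hw.mem hw.monic
  have hfq : levelPoly T j = w * (levelPoly T j /ₘ w) :=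
    (mul_divByMonic_of_dvd hw.monic hw.dvd).symm
  set f := levelPoly T j with hf_def
  set v := f /ₘ w
  have hw1 := (mul_divByMonic_of_dvd hd h.dvd_left).symm
  have hv1 := (mul_divByMonic_of_dvd hd h.dvd_right).symm
  have hw1l := divByMonic_mem_liftsRing _ hw.mem h.mem_g hd
  have hv1l := divByMonic_mem_liftsRing _ hvl h.mem_g hd
  set w₁ := w /ₘ d
  set v₁ := v /ₘ d
  set y := d * w₁ * v₁ with hy
  have hfy : f = d * y := by rw [hfq, hw1, hv1, hy]; ring
  have hym : y.Monic := hd.of_mul_monic_left (hfy ▸ hf)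
  have h1 : f ∣ y ^ 2 := ⟨w₁ * v₁, by rw [hfy, hy]; ring⟩
  have h2 := levelPoly_dvd_of_sq hT hrad j
    (Subring.mul_mem _ (Subring.mul_mem _ h.mem_g hw1l) hv1l) h1
  have h3 : f.natDegree ≤ y.natDegree := by
    by_contra hlt
    exact hf.not_dvd_of_natDegree_lt hym.ne_zero (not_le.1 hlt) h2
  rw [hfy, hd.natDegree_mul hym] at h3
  exact hd.natDegree_eq_zero.1 (by omega)

/-- A negative test result is impossible at large primes, so the main loop cannot go on skipping
primes as not radical forever. -/
theorem isRadicalPrime_eventually (hT : IsMonicTriangular T) (hrad : (triIdeal T n).IsRadical)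
    (i : ℕ) (hi : i ≤ n) :
    (∀ᶠ p in largePrimes, isRadicalPrime p (triMod p T) i = .ok true) ∨
      EventuallyReports T n fun p => isRadicalPrime p (triMod p T) i := by
  induction i with
  | zero => exact Or.inl (Filter.Eventually.of_forall fun p => rfl)
  | succ i IH =>
    have hin : i < n := hi
    rcases IH hin.le with h | h
    · set j : Fin n := ⟨i, hin⟩
      have hfl := levelPoly_mem_lowPolys hT j
      have key : ∀ᶠ p in largePrimes, monicEuclid (invLevel p (triMod p T) i)
          (levelPoly (triMod p T) j) (derivative (levelPoly (triMod p T) j)) =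
          monicEuclid (invLevel p (triMod p T) i) (redPoly p T i (levelPoly T j))
            (redPoly p T i (derivative (levelPoly T j))) := by
        filter_upwards [eventually_redPoly_levelPoly hT j,
          eventually_redPoly_derivative hT (levelPoly T j)] with p h1 h2
        have h3 := h2.trans (congrArg derivative h1)
        exact congrArg₂ _ h1.symm h3.symm
      rcases monicEuclid_eventually hT hin.le (invLevel_eventually hT i hin.le) hfl
        (derivative_mem_liftsRing _ hfl) with ⟨g, s, t, ⟨hg, hs, ht, hev⟩, hbez⟩ | hrep
      · refine Or.inl ?_
        have hg1 := bezoutGCD_derivative_eq_one hT hrad j hbez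
        filter_upwards [key, hev, eventually_redPoly_one hT i, h] with p h1 h2 h3 h4
        rw [isRadicalPrime, h4]
        simp only
        rw [dif_pos hin, h1, h2, hg1, h3]
        simp
      · refine Or.inr (hrep.mono hin.le ?_)
        filter_upwards [key, h] with p h1 h4 w hw
        rw [isRadicalPrime, h4]
        simp only
        rw [dif_pos hin, h1, hw]
    · refine Or.inr (h.mono le_rfl (Filter.Eventually.of_forall fun p w hw => ?_))
      rw [isRadicalPrime, hw]

end Radical

/-! ### Rational reconstruction -/

/-- `q` is the rational number reconstructed from `c` modulo `m`. -/
def IsRatRecon (m : ℕ) (c : ℤ) (q : ℚ) : Prop :=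
  2 * q.num ^ 2 < (m : ℤ) ∧ 2 * q.den ^ 2 < m ∧ Nat.Coprime q.den m ∧
    q.num ≡ c * (q.den : ℤ) [ZMOD (m : ℤ)]

/-- After cross-multiplication the difference of the two fractions is divisible by `m`, while each
of the two products is smaller than `m / 2` in absolute value. -/
theorem IsRatRecon.eq {m : ℕ} {c : ℤ} {q q' : ℚ} (h : IsRatRecon m c q) (h' : IsRatRecon m c q') :
    q = q' := by
  obtain ⟨h1, h2, -, h4⟩ := h
  obtain ⟨h1', h2', -, h4'⟩ := h'
  have hm : (0 : ℤ) < m := by nlinarith [sq_nonneg q.num]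
  have hmod : q.num * q'.den ≡ q'.num * q.den [ZMOD (m : ℤ)] := by
    calc q.num * q'.den ≡ c * q.den * q'.den [ZMOD (m : ℤ)] := h4.mul_right _
      _ = c * q'.den * q.den := by ring
      _ ≡ q'.num * q.den [ZMOD (m : ℤ)] := (h4'.mul_right _).symm
  have hbound : ∀ r s : ℚ, 2 * r.num ^ 2 < (m : ℤ) → 2 * s.den ^ 2 < m →
      2 * |r.num * s.den| < (m : ℤ) := by
    intro r s hr hs
    have hs' : 2 * (s.den : ℤ) ^ 2 < m := by exact_mod_cast hs
    apply lt_of_pow_lt_pow_left₀ 2 hm.le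
    rw [mul_pow, sq_abs]
    nlinarith [sq_nonneg r.num, sq_nonneg (s.den : ℤ)]
  have b1 := hbound q q' h1 h2'
  have b2 := hbound q' q h1' h2
  have heq : q.num * q'.den = q'.num * q.den := by
    have h5 := hmod.symm.dvd
    have h6 : |q.num * q'.den - q'.num * q.den| < m := by
      have := abs_sub (q.num * q'.den) (q'.num * q.den)
      omega
    have := Int.eq_zero_of_abs_lt_dvd h5 h6
    omega
  exact (Rat.eq_iff_mul_eq_mul).2 heq

theorem ratRecon_eq_some {m : ℕ} {c : ℤ} {q : ℚ} :
    ratRecon m c = some q ↔ IsRatRecon m c q := by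
  constructor
  · intro h
    rw [ratRecon] at h
    split_ifs at h with hex
    rw [Option.some.injEq] at h
    exact h ▸ hex.choose_spec
  · intro h
    have hex : ∃ q : ℚ, 2 * q.num ^ 2 < (m : ℤ) ∧ 2 * q.den ^ 2 < m ∧ Nat.Coprime q.den m ∧
      q.num ≡ c * (q.den : ℤ) [ZMOD (m : ℤ)] := ⟨q, h⟩
    rw [ratRecon, dif_pos hex, Option.some.injEq]
    exact IsRatRecon.eq hex.choose_spec h

theorem isRatRecon_zero {m : ℕ} {q : ℚ} (h : IsRatRecon m 0 q) : q = 0 := by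
  obtain ⟨h1, -, -, h4⟩ := h
  rw [zero_mul] at h4
  have h5 := (Int.modEq_zero_iff_dvd).1 h4
  rw [← Rat.num_eq_zero]
  refine Int.eq_zero_of_abs_lt_dvd h5 ?_
  have := abs_nonneg q.num
  nlinarith [sq_abs q.num]

theorem isRatRecon_of_modEq_one {m : ℕ} {c : ℤ} {q : ℚ} (hc : c ≡ 1 [ZMOD (m : ℤ)])
    (h : IsRatRecon m c q) : q = 1 := by
  -- The denominator is at least `1`, so the mere existence of a reconstruction makes `m` large
  -- enough for `1` to satisfy the bounds.
  have hm : 2 < m := by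
    have := h.2.1
    have := q.den_pos
    nlinarith
  refine h.eq ⟨?_, ?_, ?_, ?_⟩
  · norm_num; exact_mod_cast hm
  · norm_num; exact hm
  · simp
  · simpa using hc.symm

variable {n : ℕ}

theorem ratReconPoly_eq_some_of {m : ℕ} {f : (MvPolynomial (Fin n) ℤ)[X]}
    {h : (MvPolynomial (Fin n) ℚ)[X]}
    (hf : ∀ d e, IsRatRecon m ((f.coeff d).coeff e) ((h.coeff d).coeff e)) :
    ratReconPoly m f = some h := by
  have hr := fun d e => ratRecon_eq_some.2 (hf d e)
  rw [ratReconPoly, if_pos fun d _ e _ => by rw [hr d e]; rfl]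
  congr 1
  ext d e
  by_cases h0 : (f.coeff d).coeff e = 0
  · have h1 := hf d e
    rw [h0] at h1
    rw [isRatRecon_zero h1]
    have h2 : ratRecon m 0 = some 0 := by rw [← h0, hr d e, isRatRecon_zero h1]
    rw [coeff_coeff_mapCoeffsPoly (by rw [h2]; rfl), h0, h2]
    rfl
  · have h2 : ratRecon m 0 = some 0 ∨ ratRecon m 0 = none := by
      cases h3 : ratRecon m 0 with
      | none => exact Or.inr rfl
      | some q => exact Or.inl (by rw [isRatRecon_zero (ratRecon_eq_some.1 h3)])
    rw [coeff_coeff_mapCoeffsPoly (by rcases h2 with h2 | h2 <;> rw [h2] <;> rfl), hr d e]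
    rfl

theorem ratReconPoly_spec {m : ℕ} {f : (MvPolynomial (Fin n) ℤ)[X]}
    {h : (MvPolynomial (Fin n) ℚ)[X]} (hf : ratReconPoly m f = some h) (d : ℕ) (e : Fin n →₀ ℕ) :
    ((f.coeff d).coeff e = 0 → (h.coeff d).coeff e = 0) ∧
      ((f.coeff d).coeff e ≠ 0 → IsRatRecon m ((f.coeff d).coeff e) ((h.coeff d).coeff e)) := by
  rw [ratReconPoly] at hf
  split_ifs at hf with hall
  rw [Option.some.injEq] at hf
  -- For `m ≤ 2` not even `0` can be reconstructed; the default value then gives the same answer,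
  -- and coefficients outside the support are treated correctly.
  have h2 : (ratRecon m 0).getD 0 = 0 := by
    cases h3 : ratRecon m 0 with
    | none => rfl
    | some q => rw [isRatRecon_zero (ratRecon_eq_some.1 h3)]; rfl
  rw [← hf, coeff_coeff_mapCoeffsPoly (φ := fun c => (ratRecon m c).getD 0) h2]
  refine ⟨fun h0 => by rw [h0, h2], fun h0 => ?_⟩
  have hd : d ∈ f.support := by
    rw [mem_support_iff]
    intro h1
    rw [h1] at h0
    exact h0 (MvPolynomial.coeff_zero _)
  obtain ⟨q, hq⟩ := Option.isSome_iff_exists.1 (hall d hd e (MvPolynomial.mem_support_iff.2 h0))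
  rw [hq]
  exact ratRecon_eq_some.1 hq

end

/-! ### Hensel lifting: the shape of the lifts -/

noncomputable section

variable {n : ℕ}

/-- The degree in `z_l` is smaller than `D l` for `l < i`, and zero for `l ≥ i`. -/
def IsBoundedBy {A : Type} [CommRing A] (D : Fin n → ℕ) (i : ℕ) (r : MvPolynomial (Fin n) A) :
    Prop :=
  ∀ l : Fin n, (l.val < i → r.degreeOf l < D l) ∧ (i ≤ l.val → r.degreeOf l = 0)

section Bounded

variable {A B : Type} [CommRing A] [CommRing B] {D : Fin n → ℕ} {i : ℕ}

theorem IsBoundedBy.of_coeff {r : MvPolynomial (Fin n) A} {s : MvPolynomial (Fin n) B}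
    (hr : IsBoundedBy D i r) (h : ∀ e, r.coeff e = 0 → s.coeff e = 0) : IsBoundedBy D i s :=
  fun l => ⟨fun hl => (degreeOf_le_of_coeff h l).trans_lt ((hr l).1 hl),
    fun hl => Nat.le_zero.1 ((degreeOf_le_of_coeff h l).trans ((hr l).2 hl).le)⟩

theorem IsBoundedBy.mapCoeffs {r : MvPolynomial (Fin n) A} (hr : IsBoundedBy D i r) {φ : A → B}
    (h0 : φ 0 = 0) : IsBoundedBy D i (mapCoeffs φ r) :=
  hr.of_coeff fun e he => by rw [coeff_mapCoeffs h0, he, h0]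

theorem IsBoundedBy.map {r : MvPolynomial (Fin n) A} (hr : IsBoundedBy D i r) (φ : A →+* B) :
    IsBoundedBy D i (MvPolynomial.map φ r) :=
  hr.of_coeff fun e he => by rw [MvPolynomial.coeff_map, he, map_zero]

theorem IsBoundedBy.add {r s : MvPolynomial (Fin n) A} (hr : IsBoundedBy D i r)
    (hs : IsBoundedBy D i s) : IsBoundedBy D i (r + s) := fun l =>
  ⟨fun hl => (MvPolynomial.degreeOf_add_le l r s).trans_lt (max_lt ((hr l).1 hl) ((hs l).1 hl)),
    fun hl => Nat.le_zero.1 ((MvPolynomial.degreeOf_add_le l r s).trans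
      (by rw [(hr l).2 hl, (hs l).2 hl]; exact le_rfl))⟩

theorem IsBoundedBy.zsmul {r : MvPolynomial (Fin n) A} (hr : IsBoundedBy D i r) (z : ℤ) :
    IsBoundedBy D i (z • r) :=
  hr.of_coeff fun e he => by rw [MvPolynomial.coeff_smul, he, smul_zero]

theorem isBoundedBy_coeff_repPoly [Nontrivial A] {T : Fin n → MvPolynomial (Fin n) A}
    (hT : IsMonicTriangular T) (hD : ∀ l, (T l).degreeOf l = D l) {f : (TriQuot T i)[X]}
    (hf : f ∈ lowPolys T i) (d : ℕ) : IsBoundedBy D i ((repPoly T i f).coeff d) := fun l =>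
  ⟨fun hl => by rw [← hD]; exact isReducedWrt_coeff_repPoly hT f d l hl,
    fun hl => mem_lowVars.1 (coeff_repPoly_mem_lowVars hT hf d) l hl⟩

theorem IsBoundedBy.isReducedWrt {T : Fin n → MvPolynomial (Fin n) A}
    (hD : ∀ l, (T l).degreeOf l = D l) {r : MvPolynomial (Fin n) A} (hr : IsBoundedBy D i r) :
    IsReducedWrt T i r := fun l hl => by
  rw [hD]
  exact (hr l).1 hl

theorem IsBoundedBy.mem_lowVars {r : MvPolynomial (Fin n) A} (hr : IsBoundedBy D i r) :
    r ∈ lowVars A n i :=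
  _root_.mem_lowVars.2 fun l hl => (hr l).2 hl

end Bounded

/-- `u` is monic of degree `d` in the univariate variable, with bounded coefficients. -/
structure IsBoundedMonic {A : Type} [CommRing A] (D : Fin n → ℕ) (i d : ℕ)
    (u : (MvPolynomial (Fin n) A)[X]) : Prop where
  lead : u.coeff d = 1
  top : ∀ d', d < d' → u.coeff d' = 0
  bdd : ∀ d', IsBoundedBy D i (u.coeff d')

section BoundedMonic

variable {A B : Type} [CommRing A] [CommRing B] {D : Fin n → ℕ} {i d : ℕ}

theorem IsBoundedMonic.map {u : (MvPolynomial (Fin n) A)[X]} (hu : IsBoundedMonic D i d u)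
    (φ : A →+* B) : IsBoundedMonic D i d (u.map (MvPolynomial.map φ)) where
  lead := by rw [coeff_map, hu.lead, map_one]
  top d' hd' := by rw [coeff_map, hu.top d' hd', map_zero]
  bdd d' := by rw [coeff_map]; exact (hu.bdd d').map φ

variable {T : Fin n → MvPolynomial (Fin n) A}

theorem IsBoundedMonic.mem_lowPolys {u : (MvPolynomial (Fin n) A)[X]}
    (hu : IsBoundedMonic D i d u) : projPoly T i u ∈ lowPolys T i :=
  projPoly_mem_lowPolys fun d => (hu.bdd d).mem_lowVars

theorem IsBoundedMonic.monic_projPoly {u : (MvPolynomial (Fin n) A)[X]}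
    (hu : IsBoundedMonic D i d u) : (projPoly T i u).Monic :=
  monic_of_natDegree_le_of_coeff_eq_one d
    (natDegree_le_iff_coeff_eq_zero.2 fun d' hd' => by
      rw [coeff_projPoly, hu.top d' hd', map_zero])
    (by rw [coeff_projPoly, hu.lead, map_one])

theorem IsBoundedMonic.natDegree_projPoly [Nontrivial (TriQuot T i)]
    {u : (MvPolynomial (Fin n) A)[X]} (hu : IsBoundedMonic D i d u) :
    (projPoly T i u).natDegree = d := by
  apply le_antisymm
  · exact natDegree_le_iff_coeff_eq_zero.2 fun d' hd' => by
      rw [coeff_projPoly, hu.top d' hd', map_zero]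
  · apply le_natDegree_of_ne_zero
    rw [coeff_projPoly, hu.lead, map_one]
    exact one_ne_zero

theorem IsBoundedMonic.repPoly_projPoly [Nontrivial A] (hT : IsMonicTriangular T)
    (hD : ∀ l, (T l).degreeOf l = D l) {u : (MvPolynomial (Fin n) A)[X]}
    (hu : IsBoundedMonic D i d u) : repPoly T i (projPoly T i u) = u :=
  _root_.repPoly_projPoly hT fun d => (hu.bdd d).isReducedWrt hD

theorem isBoundedMonic_repPoly [Nontrivial A] (hT : IsMonicTriangular T)
    (hD : ∀ l, (T l).degreeOf l = D l) {f : (TriQuot T i)[X]} (hf : f ∈ lowPolys T i)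
    (hm : f.Monic) : IsBoundedMonic D i f.natDegree (repPoly T i f) where
  lead := by rw [coeff_repPoly hT, hm.coeff_natDegree, normalForm_one hT]
  top d' hd' := by rw [coeff_repPoly hT, coeff_eq_zero_of_natDegree_lt hd', normalForm_zero hT]
  bdd d' := isBoundedBy_coeff_repPoly hT hD hf d'

end BoundedMonic

theorem coeff_liftInt (p : ℕ) [Fact p.Prime] (f : (MvPolynomial (Fin n) (ZMod p))[X]) (d : ℕ) :
    (liftInt p f).coeff d = mapCoeffs (fun z : ZMod p => (z.val : ℤ)) (f.coeff d) :=
  coeff_mapCoeffsPoly _ _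

theorem mapCoeffs_val_one (p : ℕ) [hp : Fact p.Prime] :
    mapCoeffs (fun z : ZMod p => (z.val : ℤ)) (1 : MvPolynomial (Fin n) (ZMod p)) = 1 := by
  classical
  ext e
  rw [coeff_mapCoeffs (by simp), MvPolynomial.coeff_one, MvPolynomial.coeff_one]
  have := Fact.mk hp.out.one_lt
  split_ifs
  · rw [ZMod.val_one]; rfl
  · simp

theorem isBoundedMonic_liftInt {D : Fin n → ℕ} {i d : ℕ} (p : ℕ) [Fact p.Prime]
    {f : (MvPolynomial (Fin n) (ZMod p))[X]} (hf : IsBoundedMonic D i d f) :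
    IsBoundedMonic D i d (liftInt p f) where
  lead := by rw [coeff_liftInt, hf.lead, mapCoeffs_val_one]
  top d' hd' := by rw [coeff_liftInt, hf.top d' hd', mapCoeffs_zero]
  bdd d' := by rw [coeff_liftInt]; exact (hf.bdd d').mapCoeffs (by simp)

/-- The error of a factorization modulo `p ^ e`, divided by `p ^ e` and reduced modulo `p`. -/
def henselError (p : ℕ) (T : Fin n → MvPolynomial (Fin n) ℚ) (i : ℕ) (f : (TriQuot T i)[X])
    (e : ℕ) (u v : (MvPolynomial (Fin n) ℤ)[X]) : (TriQuot (triMod p T) i)[X] :=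
  projPoly (triMod p T) i (mapCoeffsPoly (fun q : ℚ => ratMod p (q / (p : ℚ) ^ e))
    (repPoly T i (f - projPoly T i (intToRat (u * v)))))

/-- The correction of the first factor. -/
def henselTau {A : Type} [CommRing A] (a₀ b₀ s t c : A[X]) : A[X] :=
  t * c + ((s * c) /ₘ b₀) * a₀

open Classical in
theorem henselLoop_succ (p B : ℕ) (T : Fin n → MvPolynomial (Fin n) ℚ) (i : ℕ)
    (f : (TriQuot T i)[X]) (a₀ b₀ s t : (TriQuot (triMod p T) i)[X]) (m e : ℕ)
    (u v : (MvPolynomial (Fin n) ℤ)[X]) :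
    henselLoop p B T i f a₀ b₀ s t (m + 1) e u v =
      match (ratReconPoly (p ^ e) u).filter (fun a => decide (projPoly T i a ∣ f)) with
      | some a => some (a, repPoly T i (f /ₘ projPoly T i a))
      | none =>
        if 2 * B < p ^ e then none else
          henselLoop p B T i f a₀ b₀ s t m (e + 1)
            (u + (p : ℤ) ^ e • liftInt p (repPoly (triMod p T) i
              (henselTau a₀ b₀ s t (henselError p T i f e u v))))
            (v + (p : ℤ) ^ e • liftInt p (repPoly (triMod p T) i
              ((s * henselError p T i f e u v) %ₘ b₀))) := rfl

theorem hensel_identity {A : Type} [CommRing A] {a₀ b₀ s t : A[X]} (c : A[X])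
    (h : 1 = s * a₀ + t * b₀) :
    a₀ * ((s * c) %ₘ b₀) + b₀ * henselTau a₀ b₀ s t c = c := by
  rw [modByMonic_eq_sub_mul_div, henselTau]
  linear_combination c * h.symm

/-- In `b₀ τ = c - a₀ σ` the right side has degree below `deg a₀ + deg b₀`, and `b₀` is monic. The
correction thus leaves the leading term alone, and lifts stay monic of the same degree. -/
theorem degree_henselTau_lt {A : Type} [CommRing A] [Nontrivial A] {a₀ b₀ s t c : A[X]}
    (h : 1 = s * a₀ + t * b₀) (ha : a₀.Monic) (hb : b₀.Monic)
    (hc : c.degree < (a₀.natDegree + b₀.natDegree : ℕ)) :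
    (henselTau a₀ b₀ s t c).degree < a₀.natDegree := by
  have h1 := hensel_identity c h
  have h2 : (b₀ * henselTau a₀ b₀ s t c).degree < (a₀.natDegree + b₀.natDegree : ℕ) := by
    rw [← eq_sub_iff_add_eq'] at h1
    rw [h1]
    refine (degree_sub_le _ _).trans_lt (max_lt hc ?_)
    rw [mul_comm, ha.degree_mul]
    have h3 := degree_modByMonic_lt (s * c) hb
    by_cases h0 : (s * c) %ₘ b₀ = 0
    · rw [h0, degree_zero, WithBot.bot_add]
      exact WithBot.bot_lt_coe _
    · rw [degree_eq_natDegree hb.ne_zero, degree_eq_natDegree h0] at h3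
      rw [degree_eq_natDegree ha.ne_zero, degree_eq_natDegree h0, ← Nat.cast_add, Nat.cast_lt]
      have := Nat.cast_lt.1 h3
      omega
  rw [mul_comm, hb.degree_mul] at h2
  by_cases h0 : henselTau a₀ b₀ s t c = 0
  · rw [h0, degree_zero]
    exact WithBot.bot_lt_coe _
  · rw [degree_eq_natDegree hb.ne_zero, degree_eq_natDegree h0, ← Nat.cast_add, Nat.cast_lt] at h2
    rw [degree_eq_natDegree h0, Nat.cast_lt]
    omega

section Correct

variable {p : ℕ} [Fact p.Prime] {T : Fin n → MvPolynomial (Fin n) ℚ}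

theorem IsBoundedMonic.add_zsmul_liftInt (hT : IsMonicTriangular T) (hint : IsTriIntegralAt p T)
    {i d : ℕ} {u : (MvPolynomial (Fin n) ℤ)[X]}
    (hu : IsBoundedMonic (fun l => (T l).degreeOf l) i d u) {τ : (TriQuot (triMod p T) i)[X]}
    (hτ : τ ∈ lowPolys (triMod p T) i) (hd : τ.degree < d) (z : ℤ) :
    IsBoundedMonic (fun l => (T l).degreeOf l) i d
      (u + z • liftInt p (repPoly (triMod p T) i τ)) := by
  have hTp := hT.triMod hint
  have hz : ∀ d', d ≤ d' → (liftInt p (repPoly (triMod p T) i τ)).coeff d' = 0 := fun d' hd' => by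
    rw [coeff_liftInt, coeff_repPoly hTp, coeff_eq_zero_of_degree_lt
      (hd.trans_le (Nat.cast_le.2 hd')), normalForm_zero hTp, mapCoeffs_zero]
  refine ⟨?_, fun d' hd' => ?_, fun d' => ?_⟩
  · rw [coeff_add, coeff_smul, hz d le_rfl, smul_zero, add_zero, hu.lead]
  · rw [coeff_add, coeff_smul, hz d' hd'.le, smul_zero, add_zero, hu.top d' hd']
  · rw [coeff_add, coeff_smul, coeff_liftInt]
    exact (hu.bdd d').add ((IsBoundedBy.mapCoeffs
      (isBoundedBy_coeff_repPoly hTp (degreeOf_triMod hT hint) hτ d') (by simp)).zsmul z)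

theorem projPoly_intToRat_mul (T : Fin n → MvPolynomial (Fin n) ℚ) (i : ℕ)
    (u v : (MvPolynomial (Fin n) ℤ)[X]) :
    projPoly T i (intToRat (u * v)) = projPoly T i (intToRat u) * projPoly T i (intToRat v) := by
  rw [intToRat, Polynomial.map_mul, map_mul]
  rfl

variable {j : Fin n} {a₀ b₀ s t : (TriQuot (triMod p T) j.val)[X]}

/-- `t_j` and `uv` are monic of the same degree, so the top terms cancel in the error. -/
theorem degree_henselError_lt (hT : IsMonicTriangular T)
    {u v : (MvPolynomial (Fin n) ℤ)[X]} {d d' : ℕ}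
    (hu : IsBoundedMonic (fun l => (T l).degreeOf l) j d u)
    (hv : IsBoundedMonic (fun l => (T l).degreeOf l) j d' v)
    (hdd : d + d' = (T j).degreeOf j) (e : ℕ) :
    (henselError p T j (levelPoly T j) e u v).degree < (d + d' : ℕ) := by
  have hnt := hT.nontrivial_triQuot j.val
  have hu' : IsBoundedMonic (fun l => (T l).degreeOf l) j d (intToRat u) := hu.map _
  have hv' : IsBoundedMonic (fun l => (T l).degreeOf l) j d' (intToRat v) := hv.map _
  have hum := hu'.monic_projPoly (T := T)
  have hvm := hv'.monic_projPoly (T := T)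
  have hlt : (levelPoly T j - projPoly T j (intToRat (u * v))).degree < (d + d' : ℕ) := by
    have h1 : (levelPoly T j).natDegree = d + d' := by rw [natDegree_levelPoly hT, hdd]
    have h2 : (projPoly T j (intToRat (u * v))).natDegree = d + d' := by
      rw [projPoly_intToRat_mul, hum.natDegree_mul hvm, hu'.natDegree_projPoly,
        hv'.natDegree_projPoly]
    have h3 := levelPoly_monic hT j
    have h4 : (projPoly T j (intToRat (u * v))).Monic := by
      rw [projPoly_intToRat_mul]
      exact hum.mul hvm
    have := Polynomial.degree_sub_lt_left (p := levelPoly T j) (q := projPoly T j (intToRat (u * v)))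
      (by rw [degree_eq_natDegree h3.ne_zero, degree_eq_natDegree h4.ne_zero, h1, h2]) h3.ne_zero
      (by rw [h3.leadingCoeff, h4.leadingCoeff])
    rwa [degree_eq_natDegree h3.ne_zero, h1] at this
  rw [degree_lt_iff_coeff_zero]
  intro m hm
  rw [henselError, coeff_projPoly, coeff_mapCoeffsPoly, coeff_repPoly hT,
    coeff_eq_zero_of_degree_lt (hlt.trans_le (Nat.cast_le.2 hm)), normalForm_zero hT,
    mapCoeffs_zero, map_zero]

theorem henselError_mem_lowPolys (hT : IsMonicTriangular T)
    {u v : (MvPolynomial (Fin n) ℤ)[X]} {d d' : ℕ}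
    (hu : IsBoundedMonic (fun l => (T l).degreeOf l) j d u)
    (hv : IsBoundedMonic (fun l => (T l).degreeOf l) j d' v) (e : ℕ) :
    henselError p T j (levelPoly T j) e u v ∈ lowPolys (triMod p T) j := by
  have hu' : IsBoundedMonic (fun l => (T l).degreeOf l) j d (intToRat u) := hu.map _
  have hv' : IsBoundedMonic (fun l => (T l).degreeOf l) j d' (intToRat v) := hv.map _
  have hlow : levelPoly T j - projPoly T j (intToRat (u * v)) ∈ lowPolys T j := by
    rw [projPoly_intToRat_mul]
    exact Subring.sub_mem _ (levelPoly_mem_lowPolys hT j)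
      (Subring.mul_mem _ hu'.mem_lowPolys hv'.mem_lowPolys)
  refine projPoly_mem_lowPolys fun m => ?_
  rw [coeff_mapCoeffsPoly]
  have hb := isBoundedBy_coeff_repPoly hT (D := fun l => (T l).degreeOf l) (fun l => rfl) hlow m
  exact (hb.mapCoeffs (by simp [ratMod])).mem_lowVars

/-- The data of a Hensel lift: a coprime factorization modulo `p`. -/
structure IsHenselData (p : ℕ) (T : Fin n → MvPolynomial (Fin n) ℚ) (j : Fin n)
    (a₀ b₀ s t : (TriQuot (triMod p T) j.val)[X]) : Prop where
  mem_a : a₀ ∈ lowPolys (triMod p T) j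
  mem_b : b₀ ∈ lowPolys (triMod p T) j
  mem_s : s ∈ lowPolys (triMod p T) j
  mem_t : t ∈ lowPolys (triMod p T) j
  monic_a : a₀.Monic
  monic_b : b₀.Monic
  bezout : 1 = s * a₀ + t * b₀
  deg : a₀.natDegree + b₀.natDegree = (T j).degreeOf j

theorem IsHenselData.step (h : IsHenselData p T j a₀ b₀ s t) (hT : IsMonicTriangular T)
    (hint : IsTriIntegralAt p T) {u v : (MvPolynomial (Fin n) ℤ)[X]}
    (hu : IsBoundedMonic (fun l => (T l).degreeOf l) j a₀.natDegree u)
    (hv : IsBoundedMonic (fun l => (T l).degreeOf l) j b₀.natDegree v) (e : ℕ) :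
    IsBoundedMonic (fun l => (T l).degreeOf l) j a₀.natDegree
      (u + (p : ℤ) ^ e • liftInt p (repPoly (triMod p T) j
        (henselTau a₀ b₀ s t (henselError p T j (levelPoly T j) e u v)))) ∧
    IsBoundedMonic (fun l => (T l).degreeOf l) j b₀.natDegree
      (v + (p : ℤ) ^ e • liftInt p (repPoly (triMod p T) j
        ((s * henselError p T j (levelPoly T j) e u v) %ₘ b₀))) := by
  have hnt := (hT.triMod hint).nontrivial_triQuot j.val
  have hc := henselError_mem_lowPolys (p := p) hT hu hv e
  have hcd := degree_henselError_lt (p := p) hT hu hv h.deg e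
  have hsc := Subring.mul_mem _ h.mem_s hc
  refine ⟨hu.add_zsmul_liftInt hT hint ?_ ?_ _, hv.add_zsmul_liftInt hT hint ?_ ?_ _⟩
  · exact Subring.add_mem _ (Subring.mul_mem _ h.mem_t hc) (Subring.mul_mem _
      (divByMonic_mem_liftsRing _ hsc h.mem_b h.monic_b) h.mem_a)
  · exact degree_henselTau_lt h.bezout h.monic_a h.monic_b hcd
  · exact modByMonic_mem_liftsRing _ hsc h.mem_b h.monic_b
  · rw [← degree_eq_natDegree h.monic_b.ne_zero]
    exact degree_modByMonic_lt _ h.monic_b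

/-- A factorization over the rational numbers, as returned by Hensel lifting. -/
def IsLiftedFactor (T : Fin n → MvPolynomial (Fin n) ℚ) (j : Fin n) (d : ℕ)
    (x : (MvPolynomial (Fin n) ℚ)[X] × (MvPolynomial (Fin n) ℚ)[X]) : Prop :=
  ∃ α ∈ lowPolys T j, α.Monic ∧ α.natDegree = d ∧ α ∣ levelPoly T j ∧ x.1 = repPoly T j α ∧
    x.2 = repPoly T j (levelPoly T j /ₘ α)

/-- Reconstruction fixes the coefficients `0` and `1`, so it cannot spoil the shape. -/
theorem IsBoundedMonic.of_ratReconPoly {D : Fin n → ℕ} {i d m : ℕ}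
    {u : (MvPolynomial (Fin n) ℤ)[X]} (hu : IsBoundedMonic D i d u)
    {h : (MvPolynomial (Fin n) ℚ)[X]} (hh : ratReconPoly m u = some h) :
    IsBoundedMonic D i d h := by
  classical
  refine ⟨?_, fun d' hd' => ?_, fun d' => ?_⟩
  · ext e
    have h1 := ratReconPoly_spec hh d e
    rw [hu.lead, MvPolynomial.coeff_one] at h1
    rw [MvPolynomial.coeff_one]
    split_ifs at h1 ⊢ with he
    · exact isRatRecon_of_modEq_one (Int.ModEq.refl _) (h1.2 one_ne_zero)
    · exact h1.1 rfl
  · ext e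
    refine ((ratReconPoly_spec hh d' e).1 ?_).trans (MvPolynomial.coeff_zero _).symm
    rw [hu.top d' hd', MvPolynomial.coeff_zero]
  · exact (hu.bdd d').of_coeff fun e he => (ratReconPoly_spec hh d' e).1 he

/-- No congruence has to be tracked: divisibility over `ℚ` is tested before anything is returned.
Only the shape of the lifts matters, since their degree makes the returned factor a proper one. -/
theorem henselLoop_spec (h : IsHenselData p T j a₀ b₀ s t) (hT : IsMonicTriangular T)
    (hint : IsTriIntegralAt p T) (B m : ℕ) : ∀ (e : ℕ) (u v : (MvPolynomial (Fin n) ℤ)[X]),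
      IsBoundedMonic (fun l => (T l).degreeOf l) j a₀.natDegree u →
      IsBoundedMonic (fun l => (T l).degreeOf l) j b₀.natDegree v →
      ∀ x, henselLoop p B T j (levelPoly T j) a₀ b₀ s t m e u v = some x →
        IsLiftedFactor T j a₀.natDegree x := by
  have hnt := hT.nontrivial_triQuot j.val
  induction m with
  | zero =>
    intro e u v _ _ x hx
    simp [henselLoop] at hx
  | succ m IH =>
    intro e u v hu hv x hx
    rw [henselLoop_succ] at hx
    split at hx
    · rename_i a ha
      rw [Option.some.injEq] at hx
      obtain ⟨ha1, ha2⟩ := Option.filter_eq_some_iff.1 ha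
      have ha' := hu.of_ratReconPoly ha1
      refine ⟨projPoly T j a, ha'.mem_lowPolys, ha'.monic_projPoly, ha'.natDegree_projPoly,
        by simpa using ha2, ?_, ?_⟩
      · rw [← hx, ha'.repPoly_projPoly hT fun l => rfl]
      · rw [← hx]
    · split_ifs at hx
      obtain ⟨h1, h2⟩ := h.step hT hint hu hv e
      exact IH _ _ _ h1 h2 x hx

theorem isHenselData_of_monicEuclid (hT : IsMonicTriangular T) (hint : IsTriIntegralAt p T)
    {a₀ : (TriQuot (triMod p T) j.val)[X]} (ha : IsLevelFactor (triMod p T) j a₀)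
    (he : monicEuclid (invLevel p (triMod p T) j) a₀ (levelPoly (triMod p T) j /ₘ a₀) =
      .ok (1, s, t)) :
    IsHenselData p T j a₀ (levelPoly (triMod p T) j /ₘ a₀) s t := by
  have hTp := hT.triMod hint
  have hnt := hTp.nontrivial_triQuot j.val
  have hfl := levelPoly_mem_lowPolys hTp j
  have hbl := divByMonic_mem_liftsRing _ hfl ha.mem ha.monic
  have hfq := mul_divByMonic_of_dvd ha.monic ha.dvd
  have hspec := (monicEuclid_spec (invLevel_spec hTp j j.isLt.le) ha.mem hbl).1 _ _ _ he
  have hbm : (levelPoly (triMod p T) j /ₘ a₀).Monic :=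
    ha.monic.of_mul_monic_left (hfq.symm ▸ levelPoly_monic hTp j)
  refine ⟨ha.mem, hbl, hspec.mem_s, hspec.mem_t, ha.monic, hbm, hspec.bezout, ?_⟩
  rw [← ha.monic.natDegree_mul hbm, hfq, natDegree_levelPoly hTp, degreeOf_triMod hT hint]

/-- A proper factorization of `t_j`, as used for splitting. -/
def IsFactorization (T : Fin n → MvPolynomial (Fin n) ℚ)
    (x : Fin n × (MvPolynomial (Fin n) ℚ)[X] × (MvPolynomial (Fin n) ℚ)[X]) : Prop :=
  ∃ α, IsLevelFactor T x.1 α ∧ x.2.1 = repPoly T x.1 α ∧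
    x.2.2 = repPoly T x.1 (levelPoly T x.1 /ₘ α)

open Classical in
theorem handleZeroDivisor_succ (p : ℕ) (T : Fin n → MvPolynomial (Fin n) ℚ) (m : ℕ)
    (B : Option ℕ) (j : Fin n) (w : (MvPolynomial (Fin n) (ZMod p))[X]) :
    handleZeroDivisor p T (m + 1) B (j, w) =
      match henselLift p (nextBound B) T j.val (levelPoly T j) (projPoly (triMod p T) j.val w)
        (levelPoly (triMod p T) j /ₘ projPoly (triMod p T) j.val w) with
      | .error w' => handleZeroDivisor p T m (some (nextBound B)) w'
      | .ok none => (none, some (nextBound B))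
      | .ok (some (u, v)) => (some (j, u, v), some (nextBound B)) := rfl

theorem handleZeroDivisor_spec (hT : IsMonicTriangular T) (hint : IsTriIntegralAt p T) (m : ℕ) :
    ∀ (B : Option ℕ) (w : ZeroDivisor n p), IsZeroDivisor (triMod p T) w →
      ∀ x B', handleZeroDivisor p T m B w = (some x, B') → IsFactorization T x := by
  have hTp := hT.triMod hint
  induction m with
  | zero =>
    intro B w _ x B' hx
    simp [handleZeroDivisor] at hx
  | succ m IH =>
    rintro B ⟨j, w⟩ ⟨g, hg, hw⟩ x B' hx
    simp only at hg hw
    have hproj : projPoly (triMod p T) j.val w = g := by rw [hw, projPoly_repPoly hTp]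
    rw [handleZeroDivisor_succ, hproj] at hx
    have hnt := hTp.nontrivial_triQuot j.val
    have hbl := divByMonic_mem_liftsRing _ (levelPoly_mem_lowPolys hTp j) hg.mem hg.monic
    split at hx
    · rename_i w' hw'
      refine IH _ w' ?_ x B' hx
      rw [henselLift] at hw'
      split at hw'
      · rename_i w'' he
        rw [Except.error.injEq] at hw'
        rw [← hw']
        exact ((monicEuclid_spec (invLevel_spec hTp j j.isLt.le) hg.mem hbl).2 _ he).1
      · split_ifs at hw'
    · simp at hx
    · rename_i u v hw'
      rw [henselLift] at hw'
      split at hw'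
      · simp at hw'
      · rename_i g' s t he
        split_ifs at hw' with hg1
        · rw [hg1] at he
          have hdata := isHenselData_of_monicEuclid hT hint hg he
          rw [Except.ok.injEq] at hw'
          obtain ⟨α, hα, hαm, hαd, hαf, h1, h2⟩ := henselLoop_spec hdata hT hint _ _ _ _ _
            (isBoundedMonic_liftInt p (isBoundedMonic_repPoly hTp (degreeOf_triMod hT hint)
              hdata.mem_a hdata.monic_a))
            (isBoundedMonic_liftInt p (isBoundedMonic_repPoly hTp (degreeOf_triMod hT hint)
              hdata.mem_b hdata.monic_b)) _ hw'
          rw [Prod.mk.injEq, Option.some.injEq] at hx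
          rw [← hx.1]
          refine ⟨α, ⟨hα, hαm, hαf, ?_, ?_⟩, h1, h2⟩
          · rw [hαd]; exact hg.pos
          · rw [hαd, ← degreeOf_triMod hT hint]; exact hg.lt
        · simp at hw'

end Correct

end

/-! ### Hensel lifting: success for large primes and bounds -/

noncomputable section

variable {n : ℕ}

/-- The numerators and denominators of the coefficients of `h` are smaller than `√(m/2)`. -/
def HasHeightLT (m : ℕ) (h : (MvPolynomial (Fin n) ℚ)[X]) : Prop :=
  ∀ d e, 2 * ((h.coeff d).coeff e).num ^ 2 < (m : ℤ) ∧ 2 * ((h.coeff d).coeff e).den ^ 2 < m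

theorem exists_hasHeightLT (h : (MvPolynomial (Fin n) ℚ)[X]) :
    ∃ H, ∀ m, H ≤ m → HasHeightLT m h := by
  set b : ℚ → ℕ := fun q => 2 * q.num.natAbs ^ 2 + 2 * q.den ^ 2 + 1 with hb
  -- The summand `b 0` serves the coefficients outside the support: `0` has denominator `1`, which
  -- also needs room below the modulus.
  refine ⟨b 0 + ∑ d ∈ h.support, ∑ e ∈ (h.coeff d).support, b ((h.coeff d).coeff e),
    fun m hm d e => ?_⟩
  have hle : b ((h.coeff d).coeff e) ≤ m := by
    refine le_trans ?_ hm
    by_cases h0 : (h.coeff d).coeff e = 0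
    · rw [h0]; exact Nat.le_add_right _ _
    · have he : e ∈ (h.coeff d).support := MvPolynomial.mem_support_iff.2 h0
      have hd : d ∈ h.support := mem_support_iff.2 fun h1 => h0 (by
        rw [h1, MvPolynomial.coeff_zero])
      calc b ((h.coeff d).coeff e) ≤ ∑ e ∈ (h.coeff d).support, b ((h.coeff d).coeff e) :=
            Finset.single_le_sum (f := fun e => b ((h.coeff d).coeff e))
              (fun _ _ => Nat.zero_le _) he
        _ ≤ ∑ d ∈ h.support, ∑ e ∈ (h.coeff d).support, b ((h.coeff d).coeff e) :=
            Finset.single_le_sum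
              (f := fun d => ∑ e ∈ (h.coeff d).support, b ((h.coeff d).coeff e))
              (fun _ _ => Nat.zero_le _) hd
        _ ≤ _ := Nat.le_add_left _ _
  simp only [hb] at hle
  constructor
  · rw [← Int.natAbs_sq]
    exact_mod_cast (by omega : 2 * ((h.coeff d).coeff e).num.natAbs ^ 2 < m)
  · omega

theorem pow_dvd_of_eq_mul {p e : ℕ} [hp : Fact p.Prime] {N : ℤ} {r : ℚ} (hr : r ∈ localInt p)
    (h : (N : ℚ) = p ^ e * r) : (p : ℤ) ^ e ∣ N := by
  have h1 : (N * r.den : ℚ) = p ^ e * r.num := by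
    rw [h, mul_assoc, Rat.mul_den_eq_num]
  have h2 : N * r.den = p ^ e * r.num := by exact_mod_cast h1
  have h3 : IsCoprime ((p : ℤ) ^ e) (r.den : ℤ) := by
    rw [← Nat.cast_pow, Nat.isCoprime_iff_coprime]
    exact Nat.Coprime.pow_left e ((Nat.Prime.coprime_iff_not_dvd hp.out).2 hr)
  exact h3.dvd_of_dvd_mul_right (Dvd.intro _ h2.symm)

/-- An integer that is `p`-adically close to a rational number of small height reconstructs it. -/
theorem isRatRecon_of_sub {p e : ℕ} [hp : Fact p.Prime] {c : ℤ} {q r : localInt p}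
    (hnum : 2 * (q : ℚ).num ^ 2 < ((p ^ e : ℕ) : ℤ)) (hden : 2 * (q : ℚ).den ^ 2 < p ^ e)
    (h : (c : localInt p) = q + (p : localInt p) ^ e * r) : IsRatRecon (p ^ e) c q := by
  refine ⟨hnum, hden, Nat.Coprime.pow_right e
    ((Nat.Prime.coprime_iff_not_dvd hp.out).2 q.2).symm, ?_⟩
  have h1 : (c : ℚ) = q + p ^ e * r := by
    have := congrArg (localInt p).subtype h
    simpa using this
  have h2 : ((c * (q : ℚ).den - (q : ℚ).num : ℤ) : ℚ) =
      p ^ e * (r * ((q : ℚ).den : localInt p) : localInt p) := by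
    push_cast
    rw [h1, add_mul, Rat.mul_den_eq_num]
    ring
  have h3 := pow_dvd_of_eq_mul (Subtype.mem _) h2
  rw [Nat.cast_pow]
  exact (Int.modEq_iff_dvd.2 h3)

section Local

variable {p : ℕ} [Fact p.Prime] {T : Fin n → MvPolynomial (Fin n) ℚ} {i : ℕ}

/-- The residue class of an integer polynomial, over `localInt p`. -/
def intToLocal (p : ℕ) [Fact p.Prime] (T : Fin n → MvPolynomial (Fin n) ℚ) (i : ℕ) :
    (MvPolynomial (Fin n) ℤ)[X] →+* (TriQuot (localTri p T) i)[X] :=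
  (projPoly (localTri p T) i).comp
    (Polynomial.mapRingHom (MvPolynomial.map (Int.castRingHom (localInt p))))

theorem map_inclTri_intToLocal (h : IsTriIntegralAt p T) (u : (MvPolynomial (Fin n) ℤ)[X]) :
    (intToLocal p T i u).map (inclTri h i) = projPoly T i (intToRat u) := by
  rw [intToLocal, RingHom.comp_apply, coe_mapRingHom, inclTri, map_projPoly, intToRat,
    Polynomial.map_map]
  congr 2
  apply MvPolynomial.ringHom_ext <;> intro x <;> simp

theorem map_redTri_intToLocal_liftInt (h : IsTriIntegralAt p T)
    (f : (MvPolynomial (Fin n) (ZMod p))[X]) :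
    (intToLocal p T i (liftInt p f)).map (redTri h i) = projPoly (triMod p T) i f := by
  rw [intToLocal, RingHom.comp_apply, coe_mapRingHom, redTri, map_projPoly]
  congr 1
  ext d e
  rw [coeff_map, coeff_map, MvPolynomial.coeff_map, MvPolynomial.coeff_map, coeff_liftInt,
    coeff_mapCoeffs (by simp), eq_intCast, map_intCast, Int.cast_natCast, ZMod.natCast_zmod_val]

theorem redTri_eq_zero (hT : IsMonicTriangular T) (h : IsTriIntegralAt p T)
    {f : (TriQuot (localTri p T) i)[X]} (hf : f.map (redTri h i) = 0) :
    ∃ g, f = C (p : TriQuot (localTri p T) i) * g :=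
  Polynomial.exists_eq_C_mul_of_map_eq_zero
    (fun _ hu => triQuotMap_localIntMod_eq_zero (hT.localTri h) _ hu) hf

theorem redTri_natCast (h : IsTriIntegralAt p T) :
    redTri h i (p : TriQuot (localTri p T) i) = 0 := by
  have h1 : Ideal.Quotient.mk (triIdeal (triMod p T) i) (MvPolynomial.C ((p : ℕ) : ZMod p)) = 0 := by
    rw [ZMod.natCast_self, MvPolynomial.C_0, map_zero]
  rw [map_natCast]
  rwa [map_natCast, map_natCast] at h1

/-- The ring embeds into a `ℚ`-algebra, where `p` is a unit. -/
theorem natCast_mul_eq_zero (hT : IsMonicTriangular T) (h : IsTriIntegralAt p T) (e : ℕ)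
    {u : TriQuot (localTri p T) i} (hu : (p : TriQuot (localTri p T) i) ^ e * u = 0) : u = 0 := by
  have hp : (p : ℚ) ^ e ≠ 0 := pow_ne_zero _ (Nat.cast_ne_zero.2 (Fact.out : p.Prime).ne_zero)
  apply inclTri_injective hT h
  rw [map_zero]
  have h1 := congrArg (inclTri h i) hu
  rw [map_mul, map_pow, map_natCast, map_zero] at h1
  have h2 : algebraMap ℚ (TriQuot T i) ((p : ℚ) ^ e)⁻¹ * (p : TriQuot T i) ^ e = 1 := by
    have : (p : TriQuot T i) ^ e = algebraMap ℚ (TriQuot T i) ((p : ℚ) ^ e) := by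
      rw [map_pow, map_natCast]
    rw [this, ← map_mul, inv_mul_cancel₀ hp, map_one]
  calc inclTri h i u = algebraMap ℚ (TriQuot T i) ((p : ℚ) ^ e)⁻¹ * (p : TriQuot T i) ^ e *
        inclTri h i u := by rw [h2, one_mul]
    _ = 0 := by rw [mul_assoc, h1, mul_zero]

theorem degree_C_pow_mul (hT : IsMonicTriangular T) (h : IsTriIntegralAt p T) (e : ℕ)
    (f : (TriQuot (localTri p T) i)[X]) :
    (C ((p : TriQuot (localTri p T) i) ^ e) * f).degree = f.degree := by
  by_cases hf : f = 0
  · rw [hf, mul_zero]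
  · exact degree_C_mul_of_mul_ne_zero fun h0 =>
      hf (leadingCoeff_eq_zero.1 (natCast_mul_eq_zero hT h e h0))

/-- The error term of Hensel lifting, in terms of the error over `localInt p`. -/
theorem henselError_eq (hT : IsMonicTriangular T) (h : IsTriIntegralAt p T) (j : Fin n) (e : ℕ)
    (u v : (MvPolynomial (Fin n) ℤ)[X]) {z : (TriQuot (localTri p T) j)[X]}
    (hz : levelPoly (localTri p T) j - intToLocal p T j (u * v) =
      C ((p : TriQuot (localTri p T) j) ^ e) * z) :
    henselError p T j (levelPoly T j) e u v = z.map (redTri h j) := by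
  have hp : (p : ℚ) ^ e ≠ 0 := pow_ne_zero _ (Nat.cast_ne_zero.2 (Fact.out : p.Prime).ne_zero)
  have hL := hT.localTri h
  have h1 : levelPoly T j - projPoly T j (intToRat (u * v)) =
      (C ((p : TriQuot (localTri p T) j) ^ e) * z).map (inclTri h j) := by
    rw [← hz, Polynomial.map_sub, map_inclTri_intToLocal]
    congr 1
    exact (map_levelPoly (map_subtype_localTri h) j).symm
  have h2 : mapCoeffsPoly (fun q : ℚ => ratMod p (q / (p : ℚ) ^ e))
      (repPoly T j (levelPoly T j - projPoly T j (intToRat (u * v)))) =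
      (repPoly (localTri p T) j z).map (MvPolynomial.map (localIntMod p)) := by
    rw [h1, inclTri, repPoly_map hL]
    ext d m
    rw [coeff_coeff_mapCoeffsPoly (by simp [ratMod]), coeff_map, coeff_map, MvPolynomial.coeff_map,
      MvPolynomial.coeff_map, coeff_repPoly hL, coeff_repPoly hL, coeff_C_mul]
    have h3 : (p : TriQuot (localTri p T) j) ^ e =
        Ideal.Quotient.mk _ (MvPolynomial.C ((p : localInt p) ^ e)) := by
      rw [map_pow, map_pow, map_natCast, map_natCast]
    rw [h3, normalForm_mk_C_mul hL, MvPolynomial.coeff_C_mul, map_mul, map_pow, map_natCast,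
      mul_div_cancel_left₀ _ hp]
    rfl
  rw [henselError, h2, ← map_projPoly (map_localIntMod_localTri h), projPoly_repPoly hL]
  rfl

/-- `u` and `v` approximate `w` and `v₀` modulo `p ^ e`. -/
def IsApprox (p : ℕ) [Fact p.Prime] (T : Fin n → MvPolynomial (Fin n) ℚ) (i e : ℕ)
    (u : (MvPolynomial (Fin n) ℤ)[X]) (w : (TriQuot (localTri p T) i)[X]) : Prop :=
  ∃ x, intToLocal p T i u = w + C ((p : TriQuot (localTri p T) i) ^ e) * x

/-- A digit `τ` that is opposite to the error `x` modulo `p` makes the remaining error divisible by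
one more power of `p`. -/
theorem IsApprox.add (hT : IsMonicTriangular T) (h : IsTriIntegralAt p T) {e : ℕ}
    {u : (MvPolynomial (Fin n) ℤ)[X]} {w x : (TriQuot (localTri p T) i)[X]}
    (hu : intToLocal p T i u = w + C ((p : TriQuot (localTri p T) i) ^ e) * x)
    {τ : (TriQuot (triMod p T) i)[X]} (hτ : x.map (redTri h i) + τ = 0) :
    IsApprox p T i (e + 1) (u + (p : ℤ) ^ e • liftInt p (repPoly (triMod p T) i τ)) w := by
  obtain ⟨x', hx'⟩ := redTri_eq_zero hT h
    (f := x + intToLocal p T i (liftInt p (repPoly (triMod p T) i τ)))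
    (by rw [Polynomial.map_add, map_redTri_intToLocal_liftInt, projPoly_repPoly (hT.triMod h), hτ])
  refine ⟨x', ?_⟩
  rw [map_add, map_zsmul, hu, zsmul_eq_mul, pow_succ, C_mul, mul_assoc, ← hx', mul_add, add_assoc]
  congr 3
  simp

theorem isApprox_one (hT : IsMonicTriangular T) (h : IsTriIntegralAt p T)
    (w : (TriQuot (localTri p T) i)[X]) :
    IsApprox p T i 1 (liftInt p (repPoly (triMod p T) i (w.map (redTri h i)))) w := by
  obtain ⟨x, hx⟩ := redTri_eq_zero hT h
    (f := intToLocal p T i (liftInt p (repPoly (triMod p T) i (w.map (redTri h i)))) - w)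
    (by rw [Polynomial.map_sub, map_redTri_intToLocal_liftInt, projPoly_repPoly (hT.triMod h),
      sub_self])
  exact ⟨x, by rw [pow_one, ← hx, add_sub_cancel]⟩

/-- Uniqueness of the Hensel correction: by the Bézout relation `b₀` divides `y + σ`, which has
smaller degree; then `b₀ (x + τ) = 0` with `b₀` monic. -/
theorem eq_of_mul_add_mul_eq {A : Type} [CommRing A] [Nontrivial A] {a₀ b₀ s t σ τ x y : A[X]}
    (hst : 1 = s * a₀ + t * b₀) (hb : b₀.Monic) (hσ : σ.degree < b₀.degree)
    (hy : y.degree < b₀.degree) (h : a₀ * σ + b₀ * τ = -(a₀ * y + b₀ * x)) :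
    x + τ = 0 ∧ y + σ = 0 := by
  have h1 : b₀ ∣ y + σ := ⟨t * (y + σ) - s * (x + τ), by
    linear_combination (y + σ) * hst + s * h⟩
  have h2 : y + σ = 0 := by
    by_contra h0
    exact hb.not_dvd_of_degree_lt h0 ((degree_add_le _ _).trans_lt (max_lt hy hσ)) h1
  have h3 : b₀ * (x + τ) = 0 := by linear_combination h - a₀ * h2
  exact ⟨(hb.mul_right_eq_zero_iff).1 h3, h2⟩

end Local

section Success

variable {p : ℕ} [Fact p.Prime] {T : Fin n → MvPolynomial (Fin n) ℚ} {j : Fin n}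

/-- With `u = w + p^e x` and `v = v₀ + p^e y` the error is `-p^e (w y + v₀ x + p^e x y)`. Since `e ≥
1`, its reduction after division by `p^e` is `-(a₀ y + b₀ x)`, so by uniqueness the computed digits
are `-x` and `-y` modulo `p`. Hence the algorithm follows the true rational factors. -/
theorem isApprox_step (hT : IsMonicTriangular T) (h : IsTriIntegralAt p T)
    {w v₀ : (TriQuot (localTri p T) j)[X]} (hwv : levelPoly (localTri p T) j = w * v₀)
    {s t : (TriQuot (triMod p T) j)[X]}
    (hd : IsHenselData p T j (w.map (redTri h j)) (v₀.map (redTri h j)) s t)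
    (hvm : v₀.Monic) {u v : (MvPolynomial (Fin n) ℤ)[X]} {e : ℕ} (he : 1 ≤ e)
    (hvb : IsBoundedMonic (fun l => (T l).degreeOf l) j v₀.natDegree v)
    (hu : IsApprox p T j e u w) (hv : IsApprox p T j e v v₀) :
    IsApprox p T j (e + 1) (u + (p : ℤ) ^ e • liftInt p (repPoly (triMod p T) j
        (henselTau (w.map (redTri h j)) (v₀.map (redTri h j)) s t
          (henselError p T j (levelPoly T j) e u v)))) w ∧
    IsApprox p T j (e + 1) (v + (p : ℤ) ^ e • liftInt p (repPoly (triMod p T) j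
        ((s * henselError p T j (levelPoly T j) e u v) %ₘ (v₀.map (redTri h j))))) v₀ := by
  obtain ⟨x, hx⟩ := hu
  obtain ⟨y, hy⟩ := hv
  have hnt := (hT.triMod h).nontrivial_triQuot j.val
  have hnt' := (hT.localTri h).nontrivial_triQuot j.val
  have herr := henselError_eq hT h j e u v
    (z := -(w * y + v₀ * x + C ((p : TriQuot (localTri p T) j) ^ e) * x * y)) (by
      rw [map_mul, hx, hy, hwv]; ring)
  have hred : henselError p T j (levelPoly T j) e u v =
      -(w.map (redTri h j) * y.map (redTri h j) + v₀.map (redTri h j) * x.map (redTri h j)) := by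
    rw [herr]
    have hC : (C ((p : TriQuot (localTri p T) j) ^ e)).map (redTri h j) = 0 := by
      rw [map_C, map_pow, redTri_natCast, zero_pow (by omega), C_0]
    simp only [Polynomial.map_neg, Polynomial.map_add, Polynomial.map_mul, hC]
    ring
  -- `v` and `v₀` are monic of the same degree and `p` is not a zero-divisor, so the error `y` has
  -- lost the top term, as uniqueness demands.
  have hdy : y.degree < v₀.degree := by
    rw [← degree_C_pow_mul hT h e, ← add_sub_cancel_left v₀
      (C ((p : TriQuot (localTri p T) j) ^ e) * y), ← hy]
    have hvm' : IsBoundedMonic (fun l => (T l).degreeOf l) j v₀.natDegree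
      (v.map (MvPolynomial.map (Int.castRingHom (localInt p)))) := hvb.map _
    have h1 : (intToLocal p T j v).Monic := hvm'.monic_projPoly
    have h2 : (intToLocal p T j v).natDegree = v₀.natDegree := hvm'.natDegree_projPoly
    have h3 : (intToLocal p T j v).degree = v₀.degree := by
      rw [degree_eq_natDegree h1.ne_zero, degree_eq_natDegree hvm.ne_zero, h2]
    rw [← h3]
    exact Polynomial.degree_sub_lt_left h3 h1.ne_zero (by rw [h1.leadingCoeff, hvm.leadingCoeff])
  have hdy' : (y.map (redTri h j)).degree < (v₀.map (redTri h j)).degree := by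
    rw [hvm.degree_map]
    exact degree_map_le.trans_lt hdy
  have key := eq_of_mul_add_mul_eq hd.bezout hd.monic_b
    (degree_modByMonic_lt (s * henselError p T j (levelPoly T j) e u v) hd.monic_b) hdy'
    ((hensel_identity _ hd.bezout).trans hred)
  exact ⟨IsApprox.add hT h hx key.1, IsApprox.add hT h hy key.2⟩

theorem IsApprox.ratReconPoly_eq (hT : IsMonicTriangular T) (h : IsTriIntegralAt p T) {i d e : ℕ}
    {u : (MvPolynomial (Fin n) ℤ)[X]} {w : (TriQuot (localTri p T) i)[X]}
    (hu : IsApprox p T i e u w) (hub : IsBoundedMonic (fun l => (T l).degreeOf l) i d u)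
    (hH : HasHeightLT (p ^ e) (repPoly T i (w.map (inclTri h i)))) :
    ratReconPoly (p ^ e) u = some (repPoly T i (w.map (inclTri h i))) := by
  obtain ⟨x, hx⟩ := hu
  have hL := hT.localTri h
  have hub' : IsBoundedMonic (fun l => (T l).degreeOf l) i d
      (u.map (MvPolynomial.map (Int.castRingHom (localInt p)))) := hub.map _
  have h1 : u.map (MvPolynomial.map (Int.castRingHom (localInt p))) =
      repPoly (localTri p T) i (w + C ((p : TriQuot (localTri p T) i) ^ e) * x) := by
    rw [← hx]
    exact (hub'.repPoly_projPoly hL fun l => by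
      rw [← degreeOf_map_self hL (map_subtype_localTri h)]).symm
  apply ratReconPoly_eq_some_of
  intro d' m
  obtain ⟨hn, hdn⟩ := hH d' m
  rw [inclTri, repPoly_map hL, coeff_map, MvPolynomial.coeff_map] at hn hdn ⊢
  refine isRatRecon_of_sub (r := ((repPoly (localTri p T) i x).coeff d').coeff m) hn hdn ?_
  have h2 := congrArg (fun F => (F.coeff d').coeff m) h1
  simp only [coeff_map, MvPolynomial.coeff_map, eq_intCast] at h2
  rw [h2, repPoly_add hL, coeff_add, MvPolynomial.coeff_add, coeff_repPoly hL, coeff_repPoly hL,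
    coeff_repPoly hL, coeff_C_mul]
  have h3 : (p : TriQuot (localTri p T) i) ^ e =
      Ideal.Quotient.mk _ (MvPolynomial.C ((p : localInt p) ^ e)) := by
    rw [map_pow, map_pow, map_natCast, map_natCast]
  rw [h3, normalForm_mk_C_mul hL, MvPolynomial.coeff_C_mul]

/-- When `B` exceeds the height of the true factor, neither FAIL nor lack of fuel is possible. The
loop may stop early with another factor, which is just as good, so only the absence of `none` is
claimed. -/
theorem henselLoop_ne_none (hT : IsMonicTriangular T) (h : IsTriIntegralAt p T)
    {w v₀ : (TriQuot (localTri p T) j)[X]} (hwv : levelPoly (localTri p T) j = w * v₀)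
    {s t : (TriQuot (triMod p T) j)[X]} (hwm : w.Monic) (hvm : v₀.Monic)
    (hd : IsHenselData p T j (w.map (redTri h j)) (v₀.map (redTri h j)) s t) {B : ℕ}
    (hB : ∀ m, B ≤ m → HasHeightLT m (repPoly T j (w.map (inclTri h j)))) (m : ℕ) :
    ∀ (e : ℕ) (u v : (MvPolynomial (Fin n) ℤ)[X]), 1 ≤ e → p ^ (e - 1) ≤ 2 * B + 1 →
      2 * B + 2 ≤ m + e → IsBoundedMonic (fun l => (T l).degreeOf l) j w.natDegree u →
      IsBoundedMonic (fun l => (T l).degreeOf l) j v₀.natDegree v →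
      IsApprox p T j e u w → IsApprox p T j e v v₀ →
      henselLoop p B T j (levelPoly T j) (w.map (redTri h j)) (v₀.map (redTri h j)) s t m e u v ≠
        none := by
  have hnt := (hT.triMod h).nontrivial_triQuot j.val
  have hwd : (w.map (redTri h j)).natDegree = w.natDegree := hwm.natDegree_map _
  have hvd : (v₀.map (redTri h j)).natDegree = v₀.natDegree := hvm.natDegree_map _
  induction m with
  | zero =>
    intro e u v he hpe hm
    -- With the fuel used up one would have `2B + 1 ≤ e - 1 < p^(e-1) ≤ 2B + 1`. The bound `2B + 1`,
    -- rather than `2B`, lets the invariant hold at `e = 1` even for `B = 0`.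
    have h1 : e - 1 < p ^ (e - 1) := Nat.lt_pow_self (Fact.out : p.Prime).one_lt
    omega
  | succ m IH =>
    intro e u v he hpe hm hub hvb hu hv
    rw [henselLoop_succ]
    split
    · exact Option.some_ne_none _
    · rename_i hnone
      split_ifs with hlt
      -- Reconstruction is tried before FAIL is considered. At `p^e > 2B` it would have returned `w`
      -- itself, which divides `t_j`.
      · exfalso
        rw [hu.ratReconPoly_eq hT h hub (hB _ (by omega))] at hnone
        refine Option.filter_eq_none_iff.1 hnone _ rfl ?_
        simp only [decide_eq_true_eq]
        rw [projPoly_repPoly hT]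
        refine ⟨v₀.map (inclTri h j), ?_⟩
        rw [← Polynomial.map_mul, ← hwv]
        exact (map_levelPoly (map_subtype_localTri h) j).symm
      · obtain ⟨h1, h2⟩ := hd.step hT h (hwd.symm ▸ hub) (hvd.symm ▸ hvb) e
        obtain ⟨h3, h4⟩ := isApprox_step hT h hwv hd hvm he hvb hu hv
        rw [hwd] at h1
        rw [hvd] at h2
        exact IH _ _ _ (by omega) (by rw [Nat.add_sub_cancel]; omega) (by omega) h1 h2 h3 h4

end Success

section Handle

variable {T : Fin n → MvPolynomial (Fin n) ℚ}

theorem le_nextBound_some (b : ℕ) : b ≤ nextBound (some b) := by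
  rw [nextBound, sq]
  exact Nat.le_mul_self b

theorem handleZeroDivisor_bound (p : ℕ) (T : Fin n → MvPolynomial (Fin n) ℚ) (m : ℕ) :
    ∀ (B : Option ℕ) (w : ZeroDivisor n p),
      ∃ b, nextBound B ≤ b ∧ (handleZeroDivisor p T (m + 1) B w).2 = some b := by
  induction m with
  | zero =>
    rintro B ⟨j, w⟩
    refine ⟨nextBound B, le_rfl, ?_⟩
    rw [handleZeroDivisor_succ]
    split <;> rfl
  | succ m IH =>
    rintro B ⟨j, w⟩
    rw [handleZeroDivisor_succ]
    split
    · rename_i w' _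
      obtain ⟨b, hb, hB⟩ := IH (some (nextBound B)) w'
      exact ⟨b, (le_nextBound_some _).trans hb, hB⟩
    · exact ⟨_, le_rfl, rfl⟩
    · exact ⟨_, le_rfl, rfl⟩

/-- The threshold `H` is a height bound for `w` and is independent of `p`, so that the growing
global bound can reach it while the primes vary. -/
theorem henselLift_eventually (hT : IsMonicTriangular T) (j : Fin n) {w s t : (TriQuot T j)[X]}
    (hw : IsLevelFactor T j w)
    (hE : EventuallyReturns T j (fun p => monicEuclid (invLevel p (triMod p T) j)
      (redPoly p T j w) (redPoly p T j (levelPoly T j /ₘ w))) 1 s t) :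
    ∃ H, ∀ᶠ p in largePrimes, ∀ B, H ≤ B → ∃ x,
      henselLift p B T j (levelPoly T j) (redPoly p T j w)
        (levelPoly (triMod p T) j /ₘ redPoly p T j w) = .ok (some x) := by
  obtain ⟨H, hH⟩ := exists_hasHeightLT (repPoly T j w)
  refine ⟨H, ?_⟩
  filter_upwards [hE.2.2.2, eventually_redPoly_one hT j, eventually_redPoly_divByMonic hT
    (levelPoly T j) hw.monic, eventually_exists_map_inclTri hT w] with p h1 h2 h3
    ⟨hp, h, w₀, hw₀⟩ B hB
  have hnt := (hT.triMod h).nontrivial_triQuot j.val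
  have hL := hT.localTri h
  have hwm : w₀.Monic := exists_monic_map_inclTri hT (hw₀ ▸ hw.monic)
  have hf : (levelPoly (localTri p T) j).map (inclTri h j) = levelPoly T j :=
    map_levelPoly (map_subtype_localTri h) j
  have hfr : (levelPoly (localTri p T) j).map (redTri h j) = levelPoly (triMod p T) j :=
    map_levelPoly (map_localIntMod_localTri h) j
  have hdvd : w₀ ∣ levelPoly (localTri p T) j := by
    rw [← map_dvd_map _ (inclTri_injective hT h j) hwm, hw₀, hf]
    exact hw.dvd
  have hwv := (mul_divByMonic_of_dvd hwm hdvd).symm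
  set v₀ := levelPoly (localTri p T) j /ₘ w₀ with hv₀
  have hvm : v₀.Monic := hwm.of_mul_monic_left (hwv ▸ levelPoly_monic hL j)
  have hred : redPoly p T j w = w₀.map (redTri h j) := by rw [← hw₀, redPoly_map_inclTri hT]
  have hvr : levelPoly (triMod p T) j /ₘ redPoly p T j w = v₀.map (redTri h j) := by
    rw [hred, ← hfr, ← map_divByMonic _ hwm]
  rw [h3, redPoly_levelPoly hT h, h2] at h1
  have hfac : IsLevelFactor (triMod p T) j (redPoly p T j w) := by
    refine ⟨redPoly_mem_lowPolys hT p hw.mem, hred ▸ hwm.map _, ?_, ?_, ?_⟩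
    · rw [hred, ← hfr]
      exact Polynomial.map_dvd _ hdvd
    · rw [hred, hwm.natDegree_map, ← natDegree_map_eq_of_injective (inclTri_injective hT h j), hw₀]
      exact hw.pos
    · rw [degreeOf_triMod hT h, hred, hwm.natDegree_map,
        ← natDegree_map_eq_of_injective (inclTri_injective hT h j), hw₀]
      exact hw.lt
  have hdata := isHenselData_of_monicEuclid hT h hfac h1
  rw [henselLift, h1]
  simp only [if_true]
  rw [hvr, hred] at hdata ⊢
  have hbu := isBoundedMonic_liftInt p (isBoundedMonic_repPoly (hT.triMod h) (degreeOf_triMod hT h)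
    hdata.mem_a hdata.monic_a)
  have hbv := isBoundedMonic_liftInt p (isBoundedMonic_repPoly (hT.triMod h) (degreeOf_triMod hT h)
    hdata.mem_b hdata.monic_b)
  rw [hwm.natDegree_map] at hbu
  rw [hvm.natDegree_map] at hbv
  have := henselLoop_ne_none hT h hwv hwm hvm hdata (B := B)
    (fun m hm => by rw [hw₀]; exact hH m (hB.trans hm)) (2 * B + 1) 1 _ _ le_rfl
    (by simp) (by omega) hbu hbv (isApprox_one hT h w₀) (isApprox_one hT h v₀)
  obtain ⟨x, hx⟩ := Option.ne_none_iff_exists'.1 this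
  exact ⟨x, by rw [hx]⟩

/-- Either the Bézout computation for `w` and its cofactor succeeds, with gcd `1` by radicality, and
lifting applies; or it reports one fixed zero-divisor of smaller main variable at all large primes,
and the induction takes over. Nested handling only raises the bound, so a threshold for the inner
factor also serves the outer call. -/
theorem handleZeroDivisor_eventually (hT : IsMonicTriangular T) (hrad : (triIdeal T n).IsRadical)
    (j : Fin n) : ∀ w : (TriQuot T j)[X], IsLevelFactor T j w → ∃ H, ∀ᶠ p in largePrimes,
      ∀ (m : ℕ) (B : Option ℕ), j.val < m → H ≤ nextBound B →
        ∃ x, (handleZeroDivisor p T m B (redZeroDivisor p T j w)).1 = some x := by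
  obtain ⟨k, hk⟩ : ∃ k, k = j.val := ⟨_, rfl⟩
  induction k using Nat.strong_induction_on generalizing j with
  | _ k IH =>
  subst hk
  intro w hw
  have hv := divByMonic_mem_liftsRing _ (levelPoly_mem_lowPolys hT j) hw.mem hw.monic
  have hproj : ∀ᶠ p in largePrimes,
      projPoly (triMod p T) j.val (repPoly (triMod p T) j (redPoly p T j w)) =
        redPoly p T j w := by
    filter_upwards [eventually_isTriIntegralAt T] with p ⟨_, h⟩
    exact projPoly_repPoly (hT.triMod h) _
  rcases monicEuclid_eventually hT j.isLt.le (invLevel_eventually hT j j.isLt.le) hw.mem hv with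
    ⟨g, s, t, hE, hbez⟩ | ⟨l, w', hw', hl, hE⟩
  · have hg := bezoutGCD_cofactor_eq_one hT hrad j hw hbez
    subst hg
    obtain ⟨H, hH⟩ := henselLift_eventually hT j hw hE
    refine ⟨H, ?_⟩
    filter_upwards [hH, hproj] with p h1 h2 m B hm hB
    obtain ⟨m, rfl⟩ := Nat.exists_eq_succ_of_ne_zero (by omega : m ≠ 0)
    obtain ⟨⟨u, v⟩, hx⟩ := h1 _ hB
    rw [redZeroDivisor, handleZeroDivisor_succ, h2, hx]
    exact ⟨_, rfl⟩
  · obtain ⟨H, hH⟩ := IH l.val hl l rfl w' hw'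
    refine ⟨H, ?_⟩
    filter_upwards [hH, hproj, hE, eventually_redPoly_divByMonic hT (levelPoly T j) hw.monic,
      eventually_redPoly_levelPoly hT j] with p h1 h2 h3 h4 h5 m B hm hB
    obtain ⟨m, rfl⟩ := Nat.exists_eq_succ_of_ne_zero (by omega : m ≠ 0)
    rw [h4, h5] at h3
    rw [redZeroDivisor, handleZeroDivisor_succ, h2, henselLift, h3]
    exact h1 m _ (by omega) (hB.trans (le_nextBound_some _))

end Handle

end

/-! ### Splitting a triangular set -/

noncomputable section

variable {n : ℕ}

section Eval

variable {k : Type} [CommRing k] {T : Fin n → MvPolynomial (Fin n) k}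

theorem eval_projPoly (T : Fin n → MvPolynomial (Fin n) k) (i : ℕ) (j : Fin n)
    (F : (MvPolynomial (Fin n) k)[X]) :
    (projPoly T i F).eval (Ideal.Quotient.mk _ (MvPolynomial.X j)) =
      Ideal.Quotient.mk _ (unviewAt j F) := by
  rw [projPoly, coe_mapRingHom, eval_map_apply, unviewAt]

theorem mk_eq_eval_levelPoly (T : Fin n → MvPolynomial (Fin n) k) (j : Fin n) :
    Ideal.Quotient.mk (triIdeal T j) (T j) =
      (levelPoly T j).eval (Ideal.Quotient.mk _ (MvPolynomial.X j)) := by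
  rw [levelPoly, eval_projPoly, unviewAt_viewAt]

theorem mk_unviewAt_repPoly [Nontrivial k] (hT : IsMonicTriangular T) {i : ℕ} (j : Fin n)
    (f : (TriQuot T i)[X]) : Ideal.Quotient.mk (triIdeal T i) (unviewAt j (repPoly T i f)) =
      f.eval (Ideal.Quotient.mk _ (MvPolynomial.X j)) := by
  rw [← eval_projPoly, projPoly_repPoly hT]

/-- The normal form of a monic element of main variable `z_i` with respect to the smaller
variables can be computed coefficientwise. -/
theorem viewAt_normalForm [Nontrivial k] (hT : IsMonicTriangular T) (i : Fin n)
    {f : MvPolynomial (Fin n) k} (hf : f ∈ lowVars k n (i + 1)) :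
    viewAt i (normalForm T i (Ideal.Quotient.mk _ f)) =
      repPoly T i (projPoly T i (viewAt i f)) := by
  have hlow : projPoly T i (viewAt i f) ∈ lowPolys T i :=
    projPoly_mem_lowPolys fun d => coeff_viewAt_mem_lowVars hf d
  have h1 : normalForm T i (Ideal.Quotient.mk _ f) =
      unviewAt i (repPoly T i (projPoly T i (viewAt i f))) := by
    apply normalForm_eq hT
    · intro l hl
      have hli : l ≠ i := fun h => by subst h; exact lt_irrefl _ hl
      refine lt_of_le_of_lt (degreeOf_unviewAt_le hli (N := (T l).degreeOf l - 1) fun d => ?_)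
        (by have := hT.mainVar l; omega)
      have := isReducedWrt_coeff_repPoly hT (projPoly T i (viewAt i f)) d l hl
      omega
    · rw [mk_unviewAt_repPoly hT, eval_projPoly, unviewAt_viewAt]
  rw [h1, viewAt_unviewAt_repPoly hT i hlow]

end Eval

section Ideals

/-- If `x = a + uc = b + vd` with `a, b ∈ I`, then `x^2` is congruent to `uvcd` modulo `I` and so
lies in `I`. -/
theorem Ideal.inf_sup_span_of_mul_mem {A : Type} [CommRing A] {I : Ideal A} (hI : I.IsRadical)
    {u v : A} (huv : u * v ∈ I) :
    (I ⊔ Ideal.span {u}) ⊓ (I ⊔ Ideal.span {v}) = I := by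
  apply le_antisymm
  · rintro x ⟨hx, hx'⟩
    obtain ⟨a, ha, y, hy, rfl⟩ := Submodule.mem_sup.1 hx
    obtain ⟨b, hb, z, hz, hab⟩ := Submodule.mem_sup.1 hx'
    obtain ⟨c, rfl⟩ := Ideal.mem_span_singleton.1 hy
    obtain ⟨d, rfl⟩ := Ideal.mem_span_singleton.1 hz
    refine hI ⟨2, ?_⟩
    have : (a + u * c) ^ 2 = a * (a + u * c) + b * (u * c) + (c * d) * (u * v) := by
      rw [sq]; nth_rewrite 2 [← hab]
      linear_combination a * hab
    rw [this]
    exact I.add_mem (I.add_mem (I.mul_mem_right _ ha) (I.mul_mem_right _ hb))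
      (I.mul_mem_left _ huv)
  · exact le_inf le_sup_left le_sup_left

/-- Write `1 = a + b` with `a ∈ I`, `b ∈ J`. If a power of `x` lies in `I`, then a power of `xb`
lies in `I ∩ J`, so `xb` does, and `x = xa + xb`. -/
theorem Ideal.isRadical_of_isCoprime {A : Type} [CommRing A] {I J : Ideal A}
    (h : IsCoprime I J) (hr : (I ⊓ J).IsRadical) : I.IsRadical := by
  rintro x ⟨m, hx⟩
  obtain ⟨a, ha, b, hb, hab⟩ := Ideal.isCoprime_iff_exists.1 h
  have h1 : x * b ∈ I ⊓ J := by
    rcases Nat.eq_zero_or_pos m with rfl | hm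
    · rw [pow_zero] at hx
      exact ⟨(Ideal.eq_top_iff_one I).2 hx ▸ Submodule.mem_top, J.mul_mem_left _ hb⟩
    · refine hr ⟨m, ?_⟩
      rw [mul_pow]
      exact ⟨I.mul_mem_right _ hx, J.mul_mem_left _ (J.pow_mem_of_mem hb m hm)⟩
  have h2 : x = x * a + x * b := by rw [← mul_add, hab, mul_one]
  rw [h2]
  exact I.add_mem (I.mul_mem_left _ ha) h1.1

/-- The injection of `A/I` into the product is onto by dimension, and a preimage of `(1, 0)`
separates the two ideals. -/
theorem Ideal.isCoprime_of_finrank {k A : Type} [Field k] [CommRing A] [Algebra k A]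
    {I I₁ I₂ : Ideal A} (h : I₁ ⊓ I₂ = I) [Module.Finite k (A ⧸ I)] [Module.Finite k (A ⧸ I₁)]
    [Module.Finite k (A ⧸ I₂)]
    (hd : Module.finrank k (A ⧸ I) = Module.finrank k (A ⧸ I₁) + Module.finrank k (A ⧸ I₂)) :
    IsCoprime I₁ I₂ := by
  have h1 : I ≤ I₁ := h ▸ inf_le_left
  have h2 : I ≤ I₂ := h ▸ inf_le_right
  set f : (A ⧸ I) →ₗ[k] (A ⧸ I₁) × (A ⧸ I₂) :=
    (Ideal.Quotient.factorₐ k h1).toLinearMap.prod (Ideal.Quotient.factorₐ k h2).toLinearMap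
    with hf
  have hinj : Function.Injective f := by
    rw [injective_iff_map_eq_zero]
    intro x hx
    obtain ⟨x, rfl⟩ := Ideal.Quotient.mk_surjective x
    have hx1 : Ideal.Quotient.mk I₁ x = 0 := congrArg Prod.fst hx
    have hx2 : Ideal.Quotient.mk I₂ x = 0 := congrArg Prod.snd hx
    rw [Ideal.Quotient.eq_zero_iff_mem] at hx1 hx2 ⊢
    exact h ▸ ⟨hx1, hx2⟩
  have hsurj : Function.Surjective f :=
    (LinearMap.injective_iff_surjective_of_finrank_eq_finrank
      (by rw [hd, Module.finrank_prod])).1 hinj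
  obtain ⟨x, hx⟩ := hsurj (1, 0)
  obtain ⟨x, rfl⟩ := Ideal.Quotient.mk_surjective x
  have hx1 : Ideal.Quotient.mk I₁ x = 1 := congrArg Prod.fst hx
  have hx2 : Ideal.Quotient.mk I₂ x = 0 := congrArg Prod.snd hx
  rw [Ideal.isCoprime_iff_exists]
  refine ⟨1 - x, ?_, x, Ideal.Quotient.eq_zero_iff_mem.1 hx2, by ring⟩
  rw [← Ideal.Quotient.eq_zero_iff_mem, map_sub, hx1, map_one, sub_self]

end Ideals

section Split

variable {T : Fin n → MvPolynomial (Fin n) ℚ} {j : Fin n} {α : (TriQuot T j.val)[X]}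

theorem unviewAt_repPoly_mem_lowVars (hT : IsMonicTriangular T) (hα : α ∈ lowPolys T j) :
    unviewAt j (repPoly T j α) ∈ lowVars ℚ n (j + 1) :=
  unviewAt_mem_lowVars (coeff_repPoly_mem_lowVars hT hα)

theorem degreeOf_unviewAt_repPoly (hT : IsMonicTriangular T) (hα : α ∈ lowPolys T j) :
    (unviewAt j (repPoly T j α)).degreeOf j = α.natDegree := by
  rw [degreeOf_unviewAt_self_le (degreeOf_coeff_repPoly hT j hα), natDegree_repPoly hT]

theorem IsMonicTriangular.update (hT : IsMonicTriangular T) (hα : IsLevelFactor T j α) :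
    IsMonicTriangular (Function.update T j (unviewAt j (repPoly T j α))) where
  noLarger i l hil := by
    by_cases hij : i = j
    · subst hij
      rw [Function.update_self]
      exact _root_.mem_lowVars.1 (unviewAt_repPoly_mem_lowVars hT hα.mem) l hil
    · rw [Function.update_of_ne hij]
      exact hT.noLarger i l hil
  mainVar i := by
    by_cases hij : i = j
    · subst hij
      rw [Function.update_self, degreeOf_unviewAt_repPoly hT hα.mem]
      exact hα.pos
    · rw [Function.update_of_ne hij]
      exact hT.mainVar i
  monic i := by
    by_cases hij : i = j
    · subst hij
      rw [Function.update_self, viewAt_unviewAt_repPoly hT i hα.mem]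
      exact repPoly_monic hT hα.monic
    · rw [Function.update_of_ne hij]
      exact hT.monic i

theorem splitAt_of_le {u : (MvPolynomial (Fin n) ℚ)[X]} {i : Fin n} (hi : i ≤ j) :
    splitAt T j u i = Function.update T j (unviewAt j u) i := if_pos hi

theorem splitAt_of_lt {u : (MvPolynomial (Fin n) ℚ)[X]} {i : Fin n} (hi : j < i) :
    splitAt T j u i =
      normalForm (Function.update T j (unviewAt j u)) i.val (Ideal.Quotient.mk _ (T i)) :=
  if_neg (not_le.2 hi)

theorem degreeOf_splitAt (hT : IsMonicTriangular T) (hα : IsLevelFactor T j α) (i : Fin n) :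
    (splitAt T j (repPoly T j α) i).degreeOf i =
      Function.update (fun l => (T l).degreeOf l) j α.natDegree i := by
  have hU := hT.update hα
  rcases lt_trichotomy i j with h | rfl | h
  · rw [splitAt_of_le h.le, Function.update_of_ne h.ne, Function.update_of_ne h.ne]
  · rw [splitAt_of_le le_rfl, Function.update_self, Function.update_self,
      degreeOf_unviewAt_repPoly hT hα.mem]
  · have hnt := hU.nontrivial_triQuot i.val
    rw [splitAt_of_lt h, Function.update_of_ne h.ne', ← natDegree_viewAt,
      viewAt_normalForm hU i (hT.mem_lowVars i), natDegree_repPoly hU, projPoly, coe_mapRingHom,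
      (hT.monic i).natDegree_map, natDegree_viewAt]

theorem isTriangularSet_splitAt (hT : IsTriangularSet T) (hα : IsLevelFactor T j α) :
    IsTriangularSet (splitAt T j (repPoly T j α)) := by
  have hM := hT.toIsMonicTriangular
  have hU := hM.update hα
  have hdeg : ∀ l, (splitAt T j (repPoly T j α) l).degreeOf l =
      (Function.update T j (unviewAt j (repPoly T j α)) l).degreeOf l := fun l => by
    rw [degreeOf_splitAt hM hα]
    by_cases hl : l = j
    · subst hl
      rw [Function.update_self, Function.update_self, degreeOf_unviewAt_repPoly hM hα.mem]
    · rw [Function.update_of_ne hl, Function.update_of_ne hl]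
  refine ⟨fun i l hil => ?_, fun i => ?_, fun i => ?_, fun i l hli => ?_⟩
  · rcases le_or_gt i j with h | h
    · rw [splitAt_of_le h]
      exact hU.noLarger i l hil
    · rw [splitAt_of_lt h]
      exact mem_lowVars.1 (normalForm_mem_supported hU (s := {l : Fin n | l.val < i.val + 1})
        (fun l hl => Nat.lt_succ_of_lt hl) (hM.mem_lowVars i)) l hil
  · rw [hdeg]
    exact hU.mainVar i
  · rcases le_or_gt i j with h | h
    · rw [splitAt_of_le h]
      exact hU.monic i
    · rw [splitAt_of_lt h, viewAt_normalForm hU i (hM.mem_lowVars i)]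
      exact repPoly_monic hU ((hM.monic i).map _)
  · rw [hdeg]
    rcases lt_trichotomy i j with h | rfl | h
    · rw [splitAt_of_le h.le, Function.update_of_ne h.ne, Function.update_of_ne (hli.trans h).ne]
      exact hT.reduced i l hli
    · rw [splitAt_of_le le_rfl, Function.update_self, Function.update_of_ne hli.ne]
      exact isReducedWrt_unviewAt_repPoly hM i hα.mem hα.lt i l hli
    · rw [splitAt_of_lt h]
      exact isReducedWrt_normalForm hU _ l hli

/-- Reducing `t_i` modulo earlier elements does not change the ideal. Ideals can thus be computed
with the plain replacement of `t_j`, which is monic triangular but possibly not reduced. -/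
theorem triIdeal_splitAt_eq_update (hT : IsMonicTriangular T) (hα : IsLevelFactor T j α) (i : ℕ)
    (hi : i ≤ n) : triIdeal (splitAt T j (repPoly T j α)) i =
      triIdeal (Function.update T j (unviewAt j (repPoly T j α))) i := by
  have hU := hT.update hα
  induction i with
  | zero => simp [triIdeal]
  | succ i IH =>
    have hin : i < n := hi
    rw [triIdeal_succ _ hin, triIdeal_succ _ hin, IH hin.le]
    rcases le_or_gt (⟨i, hin⟩ : Fin n) j with h | h
    · rw [splitAt_of_le h]
    · rw [splitAt_of_lt h, Function.update_of_ne h.ne']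
      set r := normalForm (Function.update T j (unviewAt j (repPoly T j α))) i
        (Ideal.Quotient.mk _ (T ⟨i, hin⟩)) with hr
      set I := triIdeal (Function.update T j (unviewAt j (repPoly T j α))) i
      have hmem : r - T ⟨i, hin⟩ ∈ I := Ideal.Quotient.eq.1 (mk_normalForm hU _)
      apply le_antisymm
      · refine sup_le le_sup_left ((Ideal.span_singleton_le_iff_mem _).2 ?_)
        rw [← sub_add_cancel r (T ⟨i, hin⟩)]
        exact Submodule.add_mem_sup hmem (Ideal.mem_span_singleton_self _)
      · refine sup_le le_sup_left ((Ideal.span_singleton_le_iff_mem _).2 ?_)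
        rw [← sub_sub_cancel r (T ⟨i, hin⟩), sub_eq_neg_add]
        exact Submodule.add_mem_sup (I.neg_mem hmem) (Ideal.mem_span_singleton_self _)

/-- A factorization of `t_j` modulo the smaller variables. -/
theorem sub_mul_mem_triIdeal (hT : IsMonicTriangular T) {β : (TriQuot T j.val)[X]}
    (h : levelPoly T j = α * β) :
    T j - unviewAt j (repPoly T j α) * unviewAt j (repPoly T j β) ∈ triIdeal T j := by
  rw [← Ideal.Quotient.eq_zero_iff_mem, map_sub, map_mul, mk_unviewAt_repPoly hT,
    mk_unviewAt_repPoly hT, mk_eq_eval_levelPoly, h, eval_mul, sub_self]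

/-- Modulo the smaller elements `t_j` is a multiple of the factor, so it becomes redundant once the
factor is adjoined. -/
theorem triIdeal_splitAt (hT : IsMonicTriangular T) (hα : IsLevelFactor T j α) :
    triIdeal (splitAt T j (repPoly T j α)) n =
      triIdeal T n ⊔ Ideal.span {unviewAt j (repPoly T j α)} := by
  rw [triIdeal_splitAt_eq_update hT hα n le_rfl]
  set u := unviewAt j (repPoly T j α) with hu
  obtain ⟨β, hβ⟩ := hα.dvd
  have hsub := sub_mul_mem_triIdeal hT hβ
  rw [← hu] at hsub
  have hlow : triIdeal T j ≤ triIdeal (Function.update T j u) n := by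
    refine Ideal.span_le.2 ?_
    rintro _ ⟨l, hl, rfl⟩
    have hlj : l ≠ j := fun h => by subst h; exact (lt_irrefl l.val) hl
    rw [← Function.update_of_ne hlj u T]
    exact IsMonicTriangular.mem_triIdeal _ l.isLt
  have huU : u ∈ triIdeal (Function.update T j u) n := by
    have := IsMonicTriangular.mem_triIdeal (Function.update T j u) j.isLt
    rwa [Function.update_self] at this
  apply le_antisymm
  · refine Ideal.span_le.2 ?_
    rintro _ ⟨l, hl, rfl⟩
    by_cases hlj : l = j
    · subst hlj
      rw [Function.update_self]
      exact Submodule.mem_sup_right (Ideal.mem_span_singleton_self _)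
    · rw [Function.update_of_ne hlj]
      exact Submodule.mem_sup_left (IsMonicTriangular.mem_triIdeal T hl)
  · refine sup_le (Ideal.span_le.2 ?_) ((Ideal.span_singleton_le_iff_mem _).2 huU)
    rintro _ ⟨l, hl, rfl⟩
    by_cases hlj : l = j
    · subst hlj
      rw [SetLike.mem_coe, ← sub_add_cancel (T l) (u * unviewAt l (repPoly T l β))]
      exact Ideal.add_mem _ (hlow hsub) (Ideal.mul_mem_right _ _ huU)
    · rw [← Function.update_of_ne hlj u T]
      exact IsMonicTriangular.mem_triIdeal _ hl

theorem IsLevelFactor.cofactor (hT : IsMonicTriangular T) (hα : IsLevelFactor T j α) :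
    IsLevelFactor T j (levelPoly T j /ₘ α) := by
  have hnt := hT.nontrivial_triQuot j.val
  have h := mul_divByMonic_of_dvd hα.monic hα.dvd
  have hm : (levelPoly T j /ₘ α).Monic :=
    hα.monic.of_mul_monic_left (h.symm ▸ levelPoly_monic hT j)
  have hd := congrArg natDegree h
  rw [hα.monic.natDegree_mul hm, natDegree_levelPoly hT] at hd
  have := hα.pos
  have := hα.lt
  exact ⟨divByMonic_mem_liftsRing _ (levelPoly_mem_lowPolys hT j) hα.mem hα.monic, hm,
    Dvd.intro_left _ h, by omega, by omega⟩

theorem inf_triIdeal_splitAt (hT : IsMonicTriangular T) (hrad : (triIdeal T n).IsRadical)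
    (hα : IsLevelFactor T j α) :
    triIdeal (splitAt T j (repPoly T j α)) n ⊓
      triIdeal (splitAt T j (repPoly T j (levelPoly T j /ₘ α))) n = triIdeal T n := by
  rw [triIdeal_splitAt hT hα, triIdeal_splitAt hT (hα.cofactor hT)]
  apply Ideal.inf_sup_span_of_mul_mem hrad
  have h1 := sub_mul_mem_triIdeal hT (mul_divByMonic_of_dvd hα.monic hα.dvd).symm
  rw [← sub_sub_cancel (T j) (_ * _)]
  exact Ideal.sub_mem _ (IsMonicTriangular.mem_triIdeal T j.isLt) (triIdeal_mono T j.isLt.le h1)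

/-- The three dimensions are products of main degrees that differ only at `j`, where `deg t_j` is
the sum of the degrees of the two factors. No Bézout relation between the factors is needed. -/
theorem isCoprime_triIdeal_splitAt (hT : IsTriangularSet T) (hrad : (triIdeal T n).IsRadical)
    (hα : IsLevelFactor T j α) :
    IsCoprime (triIdeal (splitAt T j (repPoly T j α)) n)
      (triIdeal (splitAt T j (repPoly T j (levelPoly T j /ₘ α))) n) := by
  have hM := hT.toIsMonicTriangular
  have hβ := hα.cofactor hM
  have hM₁ := (isTriangularSet_splitAt hT hα).toIsMonicTriangular
  have hM₂ := (isTriangularSet_splitAt hT hβ).toIsMonicTriangular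
  have h1 := finite_triQuot hM
  have h2 := finite_triQuot hM₁
  have h3 := finite_triQuot hM₂
  have hnt := hM.nontrivial_triQuot j.val
  refine Ideal.isCoprime_of_finrank (k := ℚ) (inf_triIdeal_splitAt hM hrad hα) ?_
  have e1 := finrank_triQuot hM
  have e2 := finrank_triQuot hM₁
  have e3 := finrank_triQuot hM₂
  rw [e1, e2, e3]
  simp only [degreeOf_splitAt hM hα, degreeOf_splitAt hM hβ]
  rw [Finset.prod_update_of_mem (Finset.mem_univ j), Finset.prod_update_of_mem (Finset.mem_univ j),
    ← Finset.prod_sdiff (Finset.subset_univ {j}), Finset.prod_singleton, ← add_mul, mul_comm]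
  congr 1
  have h := mul_divByMonic_of_dvd hα.monic hα.dvd
  rw [← natDegree_levelPoly hM]
  conv_lhs => rw [← h]
  exact hα.monic.natDegree_mul hβ.monic

theorem isRadical_triIdeal_splitAt (hT : IsTriangularSet T) (hrad : (triIdeal T n).IsRadical)
    (hα : IsLevelFactor T j α) :
    (triIdeal (splitAt T j (repPoly T j α)) n).IsRadical ∧
      (triIdeal (splitAt T j (repPoly T j (levelPoly T j /ₘ α))) n).IsRadical := by
  have h := isCoprime_triIdeal_splitAt hT hrad hα
  have hinf := inf_triIdeal_splitAt hT.toIsMonicTriangular hrad hα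
  exact ⟨Ideal.isRadical_of_isCoprime h (hinf.symm ▸ hrad),
    Ideal.isRadical_of_isCoprime h.symm (by rw [inf_comm, hinf]; exact hrad)⟩

theorem sum_degreeOf_splitAt_lt (hT : IsMonicTriangular T) (hα : IsLevelFactor T j α) :
    ∑ l, (splitAt T j (repPoly T j α) l).degreeOf l < ∑ l, (T l).degreeOf l := by
  refine Finset.sum_lt_sum (fun l _ => ?_) ⟨j, Finset.mem_univ j, ?_⟩
  · rw [degreeOf_splitAt hT hα]
    by_cases hl : l = j
    · subst hl
      rw [Function.update_self]
      exact hα.lt.le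
    · rw [Function.update_of_ne hl]
  · rw [degreeOf_splitAt hT hα, Function.update_self]
    exact hα.lt

end Split

end

/-! ### One iteration of the main loop -/

noncomputable section

variable {n : ℕ}

/-- What one iteration of the main loop leads to. -/
inductive LoopStep (n : ℕ) : Type
  /-- go on to the next prime -/
  | next (dg M : ℕ) (G : (MvPolynomial (Fin n) ℤ)[X]) (B : Option ℕ)
  /-- return a result -/
  | done (h : (MvPolynomial (Fin n) ℚ)[X])
  /-- split the triangular set -/
  | split (j : Fin n) (u v : (MvPolynomial (Fin n) ℚ)[X]) (B : Option ℕ)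

/-- The iteration in which a zero-divisor is met. -/
def zeroDivisorStep (p : ℕ) (T : Fin n → MvPolynomial (Fin n) ℚ) (dg M : ℕ)
    (G : (MvPolynomial (Fin n) ℤ)[X]) (B : Option ℕ) (w : ZeroDivisor n p) : LoopStep n :=
  match handleZeroDivisor p T n B w with
  | (none, B') => .next dg M G B'
  | (some (j, u, v), B') => .split j u v B'

/-- The combined image. -/
def combine (p : ℕ) (T : Fin n → MvPolynomial (Fin n) ℚ) (dg M : ℕ)
    (G : (MvPolynomial (Fin n) ℤ)[X]) (g : (TriQuot (triMod p T) n)[X]) :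
    (MvPolynomial (Fin n) ℤ)[X] :=
  if g.natDegree = dg then crtPoly M p G (liftInt p (repPoly (triMod p T) n g))
  else liftInt p (repPoly (triMod p T) n g)

open Classical in
/-- The iteration in which a modular image is met. -/
def imageStep (p : ℕ) (T : Fin n → MvPolynomial (Fin n) ℚ) (a b : (MvPolynomial (Fin n) ℚ)[X])
    (dg M : ℕ) (G : (MvPolynomial (Fin n) ℤ)[X]) (B : Option ℕ)
    (g : (TriQuot (triMod p T) n)[X]) : LoopStep n :=
  if dg < g.natDegree then .next dg M G B else
    match (ratReconPoly (if g.natDegree = dg then M * p else p) (combine p T dg M G g)).filter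
      (fun h => decide (projPoly T n h ∣ projPoly T n a ∧ projPoly T n h ∣ projPoly T n b)) with
    | some h => .done h
    | none => .next g.natDegree (if g.natDegree = dg then M * p else p) (combine p T dg M G g) B

/-- The Euclidean algorithm modulo `p`. -/
def euclidMod (p : ℕ) (T : Fin n → MvPolynomial (Fin n) ℚ) (a b : (MvPolynomial (Fin n) ℚ)[X]) :
    Except (ZeroDivisor n p) ((TriQuot (triMod p T) n)[X] × (TriQuot (triMod p T) n)[X] ×
      (TriQuot (triMod p T) n)[X]) :=
  monicEuclid (invLevel p (triMod p T) n)
    (projPoly (triMod p T) n (mapCoeffsPoly (ratMod p) a))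
    (projPoly (triMod p T) n (mapCoeffsPoly (ratMod p) b))

open Classical in
/-- One iteration of the main loop. -/
def loopStep (p : ℕ) (T : Fin n → MvPolynomial (Fin n) ℚ) (a b : (MvPolynomial (Fin n) ℚ)[X])
    (dg M : ℕ) (G : (MvPolynomial (Fin n) ℤ)[X]) (B : Option ℕ) : LoopStep n :=
  if IsBadPrime p T a b then .next dg M G B else
    match isRadicalPrime p (triMod p T) n with
    | .error w => zeroDivisorStep p T dg M G B w
    | .ok false => .next dg M G B
    | .ok true =>
      match euclidMod p T a b with
      | .error w => zeroDivisorStep p T dg M G B w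
      | .ok (g, _, _) => imageStep p T a b dg M G B g

/-- A recursive call. -/
def mainCall (P : (Fin n → MvPolynomial (Fin n) ℚ) → ℕ → ℕ) (m : ℕ)
    (S : Fin n → MvPolynomial (Fin n) ℚ) (a b : (MvPolynomial (Fin n) ℚ)[X]) (B : Option ℕ) :
    Option (CGCDOutput n × Option ℕ) :=
  mainLoop P m S (prepareInput S a b).1 (prepareInput S a b).2 0 (initDegree (prepareInput S a b))
    1 0 B

/-- The two recursive calls after a splitting. -/
def splitCall (P : (Fin n → MvPolynomial (Fin n) ℚ) → ℕ → ℕ) (m : ℕ)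
    (T : Fin n → MvPolynomial (Fin n) ℚ) (a b : (MvPolynomial (Fin n) ℚ)[X])
    (j : Fin n) (u v : (MvPolynomial (Fin n) ℚ)[X]) (B : Option ℕ) :
    Option (CGCDOutput n × Option ℕ) :=
  match mainCall P m (splitAt T j u) a b B with
  | none => none
  | some (out₁, B₁) =>
    match mainCall P m (splitAt T j v) a b B₁ with
    | none => none
    | some (out₂, B₂) => some (out₁ ++ out₂, B₂)

/-- The continuation of the main loop after an iteration. -/
def afterStep (P : (Fin n → MvPolynomial (Fin n) ℚ) → ℕ → ℕ) (m : ℕ)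
    (T : Fin n → MvPolynomial (Fin n) ℚ) (a b : (MvPolynomial (Fin n) ℚ)[X]) (idx : ℕ)
    (B : Option ℕ) : LoopStep n → Option (CGCDOutput n × Option ℕ)
  | .next dg M G B' => mainLoop P m T a b (idx + 1) dg M G B'
  | .done h => some ([(T, h)], B)
  | .split j u v B' => splitCall P m T a b j u v B'

/-- This separates the recursion from `loopStep`, which depends on the prime and the state only and
is what the invariants and the analysis at large primes are about. -/
theorem mainLoop_succ (P : (Fin n → MvPolynomial (Fin n) ℚ) → ℕ → ℕ) (m : ℕ)
    (T : Fin n → MvPolynomial (Fin n) ℚ) (a b : (MvPolynomial (Fin n) ℚ)[X]) (idx dg M : ℕ)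
    (G : (MvPolynomial (Fin n) ℤ)[X]) (B : Option ℕ) :
    mainLoop P (m + 1) T a b idx dg M G B =
      afterStep P m T a b idx B (loopStep (P T idx) T a b dg M G B) := by
  have hzd : ∀ w : ZeroDivisor n (P T idx),
      (match handleZeroDivisor (P T idx) T n B w with
        | (none, B') => mainLoop P m T a b (idx + 1) dg M G B'
        | (some (j, u, v), B') =>
          match mainCall P m (splitAt T j u) a b B' with
          | none => none
          | some (out₁, B₁) =>
            match mainCall P m (splitAt T j v) a b B₁ with
            | none => none
            | some (out₂, B₂) => some (out₁ ++ out₂, B₂)) =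
        afterStep P m T a b idx B (zeroDivisorStep (P T idx) T dg M G B w) := by
    intro w
    rw [zeroDivisorStep]
    rcases handleZeroDivisor (P T idx) T n B w with ⟨_ | ⟨j, u, v⟩, B'⟩ <;> rfl
  have hopt : ∀ (o : Option (MvPolynomial (Fin n) ℚ)[X]) (dg' M' : ℕ)
      (G' : (MvPolynomial (Fin n) ℤ)[X]),
      (match o with
        | some h => some ([(T, h)], B)
        | none => mainLoop P m T a b (idx + 1) dg' M' G' B) =
      afterStep P m T a b idx B (match o with
        | some h => .done h
        | none => .next dg' M' G' B) := by
    rintro (_ | h) dg' M' G' <;> rfl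
  rw [mainLoop, loopStep]
  by_cases hbad : IsBadPrime (P T idx) T a b
  · rw [if_pos hbad, if_pos hbad]
    rfl
  rw [if_neg hbad, if_neg hbad]
  rcases hr : isRadicalPrime (P T idx) (triMod (P T idx) T) n with w | (_ | _)
  · exact hzd w
  · rfl
  · simp only
    rw [← euclidMod]
    rcases euclidMod (P T idx) T a b with w | ⟨g, s, t⟩
    · exact hzd w
    · simp only
      rw [imageStep, combine]
      split_ifs with h1 h2
      · rfl
      · exact hopt _ _ _ _
      · exact hopt _ _ _ _

/-! ### Congruences -/

theorem crt_left {m p : ℕ} (h : m.Coprime p) (c d : ℤ) :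
    (p : ℤ) * Nat.gcdB m p * c + (m : ℤ) * Nat.gcdA m p * d ≡ c [ZMOD m] := by
  have h1 := Nat.gcd_eq_gcd_ab m p
  rw [h, Nat.cast_one] at h1
  rw [Int.modEq_iff_dvd]
  exact ⟨Nat.gcdA m p * (c - d), by linear_combination c * h1⟩

theorem crt_right {m p : ℕ} (h : m.Coprime p) (c d : ℤ) :
    (p : ℤ) * Nat.gcdB m p * c + (m : ℤ) * Nat.gcdA m p * d ≡ d [ZMOD p] := by
  have h1 := Nat.gcd_eq_gcd_ab m p
  rw [h, Nat.cast_one] at h1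
  rw [Int.modEq_iff_dvd]
  exact ⟨Nat.gcdB m p * (d - c), by linear_combination d * h1⟩

theorem coeff_coeff_crtPoly (m p : ℕ) (G g : (MvPolynomial (Fin n) ℤ)[X]) (d : ℕ)
    (e : Fin n →₀ ℕ) : ((crtPoly m p G g).coeff d).coeff e =
      (p : ℤ) * Nat.gcdB m p * (G.coeff d).coeff e +
        (m : ℤ) * Nat.gcdA m p * (g.coeff d).coeff e := by
  rw [crtPoly, coeff_add, coeff_smul, coeff_smul, MvPolynomial.coeff_add, MvPolynomial.coeff_smul,
    MvPolynomial.coeff_smul, smul_eq_mul, smul_eq_mul]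

theorem IsRatRecon.of_modEq {m : ℕ} {c c' : ℤ} {q : ℚ} (h : IsRatRecon m c q)
    (hc : c ≡ c' [ZMOD m]) : IsRatRecon m c' q :=
  ⟨h.1, h.2.1, h.2.2.1, h.2.2.2.trans (hc.mul_right _)⟩

/-- `G` is monic of degree `d` modulo `m`. -/
def IsMonicMod (m d : ℕ) (G : (MvPolynomial (Fin n) ℤ)[X]) : Prop :=
  ∀ e, (G.coeff d).coeff e ≡ (1 : MvPolynomial (Fin n) ℤ).coeff e [ZMOD m] ∧
    ∀ d', d < d' → (G.coeff d').coeff e ≡ 0 [ZMOD m]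

/-- Congruences modulo `1` are void, so the initial values `M = 1`, `G = 0` satisfy the invariant
for every `dg`. -/
theorem isMonicMod_one (d : ℕ) (G : (MvPolynomial (Fin n) ℤ)[X]) : IsMonicMod 1 d G := fun _ =>
  ⟨by rw [Nat.cast_one]; exact Int.modEq_one, fun _ _ => by rw [Nat.cast_one]; exact Int.modEq_one⟩

theorem IsBoundedMonic.isMonicMod {D : Fin n → ℕ} {i d : ℕ} {G : (MvPolynomial (Fin n) ℤ)[X]}
    (h : IsBoundedMonic D i d G) (m : ℕ) : IsMonicMod m d G := fun _ =>
  ⟨by rw [h.lead], fun d' hd' => by rw [h.top d' hd', MvPolynomial.coeff_zero]⟩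

theorem IsMonicMod.crtPoly {m p d : ℕ} {G g : (MvPolynomial (Fin n) ℤ)[X]} (h : m.Coprime p)
    (hG : IsMonicMod m d G) (hg : IsMonicMod p d g) : IsMonicMod (m * p) d (crtPoly m p G g) := by
  have hmp : (m : ℤ).natAbs.Coprime (p : ℤ).natAbs := by simpa using h
  intro e
  rw [Nat.cast_mul]
  refine ⟨?_, fun d' hd' => ?_⟩
  · rw [coeff_coeff_crtPoly, ← Int.modEq_and_modEq_iff_modEq_mul hmp]
    exact ⟨(crt_left h _ _).trans (hG e).1, (crt_right h _ _).trans (hg e).1⟩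
  · rw [coeff_coeff_crtPoly, ← Int.modEq_and_modEq_iff_modEq_mul hmp]
    exact ⟨(crt_left h _ _).trans ((hG e).2 d' hd'), (crt_right h _ _).trans ((hg e).2 d' hd')⟩

/-- Coefficients congruent to `0` or `1` reconstruct to exactly these numbers. The condition `1 < m`
prevents a stored coefficient `0` from counting as congruent to `1`. -/
theorem IsMonicMod.of_ratReconPoly {m d : ℕ} {G : (MvPolynomial (Fin n) ℤ)[X]} (hm : 1 < m)
    (hG : IsMonicMod m d G) {h : (MvPolynomial (Fin n) ℚ)[X]} (hh : ratReconPoly m G = some h) :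
    h.coeff d = 1 ∧ ∀ d', d < d' → h.coeff d' = 0 := by
  classical
  have hzero : ∀ d' e, (G.coeff d').coeff e ≡ 0 [ZMOD m] → (h.coeff d').coeff e = 0 := by
    intro d' e h0
    by_cases hc : (G.coeff d').coeff e = 0
    · exact (ratReconPoly_spec hh d' e).1 hc
    · exact isRatRecon_zero (((ratReconPoly_spec hh d' e).2 hc).of_modEq h0)
  constructor
  · ext e
    have h1 := (hG e).1
    rw [MvPolynomial.coeff_one] at h1 ⊢
    split_ifs at h1 ⊢ with he
    · by_cases hc : (G.coeff d).coeff e = 0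
      · exfalso
        rw [hc, Int.modEq_iff_dvd, sub_zero] at h1
        have := Int.le_of_dvd one_pos h1
        omega
      · exact isRatRecon_of_modEq_one h1 ((ratReconPoly_spec hh d e).2 hc)
    · exact hzero d e h1
  · intro d' hd'
    ext e
    rw [MvPolynomial.coeff_zero]
    exact hzero d' e ((hG e).2 d' hd')

/-- `F` has integral coefficients modulo `m`, and reduces to `G`. -/
def IsCongruentMod (m : ℕ) (G : (MvPolynomial (Fin n) ℤ)[X]) (F : (MvPolynomial (Fin n) ℚ)[X]) :
    Prop :=
  ∀ d e, ((F.coeff d).coeff e).den.Coprime m ∧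
    ((F.coeff d).coeff e).num ≡ (G.coeff d).coeff e * ((F.coeff d).coeff e).den [ZMOD m]

theorem isCongruentMod_one (G : (MvPolynomial (Fin n) ℤ)[X]) (F : (MvPolynomial (Fin n) ℚ)[X]) :
    IsCongruentMod 1 G F := fun _ _ =>
  ⟨Nat.coprime_one_right _, by rw [Nat.cast_one]; exact Int.modEq_one⟩

theorem IsCongruentMod.crtPoly {m p : ℕ} {G g : (MvPolynomial (Fin n) ℤ)[X]}
    {F : (MvPolynomial (Fin n) ℚ)[X]} (h : m.Coprime p)
    (hG : IsCongruentMod m G F) (hg : IsCongruentMod p g F) :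
    IsCongruentMod (m * p) (crtPoly m p G g) F := by
  have hmp : (m : ℤ).natAbs.Coprime (p : ℤ).natAbs := by simpa using h
  intro d e
  refine ⟨Nat.Coprime.mul_right (hG d e).1 (hg d e).1, ?_⟩
  rw [Nat.cast_mul, coeff_coeff_crtPoly, ← Int.modEq_and_modEq_iff_modEq_mul hmp]
  exact ⟨(hG d e).2.trans ((crt_left h _ _).symm.mul_right _),
    (hg d e).2.trans ((crt_right h _ _).symm.mul_right _)⟩

theorem IsCongruentMod.ratReconPoly_eq {m : ℕ} {G : (MvPolynomial (Fin n) ℤ)[X]}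
    {F : (MvPolynomial (Fin n) ℚ)[X]} (hG : IsCongruentMod m G F) (hF : HasHeightLT m F) :
    ratReconPoly m G = some F :=
  ratReconPoly_eq_some_of fun d e => ⟨(hF d e).1, (hF d e).2, (hG d e).1, (hG d e).2⟩

theorem isCongruentMod_liftInt {p : ℕ} [hp : Fact p.Prime]
    (F : (MvPolynomial (Fin n) (localInt p))[X]) :
    IsCongruentMod p (liftInt p (F.map (MvPolynomial.map (localIntMod p))))
      (F.map (MvPolynomial.map (localInt p).subtype)) := by
  intro d e
  rw [coeff_map, MvPolynomial.coeff_map, coeff_liftInt, coeff_mapCoeffs (by simp), coeff_map,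
    MvPolynomial.coeff_map]
  set q := (F.coeff d).coeff e
  refine ⟨((Nat.Prime.coprime_iff_not_dvd hp.out).2 q.2).symm, ?_⟩
  rw [← ZMod.intCast_eq_intCast_iff]
  push_cast
  rw [ZMod.natCast_zmod_val]
  change ((q : ℚ).num : ZMod p) = ratMod p (q : ℚ) * ((q : ℚ).den : ZMod p)
  rw [ratMod, mul_assoc, inv_mul_cancel₀ (den_cast_ne_zero p q.2), mul_one]

end

/-! ### Invariants of the main loop -/

noncomputable section

variable {n : ℕ}

theorem dvd_of_mem_span_pair {A : Type} [CommRing A] {a b c x : A} (ha : c ∣ a) (hb : c ∣ b)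
    (h : x ∈ Ideal.span {a, b}) : c ∣ x := by
  obtain ⟨y, z, rfl⟩ := Ideal.mem_span_pair.1 h
  exact dvd_add (Dvd.dvd.mul_left ha _) (Dvd.dvd.mul_left hb _)

/-- A run without a report has inverted this coefficient at the very start. It supplies the unit
leading coefficient that the Nakayama argument needs for finiteness. -/
theorem isUnit_leadingCoeff_of_monicEuclid {A W : Type} [CommRing A] {S : Subring A}
    {E : W → Prop} {inv : A → Except W A} (hinv : InvSpec S E inv) {a b : A[X]}
    (ha : a ∈ Polynomial.liftsRing S.subtype) (hb : b ∈ Polynomial.liftsRing S.subtype)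
    {x : A[X] × A[X] × A[X]} (h : monicEuclid inv a b = .ok x) :
    (b ≠ 0 → IsUnit b.leadingCoeff) ∧ (b = 0 → a ≠ 0 → IsUnit a.leadingCoeff) := by
  rw [monicEuclid] at h
  constructor
  · intro hb0
    rw [if_neg hb0, euclidLoop, if_neg hb0] at h
    have hu := hinv b.leadingCoeff ((mem_liftsRing_iff S).1 hb _) (leadingCoeff_ne_zero.2 hb0)
    cases hc : inv b.leadingCoeff with
    | error w => simp [hc] at h
    | ok c => exact IsUnit.of_mul_eq_one _ (hu.1 c hc).2
  · intro hb0 ha0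
    rw [if_pos hb0, if_neg ha0] at h
    have hu := hinv a.leadingCoeff ((mem_liftsRing_iff S).1 ha _) (leadingCoeff_ne_zero.2 ha0)
    cases hc : inv a.leadingCoeff with
    | error w => simp [hc] at h
    | ok c => exact IsUnit.of_mul_eq_one _ (hu.1 c hc).2

section Lift

variable {p : ℕ} [Fact p.Prime] {T : Fin n → MvPolynomial (Fin n) ℚ}
  {a b : (MvPolynomial (Fin n) ℚ)[X]}

theorem exists_map_subtype_eq {f : (MvPolynomial (Fin n) ℚ)[X]}
    (hf : ∀ d, IsIntegralAt p (f.coeff d)) :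
    ∃ F : (MvPolynomial (Fin n) (localInt p))[X],
      F.map (MvPolynomial.map (localInt p).subtype) = f :=
  (mem_lifts f).1 ((lifts_iff_coeff_lifts f).2 fun d => ⟨_, map_toLocalInt (hf d)⟩)

/-- The lift to `localInt p` of a reduced polynomial whose leading coefficient does not vanish
modulo `p`. -/
theorem exists_lift_of_leadingCoeff (hT : IsMonicTriangular T) (hint : IsTriIntegralAt p T)
    (hred : ∀ d, IsReducedWrt T n (a.coeff d)) (ha : ∀ d, IsIntegralAt p (a.coeff d))
    (hlc : a ≠ 0 → mapCoeffs (ratMod p) a.leadingCoeff ≠ 0) :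
    ∃ A : (TriQuot (localTri p T) n)[X], A.map (inclTri hint n) = projPoly T n a ∧
      A.map (redTri hint n) = projPoly (triMod p T) n (mapCoeffsPoly (ratMod p) a) ∧
      (a ≠ 0 → A.map (redTri hint n) ≠ 0 ∧
        (A.map (redTri hint n)).leadingCoeff = redTri hint n A.leadingCoeff) := by
  obtain ⟨F, hF⟩ := exists_map_subtype_eq ha
  have h1 : (projPoly (localTri p T) n F).map (inclTri hint n) = projPoly T n a := by
    rw [inclTri, map_projPoly, hF]
  have h2 : (projPoly (localTri p T) n F).map (redTri hint n) =
      projPoly (triMod p T) n (mapCoeffsPoly (ratMod p) a) := by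
    rw [redTri, map_projPoly, ← mapCoeffsPoly_ratMod, hF]
  refine ⟨projPoly (localTri p T) n F, h1, h2, fun ha0 => ?_⟩
  set A := projPoly (localTri p T) n F
  have hd : A.natDegree = a.natDegree := by
    rw [← natDegree_map_eq_of_injective (inclTri_injective hT hint n), h1, ← natDegree_repPoly hT,
      repPoly_projPoly hT hred]
  have hne : redTri hint n A.leadingCoeff ≠ 0 := by
    rw [leadingCoeff, ← coeff_map, h2, hd, coeff_projPoly, coeff_mapCoeffsPoly]
    exact fun h0 => hlc ha0 (mk_mapCoeffs_eq_zero hT hint (hred _) h0)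
  refine ⟨fun h0 => hne ?_, leadingCoeff_map_of_leadingCoeff_ne_zero _ hne⟩
  rw [leadingCoeff, ← coeff_map, h0, coeff_zero]

omit [Fact p.Prime] in
theorem isIntegralAt_of_not_bad (h : ¬ IsBadPrime p T a b) :
    IsTriIntegralAt p T ∧ (∀ d, IsIntegralAt p (a.coeff d)) ∧ (∀ d, IsIntegralAt p (b.coeff d)) ∧
      (a ≠ 0 → mapCoeffs (ratMod p) a.leadingCoeff ≠ 0) ∧
      (b ≠ 0 → mapCoeffs (ratMod p) b.leadingCoeff ≠ 0) := by
  simp only [IsBadPrime, not_or, not_exists, not_and] at h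
  exact ⟨h.1, h.2.1, h.2.2.1, h.2.2.2.1, h.2.2.2.2⟩

/-- The modular gcd lifts to an element of the ideal generated by `a` and `b`. -/
theorem euclidMod_lift (hT : IsMonicTriangular T) (hbad : ¬ IsBadPrime p T a b)
    (hint : IsTriIntegralAt p T)
    (hra : ∀ d, IsReducedWrt T n (a.coeff d)) (hrb : ∀ d, IsReducedWrt T n (b.coeff d))
    {g s t : (TriQuot (triMod p T) n)[X]} (h : euclidMod p T a b = .ok (g, s, t)) :
    ∃ G : (TriQuot (localTri p T) n)[X],
      (G.Monic ∧ ¬ (a = 0 ∧ b = 0) ∨ G = 0 ∧ a = 0 ∧ b = 0) ∧ G.map (redTri hint n) = g ∧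
      G.map (inclTri hint n) ∈ Ideal.span {projPoly T n a, projPoly T n b} := by
  obtain ⟨-, hia, hib, hla, hlb⟩ := isIntegralAt_of_not_bad hbad
  obtain ⟨A, hA1, hA2, hA3⟩ := exists_lift_of_leadingCoeff hT hint hra hia hla
  obtain ⟨B, hB1, hB2, hB3⟩ := exists_lift_of_leadingCoeff hT hint hrb hib hlb
  have hL := hT.localTri hint
  have hnt := (hT.triMod hint).nontrivial_triQuot n
  rw [euclidMod, ← hA2, ← hB2] at h
  have hinv := invLevel_spec (hT.triMod hint) n le_rfl
  have hspec := (monicEuclid_spec hinv (lowPolys_top _ _) (lowPolys_top _ _)).1 _ _ _ h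
  by_cases h0 : a = 0 ∧ b = 0
  · have hz : ∀ (f : (MvPolynomial (Fin n) ℚ)[X]) (F : (TriQuot (localTri p T) n)[X]), f = 0 →
        F.map (inclTri hint n) = projPoly T n f → F = 0 := fun f F hf hF => by
      rw [hf, map_zero] at hF
      exact (Polynomial.map_eq_zero_iff (inclTri_injective hT hint n)).1 hF
    refine ⟨0, Or.inr ⟨rfl, h0⟩, ?_, by rw [Polynomial.map_zero]; exact zero_mem _⟩
    rw [hspec.bezout, hz a A h0.1 hA1, hz b B h0.2 hB1]
    simp
  · have hunit := isUnit_leadingCoeff_of_monicEuclid hinv (lowPolys_top _ _) (lowPolys_top _ _) h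
    have hab : IsUnit (redTri hint n A.leadingCoeff) ∨ IsUnit (redTri hint n B.leadingCoeff) := by
      by_cases hb : b = 0
      · have ha : a ≠ 0 := fun ha => h0 ⟨ha, hb⟩
        left
        rw [← (hA3 ha).2]
        refine hunit.2 ?_ (hA3 ha).1
        rw [hB2, hb, mapCoeffsPoly]
        simp
      · right
        rw [← (hB3 hb).2]
        exact hunit.1 (hB3 hb).1
    have hgm : g.Monic := hspec.monic.resolve_right fun h' => by
      by_cases hb : b = 0
      · exact (hA3 fun ha => h0 ⟨ha, hb⟩).1 h'.1
      · exact (hB3 hb).1 h'.2.1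
    obtain ⟨G, hGm, hGd, hGI⟩ := exists_monic_mem_span_pair_triQuot hL
      (map_localIntMod_localTri hint) hab hgm hspec.bezout
    obtain ⟨x, y, hxy⟩ := Ideal.mem_span_pair.1 hGI
    refine ⟨G, Or.inl ⟨hGm, h0⟩, ?_, ?_⟩
    -- `g` divides the reductions of `a` and `b`, hence that of `G`; both are monic, and their
    -- degrees agree.
    · refine eq_of_monic_of_dvd_of_natDegree_le hgm (hGm.map _) ?_ ?_
      · rw [← hxy, Polynomial.map_add, Polynomial.map_mul, Polynomial.map_mul]
        exact dvd_add (Dvd.dvd.mul_left hspec.dvd_left _) (Dvd.dvd.mul_left hspec.dvd_right _)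
      · rw [← hGd]
        exact natDegree_map_le
    · rw [← hxy, Polynomial.map_add, Polynomial.map_mul, Polynomial.map_mul, hA1, hB1]
      exact Ideal.mem_span_pair.2 ⟨_, _, rfl⟩

end Lift

/-- A monic common divisor of `a` and `b`, or `0` if `a = b = 0`. -/
def IsMonicCommonDivisor (T : Fin n → MvPolynomial (Fin n) ℚ) (a b : (MvPolynomial (Fin n) ℚ)[X])
    (γ : (TriQuot T n)[X]) : Prop :=
  γ ∣ projPoly T n a ∧ γ ∣ projPoly T n b ∧
    (γ.Monic ∧ ¬ (a = 0 ∧ b = 0) ∨ γ = 0 ∧ a = 0 ∧ b = 0)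

/-- The state of the main loop. -/
structure IsLoopState (P : (Fin n → MvPolynomial (Fin n) ℚ) → ℕ → ℕ)
    (T : Fin n → MvPolynomial (Fin n) ℚ) (a b : (MvPolynomial (Fin n) ℚ)[X]) (idx dg M : ℕ)
    (G : (MvPolynomial (Fin n) ℤ)[X]) : Prop where
  left : ∀ d, IsReducedWrt T n (a.coeff d)
  right : ∀ d, IsReducedWrt T n (b.coeff d)
  pos : 0 < M
  coprime : ∀ i, idx ≤ i → M.Coprime (P T i)
  shape : ¬ (a = 0 ∧ b = 0) → IsMonicMod M dg G
  approx : ∀ γ, IsMonicCommonDivisor T a b γ →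
    γ.natDegree ≤ dg ∧ (dg = γ.natDegree → IsCongruentMod M G (repPoly T n γ))

section Step

variable {P : (Fin n → MvPolynomial (Fin n) ℚ) → ℕ → ℕ} {T : Fin n → MvPolynomial (Fin n) ℚ}
  {a b : (MvPolynomial (Fin n) ℚ)[X]} {idx dg M : ℕ} {G : (MvPolynomial (Fin n) ℤ)[X]}
  {B : Option ℕ}

theorem IsLoopState.succ (h : IsLoopState P T a b idx dg M G) :
    IsLoopState P T a b (idx + 1) dg M G :=
  { h with coprime := fun i hi => h.coprime i (by omega) }

theorem loopStep_cases {p : ℕ} [Fact p.Prime] (hT : IsMonicTriangular T) {x : LoopStep n}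
    (h : loopStep p T a b dg M G B = x) :
    x = .next dg M G B ∨
    (¬ IsBadPrime p T a b ∧ ∃ w, IsZeroDivisor (triMod p T) w ∧
      x = zeroDivisorStep p T dg M G B w) ∨
    (¬ IsBadPrime p T a b ∧ ∃ g s t, euclidMod p T a b = .ok (g, s, t) ∧ g.natDegree ≤ dg ∧
      x = imageStep p T a b dg M G B g) := by
  rw [loopStep] at h
  split_ifs at h with hbad
  · exact Or.inl h.symm
  have hTp := hT.triMod (isIntegralAt_of_not_bad hbad).1
  split at h
  · rename_i w hw
    exact Or.inr (Or.inl ⟨hbad, w, isRadicalPrime_error hTp n w hw, h.symm⟩)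
  · exact Or.inl h.symm
  · split at h
    · rename_i w hw
      refine Or.inr (Or.inl ⟨hbad, w, ?_, h.symm⟩)
      exact ((monicEuclid_spec (invLevel_spec hTp n le_rfl) (lowPolys_top _ _)
        (lowPolys_top _ _)).2 w hw).1
    · rename_i g s t hg
      by_cases hlt : dg < g.natDegree
      · rw [imageStep, if_pos hlt] at h
        exact Or.inl h.symm
      · exact Or.inr (Or.inr ⟨hbad, g, s, t, hg, not_lt.1 hlt, h.symm⟩)

theorem imageStep_cases {p : ℕ} (T : Fin n → MvPolynomial (Fin n) ℚ)
    (a b : (MvPolynomial (Fin n) ℚ)[X]) (M : ℕ) (G : (MvPolynomial (Fin n) ℤ)[X]) (B : Option ℕ)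
    {g : (TriQuot (triMod p T) n)[X]} (hdg : g.natDegree ≤ dg) :
    (∃ f, ratReconPoly (if g.natDegree = dg then M * p else p) (combine p T dg M G g) = some f ∧
      projPoly T n f ∣ projPoly T n a ∧ projPoly T n f ∣ projPoly T n b ∧
      imageStep p T a b dg M G B g = .done f) ∨
    ((∀ f, ratReconPoly (if g.natDegree = dg then M * p else p) (combine p T dg M G g) = some f →
      ¬ (projPoly T n f ∣ projPoly T n a ∧ projPoly T n f ∣ projPoly T n b)) ∧
      imageStep p T a b dg M G B g =
        .next g.natDegree (if g.natDegree = dg then M * p else p) (combine p T dg M G g) B) := by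
  classical
  rw [imageStep, if_neg (not_lt.2 hdg)]
  cases hr : ratReconPoly (if g.natDegree = dg then M * p else p) (combine p T dg M G g) with
  | none => exact Or.inr ⟨fun f hf => by simp at hf, rfl⟩
  | some f =>
    by_cases hf : projPoly T n f ∣ projPoly T n a ∧ projPoly T n f ∣ projPoly T n b
    · refine Or.inl ⟨f, rfl, hf.1, hf.2, ?_⟩
      rw [Option.filter_some, if_pos (by simpa using hf)]
    · refine Or.inr ⟨fun f' hf' => ?_, ?_⟩
      · rw [Option.some.injEq] at hf'
        rwa [← hf']
      · rw [Option.filter_some, if_neg (by simpa using hf)]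

/-- Every monic common divisor `γ` over `ℚ` divides the lift `G₀` of `g`, so `deg γ ≤ deg g`, and
equality forces `γ = G₀`, which means that `g` is the reduction of `γ`. Images of the same degree
combine by Chinese remaindering because the primes are distinct; otherwise the new image alone
satisfies the invariant. -/
theorem IsLoopState.image (hprime : ∀ S i, (P S i).Prime)
    (hnew : ∀ S, Function.Injective (P S)) (hT : IsMonicTriangular T)
    (h : IsLoopState P T a b idx dg M G) (hbad : ¬ IsBadPrime (P T idx) T a b)
    {g s t : (TriQuot (triMod (P T idx) T) n)[X]}
    (hE : euclidMod (P T idx) T a b = .ok (g, s, t)) :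
    IsLoopState P T a b (idx + 1) g.natDegree (if g.natDegree = dg then M * P T idx else P T idx)
      (combine (P T idx) T dg M G g) := by
  have hp : Fact (P T idx).Prime := ⟨hprime T idx⟩
  have hint := (isIntegralAt_of_not_bad hbad).1
  have hTp := hT.triMod hint
  have hL := hT.localTri hint
  have hnt := hTp.nontrivial_triQuot n
  have hntL := hL.nontrivial_triQuot n
  have hntQ := hT.nontrivial_triQuot n
  have hcop := h.coprime idx le_rfl
  obtain ⟨G₀, hG₀, hred, hspan⟩ := euclidMod_lift hT hbad hint h.left h.right hE
  have hcop' : ∀ i, idx + 1 ≤ i → (P T idx).Coprime (P T i) := fun i hi =>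
    (Nat.coprime_primes (hprime T idx) (hprime T i)).2 fun h => by
      have := hnew T h
      omega
  have hshape : ¬ (a = 0 ∧ b = 0) → IsMonicMod (P T idx) g.natDegree
      (liftInt (P T idx) (repPoly (triMod (P T idx) T) n g)) := by
    intro h0
    have hgm : g.Monic := by
      rw [← hred]
      exact (hG₀.resolve_right fun h' => h0 h'.2).1.map _
    exact (isBoundedMonic_liftInt (P T idx) (isBoundedMonic_repPoly hTp (degreeOf_triMod hT hint)
      (lowPolys_top _ _) hgm)).isMonicMod _
  have hdeg : g.natDegree = (G₀.map (inclTri hint n)).natDegree := by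
    rw [← hred]
    rcases hG₀ with ⟨hm, -⟩ | ⟨rfl, -⟩
    · rw [hm.natDegree_map, hm.natDegree_map]
    · rw [Polynomial.map_zero, Polynomial.map_zero, natDegree_zero, natDegree_zero]
  have happ : ∀ γ, IsMonicCommonDivisor T a b γ → γ.natDegree ≤ g.natDegree ∧
      (g.natDegree = γ.natDegree →
        IsCongruentMod (P T idx) (liftInt (P T idx) (repPoly (triMod (P T idx) T) n g)) (repPoly T n γ)) := by
    rintro γ ⟨hγa, hγb, hγ⟩
    have hdvd : γ ∣ G₀.map (inclTri hint n) := dvd_of_mem_span_pair hγa hγb hspan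
    have key : γ.natDegree ≤ g.natDegree ∧
        (g.natDegree = γ.natDegree → γ = G₀.map (inclTri hint n)) := by
      rcases hγ with ⟨hm, h0⟩ | ⟨h1, h0⟩
      · have hG₀m := (hG₀.resolve_right fun h' => h0 h'.2).1.map (inclTri hint n)
        rw [hdeg]
        constructor
        · by_contra hlt
          exact hm.not_dvd_of_natDegree_lt hG₀m.ne_zero (not_le.1 hlt) hdvd
        · intro hd
          exact (eq_of_monic_of_dvd_of_natDegree_le hm hG₀m hdvd hd.le).symm
      · have := (hG₀.resolve_left fun h' => h'.2 h0).1
        rw [h1, this, natDegree_zero, Polynomial.map_zero]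
        exact ⟨Nat.zero_le _, fun _ => rfl⟩
    refine ⟨key.1, fun hd => ?_⟩
    rw [key.2 hd, ← hred, redTri, inclTri, repPoly_map hL, repPoly_map hL]
    exact isCongruentMod_liftInt _
  rw [combine]
  split_ifs with hd
  · refine ⟨h.left, h.right, Nat.mul_pos h.pos hp.out.pos, fun i hi => ?_, fun h0 => ?_,
      fun γ hγ => ⟨(happ γ hγ).1, fun hd' => ?_⟩⟩
    · exact Nat.Coprime.mul_left (h.coprime i (by omega)) (hcop' i hi)
    · exact IsMonicMod.crtPoly hcop (hd ▸ h.shape h0) (hshape h0)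
    · exact IsCongruentMod.crtPoly hcop ((h.approx γ hγ).2 (hd ▸ hd')) ((happ γ hγ).2 hd')
  · exact ⟨h.left, h.right, hp.out.pos, hcop', hshape, happ⟩

/-- The result of an iteration is a gcd. -/
theorem IsLoopState.isGreatestCommonDivisor (hprime : ∀ S i, (P S i).Prime)
    (hnew : ∀ S, Function.Injective (P S)) (hT : IsMonicTriangular T)
    (h : IsLoopState P T a b idx dg M G) (hbad : ¬ IsBadPrime (P T idx) T a b)
    {g s t : (TriQuot (triMod (P T idx) T) n)[X]} (hE : euclidMod (P T idx) T a b = .ok (g, s, t))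
    {f : (MvPolynomial (Fin n) ℚ)[X]}
    (hf : ratReconPoly (if g.natDegree = dg then M * P T idx else P T idx)
      (combine (P T idx) T dg M G g) = some f)
    (hfa : projPoly T n f ∣ projPoly T n a) (hfb : projPoly T n f ∣ projPoly T n b) :
    (projPoly T n f ∈ Ideal.span {projPoly T n a, projPoly T n b}) ∧
      (projPoly T n f = 0 ∨ IsUnit (projPoly T n f).leadingCoeff) := by
  have hp : Fact (P T idx).Prime := ⟨hprime T idx⟩
  have hst := h.image hprime hnew hT hbad hE
  set M' := if g.natDegree = dg then M * P T idx else P T idx with hM'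
  have hM'1 : 1 < M' := by
    rw [hM']
    split_ifs
    · exact lt_of_lt_of_le hp.out.one_lt (Nat.le_mul_of_pos_left _ h.pos)
    · exact hp.out.one_lt
  have hint := (isIntegralAt_of_not_bad hbad).1
  have hnt := (hT.triMod hint).nontrivial_triQuot n
  have hntQ := hT.nontrivial_triQuot n
  obtain ⟨G₀, hG₀, hred, hspan⟩ := euclidMod_lift hT hbad hint h.left h.right hE
  rcases hG₀ with ⟨hm, h0⟩ | ⟨h1, h0⟩
  · obtain ⟨hf1, hf2⟩ := (hst.shape h0).of_ratReconPoly hM'1 hf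
    have hle : (projPoly T n f).natDegree ≤ g.natDegree :=
      natDegree_le_iff_coeff_eq_zero.2 fun d' hd' => by
        rw [coeff_projPoly, hf2 d' hd', map_zero]
    have hco : (projPoly T n f).coeff g.natDegree = 1 := by
      rw [coeff_projPoly, hf1, map_one]
    have hfm : (projPoly T n f).Monic := monic_of_natDegree_le_of_coeff_eq_one _ hle hco
    have hfd : g.natDegree ≤ (projPoly T n f).natDegree :=
      le_natDegree_of_ne_zero (by rw [hco]; exact one_ne_zero)
    have hdvd : projPoly T n f ∣ G₀.map (inclTri hint n) := dvd_of_mem_span_pair hfa hfb hspan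
    -- `f` divides `a` and `b`, hence the monic lift of `g` that lies in `(a, b)`; the degrees
    -- agree, so `f` is that lift.
    have heq := eq_of_monic_of_dvd_of_natDegree_le hfm (hm.map _) hdvd (by
      rw [hm.natDegree_map]
      rwa [← hred, hm.natDegree_map] at hfd)
    refine ⟨heq ▸ hspan, Or.inr ?_⟩
    rw [hfm.leadingCoeff]
    exact isUnit_one
  · have hg0 : g.natDegree = 0 := by rw [← hred, h1, Polynomial.map_zero, natDegree_zero]
    -- For `a = b = 0` the invariant, applied to the common divisor `0`, says that the combined
    -- image vanishes modulo the modulus, so only `0` can be reconstructed.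
    have hcong := (hst.approx 0 ⟨by rw [h0.1, map_zero], by rw [h0.2, map_zero],
      Or.inr ⟨rfl, h0⟩⟩).2 (by rw [hg0, natDegree_zero])
    have hf0 : f = 0 := by
      ext d e
      rw [coeff_zero, MvPolynomial.coeff_zero]
      have h2 := (hcong d e).2
      rw [repPoly_zero hT, coeff_zero, MvPolynomial.coeff_zero] at h2
      simp only [Rat.num_ofNat, Rat.den_ofNat, Nat.cast_one, mul_one] at h2
      by_cases hc : ((combine (P T idx) T dg M G g).coeff d).coeff e = 0
      · exact (ratReconPoly_spec hf d e).1 hc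
      · exact isRatRecon_zero (((ratReconPoly_spec hf d e).2 hc).of_modEq h2.symm)
    rw [hf0, map_zero]
    exact ⟨zero_mem _, Or.inl rfl⟩

theorem isGreatestCommonDivisor_of_mem_span {A : Type} [CommRing A] {a b g : A} (ha : g ∣ a)
    (hb : g ∣ b) (h : g ∈ Ideal.span {a, b}) : IsGreatestCommonDivisor a b g :=
  ⟨ha, hb, fun _ hca hcb => dvd_of_mem_span_pair hca hcb h⟩

/-- The specification of an iteration of the main loop. -/
theorem loopStep_spec (hprime : ∀ S i, (P S i).Prime)
    (hnew : ∀ S, Function.Injective (P S)) (hT : IsMonicTriangular T)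
    (h : IsLoopState P T a b idx dg M G) :
    match loopStep (P T idx) T a b dg M G B with
    | .next dg' M' G' _ => IsLoopState P T a b (idx + 1) dg' M' G'
    | .done f => IsGreatestCommonDivisor (projPoly T n a) (projPoly T n b) (projPoly T n f) ∧
        (projPoly T n f = 0 ∨ IsUnit (projPoly T n f).leadingCoeff)
    | .split j u v _ => IsFactorization T (j, u, v) := by
  have hp : Fact (P T idx).Prime := ⟨hprime T idx⟩
  rcases loopStep_cases hT (rfl : loopStep (P T idx) T a b dg M G B = _) with
    h1 | ⟨hbad, w, hw, h1⟩ | ⟨hbad, g, s, t, hE, hdg, h1⟩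
  · rw [h1]
    exact h.succ
  · rw [h1, zeroDivisorStep]
    have hint := (isIntegralAt_of_not_bad hbad).1
    rcases hz : handleZeroDivisor (P T idx) T n B w with ⟨_ | ⟨j, u, v⟩, B'⟩
    · exact h.succ
    · exact handleZeroDivisor_spec hT hint n B w hw _ _ hz
  · rw [h1]
    rcases imageStep_cases T a b M G B hdg with ⟨f, hf, hfa, hfb, h2⟩ | ⟨-, h2⟩
    · rw [h2]
      have := h.isGreatestCommonDivisor hprime hnew hT hbad hE hf hfa hfb
      exact ⟨isGreatestCommonDivisor_of_mem_span hfa hfb this.1, this.2⟩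
    · rw [h2]
      exact h.image hprime hnew hT hbad hE

/-- Since `M = 1`, only the degree bound has content: a monic divisor of a nonzero polynomial has at
most its degree, and for reduced inputs the degree of the representative is that of its class. -/
theorem IsLoopState.init (P : (Fin n → MvPolynomial (Fin n) ℚ) → ℕ → ℕ) (hT : IsMonicTriangular T)
    (ha : ∀ d, IsReducedWrt T n (a.coeff d)) (hb : ∀ d, IsReducedWrt T n (b.coeff d)) :
    IsLoopState P T a b 0 (initDegree (a, b)) 1 0 := by
  have hntQ := hT.nontrivial_triQuot n
  refine ⟨ha, hb, one_pos, fun i _ => Nat.coprime_one_left _, fun _ => isMonicMod_one _ _,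
    fun γ hγ => ⟨?_, fun _ => isCongruentMod_one _ _⟩⟩
  obtain ⟨hγa, hγb, ⟨hm, h0⟩ | ⟨rfl, -⟩⟩ := hγ
  · have key : ∀ f : (MvPolynomial (Fin n) ℚ)[X], (∀ d, IsReducedWrt T n (f.coeff d)) → f ≠ 0 →
        γ ∣ projPoly T n f → γ.natDegree ≤ f.natDegree := by
      intro f hf hf0 hdvd
      have hrep := repPoly_projPoly hT hf
      rw [← hrep, natDegree_repPoly hT]
      by_contra hlt
      refine hm.not_dvd_of_natDegree_lt (fun h => hf0 ?_) (not_le.1 hlt) hdvd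
      rw [← hrep, h, repPoly_zero hT]
    rw [initDegree]
    split_ifs with hb0
    · exact key a ha (fun ha0 => h0 ⟨ha0, hb0⟩) hγa
    · exact key b hb hb0 hγb
  · rw [natDegree_zero]
    exact Nat.zero_le _

end Step

end

/-! ### Correctness of the output -/

noncomputable section

variable {n : ℕ}

/-- A value of the global bound that grows when it is squared. -/
def IsValidBound (B : Option ℕ) : Prop := ∀ b, B = some b → 2 ≤ b

theorem IsValidBound.two_le_nextBound {B : Option ℕ} (h : IsValidBound B) : 2 ≤ nextBound B := by
  cases B with
  | none => simp [nextBound]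
  | some b => exact (h b rfl).trans (le_nextBound_some b)

theorem isValidBound_none : IsValidBound none := fun _ h => by cases h

/-- The main variable of `w` shows that `n ≠ 0`, so at least one new bound is assigned; from `2` on,
squaring strictly increases. -/
theorem handleZeroDivisor_validBound {p : ℕ} {T : Fin n → MvPolynomial (Fin n) ℚ} {B : Option ℕ}
    (hB : IsValidBound B) (w : ZeroDivisor n p) :
    IsValidBound (handleZeroDivisor p T n B w).2 ∧
      nextBound B + 1 ≤ nextBound (handleZeroDivisor p T n B w).2 := by
  obtain ⟨m, rfl⟩ := Nat.exists_eq_succ_of_ne_zero (Nat.ne_of_gt w.1.pos)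
  obtain ⟨b, hb, h⟩ := handleZeroDivisor_bound p T m B w
  have h2 := hB.two_le_nextBound
  rw [h]
  refine ⟨fun b' hb' => ?_, ?_⟩
  · rw [Option.some.injEq] at hb'
    omega
  · have h3 : nextBound (some b) = b ^ 2 := rfl
    rw [h3]
    nlinarith

/-- `out` is a componentwise gcd of `a` and `b` modulo `I`. -/
structure IsGCDOutput (I : Ideal (MvPolynomial (Fin n) ℚ)) (a b : (MvPolynomial (Fin n) ℚ)[X])
    (out : CGCDOutput n) : Prop where
  triangular : ∀ c ∈ out, IsTriangularSet c.1 ∧ (triIdeal c.1 n).IsRadical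
  comaximal : out.Pairwise fun c c' => IsCoprime (triIdeal c.1 n) (triIdeal c'.1 n)
  inter : (⨅ c ∈ out, triIdeal c.1 n) = I
  gcd : ∀ c ∈ out,
    IsGreatestCommonDivisor (projPoly c.1 n a) (projPoly c.1 n b) (projPoly c.1 n c.2) ∧
      (projPoly c.1 n c.2 = 0 ∨ IsUnit (projPoly c.1 n c.2).leadingCoeff)

section Output

variable {I J : Ideal (MvPolynomial (Fin n) ℚ)} {a b : (MvPolynomial (Fin n) ℚ)[X]}
  {out out₁ out₂ : CGCDOutput n}

theorem IsGCDOutput.le (h : IsGCDOutput I a b out) {c} (hc : c ∈ out) : I ≤ triIdeal c.1 n := by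
  rw [← h.inter]
  exact iInf₂_le c hc

theorem IsGreatestCommonDivisor.swap {A : Type} [CommRing A] {a b g : A}
    (h : IsGreatestCommonDivisor a b g) : IsGreatestCommonDivisor b a g :=
  ⟨h.2.1, h.1, fun c hb ha => h.2.2 c ha hb⟩

theorem IsGCDOutput.swap (h : IsGCDOutput I a b out) : IsGCDOutput I b a out :=
  { h with gcd := fun c hc => ⟨(h.gcd c hc).1.swap, (h.gcd c hc).2⟩ }

theorem IsGCDOutput.congr (h : IsGCDOutput I a b out) {a' b' : (MvPolynomial (Fin n) ℚ)[X]}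
    (ha : ∀ d, a.coeff d - a'.coeff d ∈ I) (hb : ∀ d, b.coeff d - b'.coeff d ∈ I) :
    IsGCDOutput I a' b' out := by
  have key : ∀ {f f' : (MvPolynomial (Fin n) ℚ)[X]} {c}, c ∈ out →
      (∀ d, f.coeff d - f'.coeff d ∈ I) → projPoly c.1 n f = projPoly c.1 n f' := by
    intro f f' c hc hf
    ext1 d
    rw [coeff_projPoly, coeff_projPoly, Ideal.Quotient.eq]
    exact h.le hc (hf d)
  refine { h with gcd := fun c hc => ?_ }
  rw [← key hc ha, ← key hc hb]
  exact h.gcd c hc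

theorem IsGCDOutput.append (h₁ : IsGCDOutput I a b out₁) (h₂ : IsGCDOutput J a b out₂)
    (hIJ : IsCoprime I J) : IsGCDOutput (I ⊓ J) a b (out₁ ++ out₂) := by
  refine ⟨fun c hc => ?_, ?_, ?_, fun c hc => ?_⟩
  · exact (List.mem_append.1 hc).elim (h₁.triangular c) (h₂.triangular c)
  · refine List.pairwise_append.2 ⟨h₁.comaximal, h₂.comaximal, fun c hc c' hc' => ?_⟩
    rw [Ideal.isCoprime_iff_sup_eq] at hIJ ⊢
    exact top_le_iff.1 (hIJ ▸ sup_le_sup (h₁.le hc) (h₂.le hc'))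
  · simp only [List.mem_append, iInf_or, iInf_inf_eq, h₁.inter, h₂.inter]
  · exact (List.mem_append.1 hc).elim (h₁.gcd c) (h₂.gcd c)

end Output

section Correct

variable {P : (Fin n → MvPolynomial (Fin n) ℚ) → ℕ → ℕ} {T : Fin n → MvPolynomial (Fin n) ℚ}
  {a b : (MvPolynomial (Fin n) ℚ)[X]} {idx dg M : ℕ} {G : (MvPolynomial (Fin n) ℤ)[X]}
  {B : Option ℕ}

theorem loopStep_validBound {p : ℕ} [Fact p.Prime] (hT : IsMonicTriangular T)
    (hB : IsValidBound B) :
    match loopStep p T a b dg M G B with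
    | .next _ _ _ B' => IsValidBound B'
    | .done _ => True
    | .split _ _ _ B' => IsValidBound B' := by
  rcases loopStep_cases hT (rfl : loopStep p T a b dg M G B = _) with
    h1 | ⟨-, w, -, h1⟩ | ⟨-, g, s, t, hE, hdg, h1⟩
  · rw [h1]
    exact hB
  · rw [h1, zeroDivisorStep]
    have h2 := (handleZeroDivisor_validBound (T := T) hB w).1
    rcases hz : handleZeroDivisor p T n B w with ⟨_ | ⟨j, u, v⟩, B'⟩ <;>
    · rw [hz] at h2
      exact h2
  · rw [h1]
    rcases imageStep_cases T a b M G B hdg with ⟨f, -, -, -, h2⟩ | ⟨-, h2⟩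
    · rw [h2]
      trivial
    · rw [h2]
      exact hB

theorem isReducedWrt_prepareInput (hT : IsMonicTriangular T) (a b : (MvPolynomial (Fin n) ℚ)[X]) :
    (∀ d, IsReducedWrt T n ((prepareInput T a b).1.coeff d)) ∧
      ∀ d, IsReducedWrt T n ((prepareInput T a b).2.coeff d) := by
  rw [prepareInput]
  split_ifs
  · exact ⟨isReducedWrt_coeff_repPoly hT _, isReducedWrt_coeff_repPoly hT _⟩
  · exact ⟨isReducedWrt_coeff_repPoly hT _, isReducedWrt_coeff_repPoly hT _⟩

theorem isLoopState_prepareInput (P : (Fin n → MvPolynomial (Fin n) ℚ) → ℕ → ℕ)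
    (hT : IsMonicTriangular T) (a b : (MvPolynomial (Fin n) ℚ)[X]) :
    IsLoopState P T (prepareInput T a b).1 (prepareInput T a b).2 0
      (initDegree (prepareInput T a b)) 1 0 :=
  IsLoopState.init P hT (isReducedWrt_prepareInput hT a b).1 (isReducedWrt_prepareInput hT a b).2

theorem IsGCDOutput.of_prepareInput (hT : IsMonicTriangular T) {out : CGCDOutput n}
    (h : IsGCDOutput (triIdeal T n) (prepareInput T a b).1 (prepareInput T a b).2 out) :
    IsGCDOutput (triIdeal T n) a b out := by
  have key : ∀ (f : (MvPolynomial (Fin n) ℚ)[X]) (d : ℕ),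
      (repPoly T n (projPoly T n f)).coeff d - f.coeff d ∈ triIdeal T n := fun f d => by
    rw [← Ideal.Quotient.eq, ← coeff_projPoly, projPoly_repPoly hT, coeff_projPoly]
  rw [prepareInput] at h
  split_ifs at h
  · exact h.swap.congr (key a) (key b)
  · exact h.congr (key a) (key b)

/-- Both parts of a splitting are again radical triangular sets, so an induction on the fuel covers
the recursive calls as well. Validity of the bound is part of the conclusion because the second call
starts with the value that the first one leaves. -/
theorem mainLoop_spec (hprime : ∀ S i, (P S i).Prime) (hnew : ∀ S, Function.Injective (P S))
    (m : ℕ) : ∀ (T : Fin n → MvPolynomial (Fin n) ℚ) (a b : (MvPolynomial (Fin n) ℚ)[X])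
      (idx dg M : ℕ) (G : (MvPolynomial (Fin n) ℤ)[X]) (B : Option ℕ), IsTriangularSet T →
      (triIdeal T n).IsRadical → IsLoopState P T a b idx dg M G → IsValidBound B →
      ∀ out B', mainLoop P m T a b idx dg M G B = some (out, B') →
        IsGCDOutput (triIdeal T n) a b out ∧ IsValidBound B' := by
  induction m with
  | zero =>
    intro T a b idx dg M G B _ _ _ _ out B' h
    simp [mainLoop] at h
  | succ m IH =>
    intro T a b idx dg M G B hT hrad hst hB out B' h
    have hM := hT.toIsMonicTriangular
    have hcall : ∀ (S : Fin n → MvPolynomial (Fin n) ℚ) (B : Option ℕ), IsTriangularSet S →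
        (triIdeal S n).IsRadical → IsValidBound B →
        ∀ out B', mainCall P m S a b B = some (out, B') →
          IsGCDOutput (triIdeal S n) a b out ∧ IsValidBound B' := by
      intro S B hS hSr hB out B' h
      have := IH S _ _ _ _ _ _ B hS hSr
        (isLoopState_prepareInput P hS.toIsMonicTriangular a b) hB out B' h
      exact ⟨this.1.of_prepareInput hS.toIsMonicTriangular, this.2⟩
    have hp : Fact (P T idx).Prime := ⟨hprime T idx⟩
    have hspec := loopStep_spec (B := B) hprime hnew hM hst
    have hbound := loopStep_validBound (p := P T idx) (a := a) (b := b) (dg := dg) (M := M)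
      (G := G) hM hB
    rw [mainLoop_succ] at h
    cases hx : loopStep (P T idx) T a b dg M G B with
    | next dg' M' G' B₁ =>
      rw [hx] at h hspec hbound
      exact IH T a b _ _ _ _ _ hT hrad hspec hbound out B' h
    | done f =>
      rw [hx] at h hspec
      rw [afterStep, Option.some.injEq, Prod.mk.injEq] at h
      rw [← h.1, ← h.2]
      refine ⟨⟨?_, List.pairwise_singleton _ _, ?_, ?_⟩, hB⟩
      · simpa using ⟨hT, hrad⟩
      · simp
      · simpa using hspec
    | split j u v B₁ =>
      rw [hx] at h hspec hbound
      obtain ⟨α, hα, hu, hv⟩ := hspec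
      simp only at hα hu hv
      rw [afterStep, splitCall, hu, hv] at h
      have hrad' := isRadical_triIdeal_splitAt hT hrad hα
      split at h
      · simp at h
      · rename_i out₁ B₂ h₁
        obtain ⟨ho₁, hB₂⟩ := hcall _ _ (isTriangularSet_splitAt hT hα) hrad'.1 hbound _ _ h₁
        split at h
        · simp at h
        · rename_i out₂ B₃ h₂
          obtain ⟨ho₂, hB₃⟩ := hcall _ _ (isTriangularSet_splitAt hT (hα.cofactor hM)) hrad'.2
            hB₂ _ _ h₂
          rw [Option.some.injEq, Prod.mk.injEq] at h
          rw [← h.1, ← h.2, ← inf_triIdeal_splitAt hM hrad hα]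
          exact ⟨ho₁.append ho₂ (isCoprime_triIdeal_splitAt hT hrad hα), hB₃⟩

theorem mainCall_spec (hprime : ∀ S i, (P S i).Prime) (hnew : ∀ S, Function.Injective (P S))
    {m : ℕ} (hT : IsTriangularSet T) (hrad : (triIdeal T n).IsRadical) (hB : IsValidBound B)
    {out : CGCDOutput n} {B' : Option ℕ} (h : mainCall P m T a b B = some (out, B')) :
    IsGCDOutput (triIdeal T n) a b out ∧ IsValidBound B' := by
  have := mainLoop_spec hprime hnew m T _ _ _ _ _ _ B hT hrad
    (isLoopState_prepareInput P hT.toIsMonicTriangular a b) hB out B' h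
  exact ⟨this.1.of_prepareInput hT.toIsMonicTriangular, this.2⟩

end Correct

end

/-! ### Termination -/

noncomputable section

variable {n : ℕ}

section Terminates

variable {P : (Fin n → MvPolynomial (Fin n) ℚ) → ℕ → ℕ} {T : Fin n → MvPolynomial (Fin n) ℚ}
  {a b : (MvPolynomial (Fin n) ℚ)[X]} {idx dg M : ℕ} {G : (MvPolynomial (Fin n) ℤ)[X]}
  {B : Option ℕ}

/-- The two recursive calls share one amount of fuel, although each terminates with its own;
monotonicity allows passing to the maximum. -/
theorem mainLoop_mono_succ (m : ℕ) : ∀ (T : Fin n → MvPolynomial (Fin n) ℚ)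
    (a b : (MvPolynomial (Fin n) ℚ)[X]) (idx dg M : ℕ) (G : (MvPolynomial (Fin n) ℤ)[X])
    (B : Option ℕ) x, mainLoop P m T a b idx dg M G B = some x →
      mainLoop P (m + 1) T a b idx dg M G B = some x := by
  induction m with
  | zero =>
    intro T a b idx dg M G B x h
    simp [mainLoop] at h
  | succ m IH =>
    intro T a b idx dg M G B x h
    rw [mainLoop_succ] at h ⊢
    cases hx : loopStep (P T idx) T a b dg M G B with
    | next dg' M' G' B' =>
      rw [hx] at h
      exact IH _ _ _ _ _ _ _ _ _ h
    | done f =>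
      rw [hx] at h
      exact h
    | split j u v B' =>
      rw [hx, afterStep, splitCall] at h
      rw [afterStep, splitCall]
      split at h
      · simp at h
      · rename_i out₁ B₁ h₁
        split at h
        · simp at h
        · rename_i out₂ B₂ h₂
          have e₁ : mainCall P (m + 1) (splitAt T j u) a b B' = some (out₁, B₁) :=
            IH _ _ _ _ _ _ _ _ _ h₁
          have e₂ : mainCall P (m + 1) (splitAt T j v) a b B₁ = some (out₂, B₂) :=
            IH _ _ _ _ _ _ _ _ _ h₂
          simp only [e₁, e₂]
          exact h

theorem mainLoop_mono {m m' : ℕ} (hm : m ≤ m') {x : CGCDOutput n × Option ℕ}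
    (h : mainLoop P m T a b idx dg M G B = some x) :
    mainLoop P m' T a b idx dg M G B = some x := by
  induction hm with
  | refl => exact h
  | step _ IH => exact mainLoop_mono_succ _ _ _ _ _ _ _ _ _ _ IH

theorem mainCall_mono {m m' : ℕ} (hm : m ≤ m') {x : CGCDOutput n × Option ℕ}
    (h : mainCall P m T a b B = some x) : mainCall P m' T a b B = some x :=
  mainLoop_mono hm h

/-- The main loop terminates, if it terminates after an iteration that leads to the next prime. -/
theorem terminates_of_next (hprime : ∀ S i, (P S i).Prime) (hnew : ∀ S, Function.Injective (P S))
    (hT : IsMonicTriangular T) (hst : IsLoopState P T a b idx dg M G) (hB : IsValidBound B)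
    (hsplit : ∀ j u v B, IsFactorization T (j, u, v) → IsValidBound B →
      ∃ m x, splitCall P m T a b j u v B = some x)
    (hnext : ∀ dg' M' G' B', loopStep (P T idx) T a b dg M G B = .next dg' M' G' B' →
      IsLoopState P T a b (idx + 1) dg' M' G' → IsValidBound B' →
      ∃ m x, mainLoop P m T a b (idx + 1) dg' M' G' B' = some x) :
    ∃ m x, mainLoop P m T a b idx dg M G B = some x := by
  have hp : Fact (P T idx).Prime := ⟨hprime T idx⟩
  have hspec := loopStep_spec (B := B) hprime hnew hT hst
  have hbound := loopStep_validBound (p := P T idx) (a := a) (b := b) (dg := dg) (M := M)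
    (G := G) hT hB
  cases hx : loopStep (P T idx) T a b dg M G B with
  | next dg' M' G' B' =>
    rw [hx] at hspec hbound
    obtain ⟨m, x, h⟩ := hnext _ _ _ _ hx hspec hbound
    exact ⟨m + 1, x, by rw [mainLoop_succ, hx]; exact h⟩
  | done f => exact ⟨1, _, by rw [mainLoop_succ, hx]; rfl⟩
  | split j u v B' =>
    rw [hx] at hspec hbound
    obtain ⟨m, x, h⟩ := hsplit j u v B' hspec hbound
    exact ⟨m + 1, x, by rw [mainLoop_succ, hx]; exact h⟩

theorem eventually_not_isBadPrime (T : Fin n → MvPolynomial (Fin n) ℚ)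
    (a b : (MvPolynomial (Fin n) ℚ)[X]) : ∀ᶠ p in largePrimes, ¬ IsBadPrime p T a b := by
  have key : ∀ f : (MvPolynomial (Fin n) ℚ)[X],
      ∀ᶠ p in largePrimes, ∀ d, IsIntegralAt p (f.coeff d) := by
    intro f
    have h1 : ∀ᶠ p in largePrimes, ∀ d ∈ f.support, IsIntegralAt p (f.coeff d) :=
      (Filter.eventually_all_finset _).2 fun d _ => eventually_isIntegralAt _
    filter_upwards [h1, eventually_isIntegralAt (0 : MvPolynomial (Fin n) ℚ)] with p h2 h3 d
    by_cases hd : d ∈ f.support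
    · exact h2 d hd
    · rw [notMem_support_iff.1 hd]
      exact h3
  have hlc : ∀ f : (MvPolynomial (Fin n) ℚ)[X],
      ∀ᶠ p in largePrimes, ¬ (f ≠ 0 ∧ mapCoeffs (ratMod p) f.leadingCoeff = 0) := by
    intro f
    by_cases hf : f = 0
    · exact Filter.Eventually.of_forall fun p h => h.1 hf
    · filter_upwards [eventually_mapCoeffs_ne_zero (leadingCoeff_ne_zero.2 hf)] with p hp h
      exact hp h.2
  filter_upwards [eventually_isTriIntegralAt T, key a, key b, hlc a, hlc b]
    with p ⟨_, h1⟩ h2 h3 h4 h5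
  simp only [IsBadPrime, not_or]
  exact ⟨fun ⟨j, e, h⟩ => h1 j e h, fun ⟨d, e, h⟩ => h2 d e h, fun ⟨d, e, h⟩ => h3 d e h, h4, h5⟩

/-- An injective sequence of natural numbers tends to infinity. This is where the requirement that
no prime be picked twice makes large primes unavoidable. -/
theorem eventually_index (hprime : ∀ S i, (P S i).Prime) (hnew : ∀ S, Function.Injective (P S))
    (T : Fin n → MvPolynomial (Fin n) ℚ) {Q : ℕ → Prop} (h : ∀ᶠ p in largePrimes, Q p) :
    ∃ i₀, ∀ i, i₀ ≤ i → Q (P T i) := by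
  have h1 := (hnew T).nat_tendsto_atTop.eventually (eventually_largePrimes.1 h)
  obtain ⟨i₀, hi₀⟩ := Filter.eventually_atTop.1 h1
  exact ⟨i₀, fun i hi => hi₀ i hi (hprime T i)⟩

/-- For large primes the main loop either always meets the same zero-divisor, or it always meets
the reduction of a gcd over the rational numbers. -/
theorem loopStep_eventually (hT : IsMonicTriangular T) (hrad : (triIdeal T n).IsRadical)
    (ha : ∀ d, IsReducedWrt T n (a.coeff d)) (hb : ∀ d, IsReducedWrt T n (b.coeff d)) :
    (∃ j w, IsLevelFactor T j w ∧ ∀ᶠ p in largePrimes, ∀ dg M G B,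
      loopStep p T a b dg M G B = zeroDivisorStep p T dg M G B (redZeroDivisor p T j w)) ∨
    ∃ γ, IsMonicCommonDivisor T a b γ ∧ ∀ᶠ p in largePrimes, ∃ g, g.natDegree = γ.natDegree ∧
      ∀ dg M G B, loopStep p T a b dg M G B = imageStep p T a b dg M G B g := by
  have hra := repPoly_projPoly hT ha
  have hrb := repPoly_projPoly hT hb
  have hbad := eventually_not_isBadPrime T a b
  rcases isRadicalPrime_eventually hT hrad n le_rfl with hR | ⟨j, w, hw, -, hR⟩
  · have hE : ∀ p, euclidMod p T a b = monicEuclid (invLevel p (triMod p T) n)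
        (redPoly p T n (projPoly T n a)) (redPoly p T n (projPoly T n b)) := fun p => by
      rw [redPoly, redPoly, hra, hrb, euclidMod]
    rcases monicEuclid_eventually hT le_rfl (invLevel_eventually hT n le_rfl)
      (lowPolys_top T (projPoly T n a)) (lowPolys_top T (projPoly T n b)) with
      ⟨γ, s, t, hev, hbez⟩ | ⟨j, w, hw, -, hev⟩
    · refine Or.inr ⟨γ, ⟨hbez.dvd_left, hbez.dvd_right, ?_⟩, ?_⟩
      · have hz : ∀ {f : (MvPolynomial (Fin n) ℚ)[X]}, repPoly T n (projPoly T n f) = f →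
            projPoly T n f = 0 → f = 0 := fun hf h => by rw [← hf, h, repPoly_zero hT]
        by_cases h0 : a = 0 ∧ b = 0
        · refine Or.inr ⟨?_, h0⟩
          rw [hbez.bezout, h0.1, h0.2, map_zero, mul_zero, mul_zero, add_zero]
        · exact Or.inl ⟨hbez.monic.resolve_right fun h => h0 ⟨hz hra h.1, hz hrb h.2.1⟩, h0⟩
      · filter_upwards [hbad, hR, hev.2.2.2, eventually_natDegree_redPoly hT γ] with p h1 h2 h3 h4
        refine ⟨redPoly p T n γ, h4, fun dg M G B => ?_⟩
        rw [loopStep, if_neg h1, h2, hE, h3]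
    · refine Or.inl ⟨j, w, hw, ?_⟩
      filter_upwards [hbad, hR, hev] with p h1 h2 h3 dg M G B
      rw [loopStep, if_neg h1, h2, hE, h3]
  · refine Or.inl ⟨j, w, hw, ?_⟩
    filter_upwards [hbad, hR] with p h1 h2 dg M G B
    rw [loopStep, if_neg h1, h2]

/-- It is enough to consider the iterations with large index. -/
theorem terminates_of_large (hprime : ∀ S i, (P S i).Prime)
    (hnew : ∀ S, Function.Injective (P S)) (hT : IsMonicTriangular T)
    (hsplit : ∀ j u v B, IsFactorization T (j, u, v) → IsValidBound B →
      ∃ m x, splitCall P m T a b j u v B = some x) {i₀ : ℕ}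
    (h : ∀ idx dg M G B, i₀ ≤ idx → IsLoopState P T a b idx dg M G → IsValidBound B →
      ∃ m x, mainLoop P m T a b idx dg M G B = some x) (r : ℕ) :
    ∀ idx dg M G B, i₀ ≤ idx + r → IsLoopState P T a b idx dg M G → IsValidBound B →
      ∃ m x, mainLoop P m T a b idx dg M G B = some x := by
  induction r with
  | zero => exact h
  | succ r IH =>
    intro idx dg M G B hi hst hB
    exact terminates_of_next hprime hnew hT hst hB hsplit fun dg' M' G' B' _ hst' hB' =>
      IH _ _ _ _ _ (by omega) hst' hB'

/-- `k` bounds the distance of the next bound from `H`. Each failed lifting shortens it by at least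
one, and at `k = 0` the iteration must split. -/
theorem terminates_of_zeroDivisor (hprime : ∀ S i, (P S i).Prime)
    (hnew : ∀ S, Function.Injective (P S)) (hT : IsMonicTriangular T)
    (hsplit : ∀ j u v B, IsFactorization T (j, u, v) → IsValidBound B →
      ∃ m x, splitCall P m T a b j u v B = some x) {i₀ H : ℕ}
    (h : ∀ i, i₀ ≤ i → ∀ dg M G B, H ≤ nextBound B → ∃ j u v B',
      loopStep (P T i) T a b dg M G B = .split j u v B')
    (h' : ∀ i, i₀ ≤ i → ∀ dg M G B, IsValidBound B → ∀ dg' M' G' B',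
      loopStep (P T i) T a b dg M G B = .next dg' M' G' B' → nextBound B + 1 ≤ nextBound B')
    (k : ℕ) :
    ∀ idx dg M G B, i₀ ≤ idx → H ≤ nextBound B + k → IsLoopState P T a b idx dg M G →
      IsValidBound B → ∃ m x, mainLoop P m T a b idx dg M G B = some x := by
  induction k with
  | zero =>
    intro idx dg M G B hi hH hst hB
    refine terminates_of_next hprime hnew hT hst hB hsplit fun dg' M' G' B' hx _ _ => ?_
    obtain ⟨j, u, v, B', h1⟩ := h idx hi dg M G B hH
    rw [h1] at hx
    cases hx
  | succ k IH =>
    intro idx dg M G B hi hH hst hB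
    refine terminates_of_next hprime hnew hT hst hB hsplit fun dg' M' G' B' hx hst' hB' => ?_
    have := h' idx hi _ _ _ _ hB _ _ _ _ hx
    exact IH _ _ _ _ _ (by omega) (by omega) hst' hB'

/-- `k` bounds the distance of the modulus from `H`. Once `dg = deg γ`, every unsuccessful iteration
multiplies the modulus by a prime and leaves it below `H`. -/
theorem terminates_of_image (hprime : ∀ S i, (P S i).Prime)
    (hnew : ∀ S, Function.Injective (P S)) (hT : IsMonicTriangular T)
    (hsplit : ∀ j u v B, IsFactorization T (j, u, v) → IsValidBound B →
      ∃ m x, splitCall P m T a b j u v B = some x) {γ : (TriQuot T n)[X]}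
    (hγ : IsMonicCommonDivisor T a b γ) {i₀ H : ℕ}
    (hH : ∀ m, H ≤ m → HasHeightLT m (repPoly T n γ))
    (h : ∀ i, i₀ ≤ i → ∃ g : (TriQuot (triMod (P T i) T) n)[X], g.natDegree = γ.natDegree ∧
      ∀ dg M G B, loopStep (P T i) T a b dg M G B = imageStep (P T i) T a b dg M G B g)
    (k : ℕ) :
    ∀ idx M G B, i₀ ≤ idx → H ≤ M + k → IsLoopState P T a b idx γ.natDegree M G →
      IsValidBound B → ∃ m x, mainLoop P m T a b idx γ.natDegree M G B = some x := by
  have key : ∀ idx M G B, i₀ ≤ idx → IsLoopState P T a b idx γ.natDegree M G →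
      ∀ dg' M' G' B', loopStep (P T idx) T a b γ.natDegree M G B = .next dg' M' G' B' →
      IsLoopState P T a b (idx + 1) dg' M' G' →
      dg' = γ.natDegree ∧ M + 1 ≤ M' ∧ M' < H := by
    intro idx M G B hi hst dg' M' G' B' hx hst'
    obtain ⟨g, hg, hstep⟩ := h idx hi
    rw [hstep] at hx
    rcases imageStep_cases T a b M G B hg.le with ⟨f, -, -, -, h2⟩ | ⟨h1, h2⟩
    · rw [h2] at hx
      cases hx
    · rw [h2, LoopStep.next.injEq] at hx
      obtain ⟨hx1, hx2, hx3, -⟩ := hx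
      rw [hx2, hx3] at h1
      have hdg : dg' = γ.natDegree := by rw [← hx1, hg]
      refine ⟨hdg, ?_, ?_⟩
      · rw [if_pos hg] at hx2
        rw [← hx2]
        have := (hprime T idx).two_le
        have := hst.pos
        nlinarith
      · by_contra hle
        -- With the new modulus at least `H`, the reconstruction would have been `γ`, and `γ` passes
        -- both trial divisions.
        refine h1 _ (((hst'.approx γ hγ).2 hdg).ratReconPoly_eq (hH _ (not_lt.1 hle))) ?_
        rw [projPoly_repPoly hT]
        exact ⟨hγ.1, hγ.2.1⟩
  induction k with
  | zero =>
    intro idx M G B hi hHM hst hB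
    refine terminates_of_next hprime hnew hT hst hB hsplit fun dg' M' G' B' hx hst' _ => ?_
    have := key idx M G B hi hst _ _ _ _ hx hst'
    omega
  | succ k IH =>
    intro idx M G B hi hHM hst hB
    refine terminates_of_next hprime hnew hT hst hB hsplit fun dg' M' G' B' hx hst' hB' => ?_
    obtain ⟨rfl, h1, h2⟩ := key idx M G B hi hst _ _ _ _ hx hst'
    exact IH _ _ _ _ (by omega) (by omega) hst' hB'

theorem terminates_of_split (hprime : ∀ S i, (P S i).Prime)
    (hnew : ∀ S, Function.Injective (P S)) (hT : IsMonicTriangular T)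
    (hrad : (triIdeal T n).IsRadical)
    (hsplit : ∀ j u v B, IsFactorization T (j, u, v) → IsValidBound B →
      ∃ m x, splitCall P m T a b j u v B = some x)
    (hst : IsLoopState P T a b idx dg M G) (hB : IsValidBound B) :
    ∃ m x, mainLoop P m T a b idx dg M G B = some x := by
  rcases loopStep_eventually hT hrad hst.left hst.right with ⟨j, w, hw, hev⟩ | ⟨γ, hγ, hev⟩
  · obtain ⟨H, hH⟩ := handleZeroDivisor_eventually hT hrad j w hw
    obtain ⟨i₀, hi₀⟩ := eventually_index hprime hnew T (hev.and hH)
    refine terminates_of_large hprime hnew hT hsplit (i₀ := i₀) (fun idx dg M G B hi hst hB => ?_)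
      i₀ idx dg M G B (by omega) hst hB
    refine terminates_of_zeroDivisor hprime hnew hT hsplit (i₀ := i₀) (H := H) ?_ ?_ H idx dg M G B
      hi (by omega) hst hB
    · intro i hi dg M G B hHB
      obtain ⟨⟨j', u, v⟩, hx⟩ := (hi₀ i hi).2 n B j.isLt hHB
      rw [(hi₀ i hi).1, zeroDivisorStep]
      rcases hz : handleZeroDivisor (P T i) T n B (redZeroDivisor (P T i) T j w) with ⟨o, B'⟩
      rw [hz] at hx
      simp only at hx
      rw [hx]
      exact ⟨_, _, _, _, rfl⟩
    · intro i hi dg M G B hB dg' M' G' B' hx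
      rw [(hi₀ i hi).1, zeroDivisorStep] at hx
      have h2 := (handleZeroDivisor_validBound (T := T) hB
        (redZeroDivisor (P T i) T j w)).2
      rcases hz : handleZeroDivisor (P T i) T n B (redZeroDivisor (P T i) T j w) with
        ⟨_ | ⟨j', u, v⟩, B''⟩
      · rw [hz] at hx h2
        simp only [LoopStep.next.injEq] at hx
        rw [← hx.2.2.2]
        exact h2
      · rw [hz] at hx
        cases hx
  · obtain ⟨H, hH⟩ := exists_hasHeightLT (repPoly T n γ)
    obtain ⟨i₀, hi₀⟩ := eventually_index hprime hnew T hev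
    refine terminates_of_large hprime hnew hT hsplit (i₀ := i₀) (fun idx dg M G B hi hst hB => ?_)
      i₀ idx dg M G B (by omega) hst hB
    -- One large prime brings `dg` down to `deg γ`: by the invariant `dg` was never smaller, so its
    -- image is not rejected.
    refine terminates_of_next hprime hnew hT hst hB hsplit fun dg' M' G' B' hx hst' hB' => ?_
    obtain ⟨g, hg, hstep⟩ := hi₀ idx hi
    rw [hstep] at hx
    have hdg : dg' = γ.natDegree := by
      rcases imageStep_cases T a b M G B (hg.le.trans (hst.approx γ hγ).1) with
        ⟨f, -, -, -, h2⟩ | ⟨-, h2⟩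
      · rw [h2] at hx
        cases hx
      · rw [h2, LoopStep.next.injEq] at hx
        rw [← hx.1, hg]
    subst hdg
    exact terminates_of_image hprime hnew hT hsplit hγ hH hi₀ H _ _ _ _ (by omega) (by omega)
      hst' hB'

/-- The main loop terminates. -/
theorem mainLoop_terminates (hprime : ∀ S i, (P S i).Prime)
    (hnew : ∀ S, Function.Injective (P S)) (N : ℕ) :
    ∀ T : Fin n → MvPolynomial (Fin n) ℚ, IsTriangularSet T → (triIdeal T n).IsRadical →
      ∑ l, (T l).degreeOf l = N → ∀ a b idx dg M G B, IsLoopState P T a b idx dg M G →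
      IsValidBound B → ∃ m x, mainLoop P m T a b idx dg M G B = some x := by
  induction N using Nat.strong_induction_on with
  | _ N IH =>
  intro T hT hrad hN a b idx dg M G B hst hB
  have hM := hT.toIsMonicTriangular
  refine terminates_of_split hprime hnew hM hrad ?_ hst hB
  rintro j u v B ⟨α, hα, hu, hv⟩ hB
  simp only at hα hu hv
  have hβ := hα.cofactor hM
  have hrad' := isRadical_triIdeal_splitAt hT hrad hα
  have hcall : ∀ {α} (B : Option ℕ), IsLevelFactor T j α →
      (triIdeal (splitAt T j (repPoly T j α)) n).IsRadical → IsValidBound B →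
      ∃ m x, mainCall P m (splitAt T j (repPoly T j α)) a b B = some x := by
    intro α B hα hr hB
    have hS := isTriangularSet_splitAt hT hα
    exact IH _ (hN ▸ sum_degreeOf_splitAt_lt hM hα) _ hS hr rfl _ _ _ _ _ _ _
      (isLoopState_prepareInput P hS.toIsMonicTriangular a b) hB
  obtain ⟨m₁, ⟨out₁, B₁⟩, h₁⟩ := hcall B hα hrad'.1 hB
  have hB₁ := (mainCall_spec hprime hnew (isTriangularSet_splitAt hT hα) hrad'.1 hB h₁).2
  obtain ⟨m₂, ⟨out₂, B₂⟩, h₂⟩ := hcall B₁ hβ hrad'.2 hB₁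
  -- The second call was started from the bound that the first one returned, so the two fuels are
  -- found one after the other.
  refine ⟨max m₁ m₂, (out₁ ++ out₂, B₂), ?_⟩
  rw [splitCall, hu, hv, mainCall_mono (le_max_left m₁ m₂) h₁]
  simp only
  rw [mainCall_mono (le_max_right m₁ m₂) h₂]

end Terminates

end

/-! ### The product decomposition and the main theorem -/

noncomputable section

/-- The isomorphism with the product of the residue class rings, for an output. -/
theorem IsGCDOutput.exists_ringEquiv {n : ℕ} {T : Fin n → MvPolynomial (Fin n) ℚ}
    {a b : (MvPolynomial (Fin n) ℚ)[X]} {out : CGCDOutput n}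
    (h : IsGCDOutput (triIdeal T n) a b out) :
    ∃ e : TriQuot T n ≃+* (∀ i : Fin out.length, TriQuot (out.get i).1 n),
      ∀ f i, e (Ideal.Quotient.mk _ f) i = Ideal.Quotient.mk _ f := by
  have hinf : triIdeal T n = ⨅ i : Fin out.length, triIdeal (out.get i).1 n := by
    rw [← h.inter]
    apply le_antisymm
    · exact le_iInf fun i => iInf₂_le _ (List.get_mem out i)
    · refine le_iInf₂ fun c hc => ?_
      obtain ⟨i, rfl⟩ := List.get_of_mem hc
      exact iInf_le _ i
  have hco : Pairwise fun i j : Fin out.length =>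
      IsCoprime (triIdeal (out.get i).1 n) (triIdeal (out.get j).1 n) := by
    have h1 := List.pairwise_iff_get.1 h.comaximal
    intro i j hij
    rcases lt_or_gt_of_ne hij with hlt | hlt
    · exact h1 i j hlt
    · exact (h1 j i hlt).symm
  exact ⟨(Ideal.quotEquivOfEq hinf).trans (Ideal.quotientInfRingEquivPiQuotient _ hco),
    fun f i => rfl⟩

theorem IsGCDOutput.isCorrectCGCD {n : ℕ} {T : Fin n → MvPolynomial (Fin n) ℚ}
    (hT : IsMonicTriangular T) {a b : (TriQuot T n)[X]} {out : CGCDOutput n}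
    (h : IsGCDOutput (triIdeal T n) (repPoly T n a) (repPoly T n b) out) :
    IsCorrectCGCD T a b out := by
  refine ⟨h.triangular, h.comaximal, h.inter, ?_⟩
  obtain ⟨e, he⟩ := h.exists_ringEquiv
  refine ⟨e, he, fun i => ?_⟩
  have key : ∀ f : (TriQuot T n)[X], f.map ((Pi.evalRingHom
      (fun i : Fin out.length => TriQuot (out.get i).1 n) i).comp
      (e : TriQuot T n →+* (∀ i : Fin out.length, TriQuot (out.get i).1 n))) =
      projPoly (out.get i).1 n (repPoly T n f) := by
    intro f
    ext1 d
    rw [coeff_map, coeff_projPoly, coeff_repPoly hT]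
    conv_lhs => rw [← mk_normalForm hT (f.coeff d)]
    exact he _ i
  rw [key, key]
  exact h.gcd _ (List.get_mem out i)

theorem theorem4 (n : ℕ) (T : Fin n → MvPolynomial (Fin n) ℚ)
    (hT : IsTriangularSet T) (hrad : (triIdeal T n).IsRadical)
    (a b : (TriQuot T n)[X])
    (P : (Fin n → MvPolynomial (Fin n) ℚ) → ℕ → ℕ)
    (hprime : ∀ S i, (P S i).Prime) (hnew : ∀ S, Function.Injective (P S)) :
    (∃ out, ModularCGCDOutputs P T a b out) ∧
      ∀ out, ModularCGCDOutputs P T a b out → IsCorrectCGCD T a b out := by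
  have hM := hT.toIsMonicTriangular
  have hst := isLoopState_prepareInput P hM (repPoly T n a) (repPoly T n b)
  constructor
  · obtain ⟨m, ⟨out, B⟩, h⟩ := mainLoop_terminates hprime hnew _ T hT hrad rfl _ _ _ _ _ _ none hst
      isValidBound_none
    exact ⟨out, m, B, h⟩
  · rintro out ⟨m, B, h⟩
    exact (mainCall_spec hprime hnew hT hrad isValidBound_none h).1.isCorrectCGCD hM

end
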